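/- Let $M$ and $N$ be smooth finite-dimensional manifolds endowed with smooth connections $\nabla^M$, $\nabla^N$ on their tangent bundles (not assumed symmetric), with torsion tensors $T^M,T^N$ and curvature tensors $R^M,R^N$. Let $x_0\in M$, $y_0\in N$ and let $\sigma_0:T_{x_0}M\to T_{y_0}N$ be a linear map. Let $U$ be an open subset of $T_{x_0}M$ which contains $0$, is star-shaped at $0$, is contained in the domain of the exponential map of $M$ at $x_0$, and is carried diffeomorphically by that map onto an open subset $V$ of $M$. Assume that $\sigma_0(U)$ is contained in the domain of the exponential map of $N$ at $y_0$. For each $x\in V$ let $\gamma_x:[0,1]\to M$ be the geodesic with $\gamma_x(0)=x_0$, $\gamma_x'(0)\in U$ and $\gamma_x(1)=x$; let $\mu_x:[0,1]\to N$ be the geodesic with $\mu_x(0)=y_0$ and $\mu_x'(0)=\sigma_0(\gamma_x'(0))$; and let $\sigma_x:T_xM\to T_{\mu_x(1)}N$ be the linear map obtained by composing parallel transport along $\gamma_x$ from $x$ back to $x_0$, the map $\sigma_0$, and parallel transport along $\mu_x$ from $y_0$ to $\mu_x(1)$. Then such $\gamma_x$, $\mu_x$, $\sigma_x$ exist for all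 $x\in V$. Moreover, if for all $x\in V$ the map $\sigma_x$ relates $T^M$ with $T^N$ and $R^M$ with $R^N$, i.e. $$\sigma_x\big(T^M(u,v)\big)=T^N\big(\sigma_x u,\sigma_x v\big),\qquad \sigma_x\big(R^M(u,v)w\big)=R^N\big(\sigma_x u,\sigma_x v\big)\,\sigma_x w$$ for all $u,v,w\in T_xM$, then the map $f:V\to N$, $f(x)=\mu_x(1)$, is smooth and affine, that is, $$\mathrm df_x(\nabla^M_vX)=\nabla^N_v(\mathrm df\circ X)$$ for all $x\in V$, $v\in T_xM$ and all smooth vector fields $X$ on $V$ (where $\mathrm df\circ X$ is differentiated as a vector field along $f$), and $\mathrm df(x)=\sigma_x$ for all $x\in V$; in particular $f(x_0)=y_0$ and $\mathrm df(x_0)=\sigma_0$. -/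

import Mathlib

open Set Bundle Manifold
open scoped Manifold ContDiff

namespace CovariantDerivative

noncomputable section

variable {E : Type*} [NormedAddCommGroup E] [NormedSpace ℝ E]
  {H : Type*} [TopologicalSpace H] {I : ModelWithCorners ℝ E H}
  {M : Type*} [TopologicalSpace M] [ChartedSpace H M] [IsManifold I ∞ M]
  {E' : Type*} [NormedAddCommGroup E'] [NormedSpace ℝ E']
  {H' : Type*} [TopologicalSpace H'] {I' : ModelWithCorners ℝ E' H'}
  {N : Type*} [TopologicalSpace N] [ChartedSpace H' N] [IsManifold I' ∞ N]
  {E₁ : Type*} [NormedAddCommGroup E₁] [NormedSpace ℝ E₁]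
  {H₁ : Type*} [TopologicalSpace H₁] {I₁ : ModelWithCorners ℝ E₁ H₁}
  {P : Type*} [TopologicalSpace P] [ChartedSpace H₁ P]

/-- `∇_X ∇_Y Z - ∇_Y ∇_X Z - ∇_{[X, Y]} Z` at the point `x`, for vector fields `X`, `Y`, `Z`.
Recall that `cov Z x v` is `∇_v Z`. -/
def curvatureField (cov : CovariantDerivative I E (TangentSpace I : M → Type _))
    (X Y Z : Π x : M, TangentSpace I x) (x : M) : TangentSpace I x :=
  cov (fun y ↦ cov Z y (Y y)) x (X x) - cov (fun y ↦ cov Z y (X y)) x (Y x)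
    - cov Z x (VectorField.mlieBracket I X Y x)

/-- The curvature tensor `R_x(u, v) w` of a connection on the tangent bundle. The expression
`curvatureField` is tensorial, so it may be evaluated on any extensions of `u`, `v`, `w` to vector
fields that are smooth near `x`; `FiberBundle.extend` gives the fields that are constant in the
preferred trivialization at `x`. -/
def curvature (cov : CovariantDerivative I E (TangentSpace I : M → Type _)) (x : M)
    (u v w : TangentSpace I x) : TangentSpace I x :=
  cov.curvatureField (FiberBundle.extend E u) (FiberBundle.extend E v) (FiberBundle.extend E w) x

/-- The covariant derivative `∇_v ξ` at `p`, for `v ∈ T_p P`, of a vector field `ξ` along a map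
(the derivative for the pull-back connection). A vector field along `h : P → M` is given as a map
`ξ : P → TM` with base map `h = π ∘ ξ`, and derivatives are taken within the set `s`.

Let `e` be the preferred trivialization of `TM` at `h p`. Writing `ξ q = ∑ ξⁱ(q) • Sᵢ(h q)` with
`Sᵢ` the local frame that is constant in `e`, this is the usual formula
`∑ dξⁱ(v) • Sᵢ(h p) + ∇_{dh(v)} (∑ ξⁱ(p) • Sᵢ)`. -/
def covAlong (cov : CovariantDerivative I E (TangentSpace I : M → Type _))
    (ξ : P → TangentBundle I M) (s : Set P) (p : P) (v : TangentSpace I₁ p) :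
    TangentSpace I (ξ p).proj :=
  (trivializationAt E (TangentSpace I : M → Type _) (ξ p).proj).symmL ℝ (ξ p).proj
      (mfderivWithin I₁ 𝓘(ℝ, E)
        (fun q ↦ (trivializationAt E (TangentSpace I : M → Type _) (ξ p).proj (ξ q)).2) s p v)
    + cov (FiberBundle.extend E (ξ p).2) (ξ p).proj
        (mfderivWithin I₁ I (fun q ↦ (ξ q).proj) s p v)

/-- The velocity `t ↦ (γ t, γ' t)` of a curve, the derivative being taken within `s`. -/
def velocity (I : ModelWithCorners ℝ E H) {M : Type*} [TopologicalSpace M] [ChartedSpace H M]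
    (γ : ℝ → M) (s : Set ℝ) (t : ℝ) : TangentBundle I M :=
  tangentMapWithin 𝓘(ℝ, ℝ) I γ s ⟨t, (1 : ℝ)⟩

/-- The curve `ξ` in `TM` is, on the interval `s`, a smooth parallel vector field along its base
curve: `D ξ / dt = 0`. -/
def IsParallelOn (cov : CovariantDerivative I E (TangentSpace I : M → Type _))
    (ξ : ℝ → TangentBundle I M) (s : Set ℝ) : Prop :=
  ContMDiffOn 𝓘(ℝ, ℝ) I.tangent ∞ ξ s ∧
    ∀ t ∈ s, cov.covAlong (I₁ := 𝓘(ℝ, ℝ)) ξ s t (1 : ℝ) = 0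

/-- `γ` is a geodesic on the interval `s`: it is smooth and `D γ' / dt = 0`. -/
def IsGeodesicOn (cov : CovariantDerivative I E (TangentSpace I : M → Type _))
    (γ : ℝ → M) (s : Set ℝ) : Prop :=
  ContMDiffOn 𝓘(ℝ, ℝ) I ∞ γ s ∧
    ∀ t ∈ s, cov.covAlong (I₁ := 𝓘(ℝ, ℝ)) (velocity I γ s) s t (1 : ℝ) = 0

/-- `v ∈ T_x M` belongs to the domain of the exponential map at `x`: there is a geodesic defined on
`[0, 1]` that starts at `x` with velocity `v`. -/
def expDomain (cov : CovariantDerivative I E (TangentSpace I : M → Type _)) (x : M) :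
    Set (TangentSpace I x) :=
  {v | ∃ γ : ℝ → M, cov.IsGeodesicOn γ (Icc 0 1) ∧ velocity I γ (Icc 0 1) 0 = ⟨x, v⟩}

open Classical in
/-- The exponential map at `x`: the endpoint `γ 1` of the geodesic `γ : [0, 1] → M` that starts
at `x` with velocity `v` (and the irrelevant value `x` if `v` is not in the domain). -/
def expMap (cov : CovariantDerivative I E (TangentSpace I : M → Type _)) (x : M)
    (v : TangentSpace I x) : M :=
  if h : v ∈ cov.expDomain x then h.choose 1 else x

/-- Parallel transport along `γ` from time `a` to time `b` sends the tangent vector `p` at `γ a` to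
the tangent vector `q` at `γ b`. -/
def IsParallelTransport (cov : CovariantDerivative I E (TangentSpace I : M → Type _))
    (γ : ℝ → M) (a b : ℝ) (p q : TangentBundle I M) : Prop :=
  ∃ ξ : ℝ → TangentBundle I M, cov.IsParallelOn ξ (Icc a b) ∧
    (∀ t ∈ Icc a b, (ξ t).proj = γ t) ∧ ξ a = p ∧ ξ b = q

/-- `μ : [a, b] → N` is the geodesic induced by the geodesic `γ : [a, b] → M` with `γ a = x₀` and by
the linear map `σ₀ : T_{x₀} M → T_{y₀} N`: it is the geodesic with `μ a = y₀` and
`μ' a = σ₀ (γ' a)`. -/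
def IsInducedGeodesic (covN : CovariantDerivative I' E' (TangentSpace I' : N → Type _))
    {x₀ : M} {y₀ : N} (σ₀ : TangentSpace I x₀ →L[ℝ] TangentSpace I' y₀)
    (γ : ℝ → M) (a b : ℝ) (μ : ℝ → N) : Prop :=
  covN.IsGeodesicOn μ (Icc a b) ∧
    ∃ u : TangentSpace I x₀, velocity I γ (Icc a b) a = ⟨x₀, u⟩ ∧
      velocity I' μ (Icc a b) a = ⟨y₀, σ₀ u⟩

/-- `σ : T_x M → T_y N`, where `x = γ b` and `y = μ b`, is the linear map induced by the geodesic
`γ : [a, b] → M` and by `σ₀`, where `μ` is the geodesic induced by `γ` and `σ₀`: it is the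
composition of the parallel transport along `γ` from `x` back to `x₀`, of `σ₀`, and of the parallel
transport along `μ` from `y₀` to `y`. -/
def IsInducedMap (covM : CovariantDerivative I E (TangentSpace I : M → Type _))
    (covN : CovariantDerivative I' E' (TangentSpace I' : N → Type _))
    {x₀ : M} {y₀ : N} (σ₀ : TangentSpace I x₀ →L[ℝ] TangentSpace I' y₀)
    (γ : ℝ → M) (μ : ℝ → N) (a b : ℝ) {x : M} {y : N}
    (σ : TangentSpace I x →L[ℝ] TangentSpace I' y) : Prop :=
  ∀ v : TangentSpace I x, ∃ u : TangentSpace I x₀,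
    covM.IsParallelTransport γ a b ⟨x₀, u⟩ ⟨x, v⟩ ∧
    covN.IsParallelTransport μ a b ⟨y₀, σ₀ u⟩ ⟨y, σ v⟩

/-- `f` is an affine map on the open set `V`: it is smooth on `V` and
`df_x (∇_v X) = ∇_v (df ∘ X)` for all `x ∈ V`, `v ∈ T_x M` and all smooth vector fields `X` on `V`,
where `df ∘ X` is a vector field along `f`. -/
def IsAffineOn (covM : CovariantDerivative I E (TangentSpace I : M → Type _))
    (covN : CovariantDerivative I' E' (TangentSpace I' : N → Type _))
    (f : M → N) (V : Set M) : Prop :=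
  ContMDiffOn I I' ∞ f V ∧
    ∀ X : Π x : M, TangentSpace I x,
      ContMDiffOn I I.tangent ∞ (fun q ↦ (⟨q, X q⟩ : TangentBundle I M)) V →
      ∀ x ∈ V, ∀ v : TangentSpace I x,
        mfderiv I I' f x (covM X x v) =
          covN.covAlong (I₁ := I) (fun q ↦ tangentMap I I' f ⟨q, X q⟩) V x v

/-- `F` carries the subset `U` of `E` diffeomorphically onto `V`: it is smooth on `U`, it is a
bijection from `U` onto `V`, and the inverse bijection is smooth on `V`. -/
def CarriesDiffeomorphically (I : ModelWithCorners ℝ E H) {M : Type*} [TopologicalSpace M]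
    [ChartedSpace H M] (F : E → M) (U : Set E) (V : Set M) : Prop :=
  ContMDiffOn 𝓘(ℝ, E) I ∞ F U ∧ BijOn F U V ∧
    ∃ G : M → E, ContMDiffOn I 𝓘(ℝ, E) ∞ G V ∧ InvOn G F U V

/-- The data of the local theorem, for every `x ∈ V`: `γ x : [0, 1] → M` is the geodesic that starts
at `x₀` with velocity in `U` and ends at `x`; `μ x : [0, 1] → N` and `σ x : T_x M → T_{μ x 1} N` are
the geodesic and the linear map induced by `γ x` and `σ₀`. -/
def IsRadialData (covM : CovariantDerivative I E (TangentSpace I : M → Type _))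
    (covN : CovariantDerivative I' E' (TangentSpace I' : N → Type _))
    {x₀ : M} {y₀ : N} (σ₀ : TangentSpace I x₀ →L[ℝ] TangentSpace I' y₀)
    (U : Set (TangentSpace I x₀)) (V : Set M) (γ : M → ℝ → M) (μ : M → ℝ → N)
    (σ : ∀ x : M, TangentSpace I x →L[ℝ] TangentSpace I' (μ x 1)) : Prop :=
  ∀ x ∈ V,
    (covM.IsGeodesicOn (γ x) (Icc 0 1) ∧
      (∃ u ∈ U, velocity I (γ x) (Icc 0 1) 0 = ⟨x₀, u⟩) ∧ γ x 1 = x) ∧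
    covN.IsInducedGeodesic σ₀ (γ x) 0 1 (μ x) ∧
    IsInducedMap covM covN σ₀ (γ x) (μ x) 0 1 (σ x)

end

end CovariantDerivative

/-! Let `x u` and `y u` be the endpoints of the geodesics with initial velocities `u` and `σ₀ u`,
and let `P u`, `Q u` be the parallel frames along them, equal to the identity at time 0 and
evaluated at time 1. Then `σ` carries `P u k` to `Q u (σ₀ k)` and `f ∘ x = y`, so both assertions
concern the forms `θ = P⁻¹ dx`, `ω = P⁻¹ ∇P` on `U` and their analogues `θ'`, `ω'` for `Q`, `y`.

Cartan's structure equations, restricted to a ray, are a linear differential equation. On the `N`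
side, where the velocity of the ray is `Q (L u)` with `L = σ₀`, the values `θ'(t)`, `ω'(t)` of the
forms at `t u` on the vector `t w` satisfy `dθ'/dt = ω' (L u) + L w + Q⁻¹ T(Q L u, Q θ')` and
`dω'/dt = Q⁻¹ R(Q L u, Q θ') Q`, and both vanish at `t = 0`; on the `M` side `L` is the identity.
That `σ` relates torsions and curvatures says exactly that `(σ₀ θ, σ₀ ω)` solves the same equation
as `(θ', ω' σ₀)`. By uniqueness `θ' = σ₀ θ` and `ω' σ₀ = σ₀ ω`. The first identity gives `df = σ`.
The second gives affinity: if `X = P k`, then `∇X = P (dk + ω k)`, whereas `df X = Q σ₀ k` has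
covariant derivative `Q (σ₀ dk + ω' σ₀ k)`.

The structure equations are `hasDerivAt_frameForm` and `hasDerivAt_frameConn`, the comparison is
`IsRadialFrame.solder_eq_and_connForm_eq`, and the conclusions are drawn in
`hasMFDerivAt_of_solder_eq` and `apply_cov_eq_covAlong`.

The analytic input is that `x`, `y`, `P`, `Q` are smooth in `u`. A geodesic with a parallel frame
is, in a chart, an integral curve of `devField`; local smoothness of flows (`exists_smooth_flow`) is
propagated along the geodesic by `Icc_chain` in `isSmoothFrameAt_of_isDevelopment`. Uniqueness
(`IsDevelopment.eqOn`) also shows that the frame for `t u` at time 1 is the frame for `u` at time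
`t`, so that the frames are parallel along rays. -/

open Filter Topology

universe u

set_option linter.unusedSectionVars false
set_option synthInstance.maxHeartbeats 400000

/-! ### Smoothness of superposition operators on spaces of continuous functions. -/

namespace ContinuousMap

variable {K : Type*} [TopologicalSpace K] [CompactSpace K]

/-- The bilinear map on spaces of continuous functions which a continuous bilinear map induces
pointwise. -/
noncomputable def postcompBilin (K : Type*) [TopologicalSpace K] [CompactSpace K]
    {A E G : Type*} [NormedAddCommGroup A] [NormedSpace ℝ A] [NormedAddCommGroup E]
    [NormedSpace ℝ E] [NormedAddCommGroup G] [NormedSpace ℝ G] (L : A →L[ℝ] E →L[ℝ] G) :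
    C(K, A) →L[ℝ] C(K, E) →L[ℝ] C(K, G) :=
  LinearMap.mkContinuous₂
    (LinearMap.mk₂ ℝ (fun (A : C(K, A)) (h : C(K, E)) ↦
        (⟨fun k ↦ L (A k) (h k), by fun_prop⟩ : C(K, G)))
      (fun _ _ _ ↦ by ext; simp) (fun _ _ _ ↦ by ext; simp)
      (fun _ _ _ ↦ by ext; simp) (fun _ _ _ ↦ by ext; simp)) ‖L‖
    (fun A h ↦ by
      rw [ContinuousMap.norm_le _ (by positivity)]
      intro k
      exact (L.le_opNorm₂ _ _).trans
        (mul_le_mul (mul_le_mul_of_nonneg_left (A.norm_coe_le_norm k) (by positivity))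
          (h.norm_coe_le_norm k) (norm_nonneg _) (by positivity)))

@[simp] lemma postcompBilin_apply {A E G : Type*} [NormedAddCommGroup A] [NormedSpace ℝ A]
    [NormedAddCommGroup E] [NormedSpace ℝ E] [NormedAddCommGroup G] [NormedSpace ℝ G]
    (L : A →L[ℝ] E →L[ℝ] G) (a : C(K, A)) (h : C(K, E)) (k : K) :
    postcompBilin K L a h k = L (a k) (h k) := rfl

/-- `D` need not be uniformly continuous; uniformity in `k` comes from compactness of `K`, through
continuity of postcomposition in the sup distance. -/
lemma exists_dist_postcomp_lt {E A : Type*} [NormedAddCommGroup E] [NormedAddCommGroup A]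
    (D : C(E, A)) (y : C(K, E)) {c : ℝ} (hc : 0 < c) :
    ∃ δ > 0, ∀ z : C(K, E), dist z y < δ → ∀ k, dist (D (z k)) (D (y k)) < c := by
  have hcont : ContinuousAt (fun z : C(K, E) ↦ D.comp z) y :=
    (ContinuousMap.continuous_postcomp D).continuousAt
  obtain ⟨δ, hδ, hball⟩ := Metric.continuousAt_iff.1 hcont c hc
  exact ⟨δ, hδ, fun z hz k ↦ (ContinuousMap.dist_apply_le_dist k).trans_lt (hball hz)⟩

lemma hasFDerivAt_postcomp {E G : Type*} [NormedAddCommGroup E] [NormedSpace ℝ E]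
    [NormedAddCommGroup G] [NormedSpace ℝ G] {X : E → G} (hX : ContDiff ℝ 1 X) (y : C(K, E)) :
    HasFDerivAt (fun y : C(K, E) ↦ (⟨X, hX.continuous⟩ : C(E, G)).comp y)
      (postcompBilin K (.id ℝ (E →L[ℝ] G))
        ((⟨fderiv ℝ X, hX.continuous_fderiv one_ne_zero⟩ : C(E, E →L[ℝ] G)).comp y)) y := by
  set D : C(E, E →L[ℝ] G) := ⟨fderiv ℝ X, hX.continuous_fderiv one_ne_zero⟩
  rw [hasFDerivAt_iff_isLittleO_nhds_zero, Asymptotics.isLittleO_iff]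
  intro c hc
  obtain ⟨δ, hδ, hball⟩ := exists_dist_postcomp_lt D y hc
  filter_upwards [Metric.ball_mem_nhds (0 : C(K, E)) hδ] with h hh
  rw [ContinuousMap.norm_le _ (by positivity)]
  intro k
  have key : ‖X (y k + h k) - X (y k) - fderiv ℝ X (y k) ((y k + h k) - y k)‖
      ≤ c * ‖(y k + h k) - y k‖ := by
    refine (convex_segment (𝕜 := ℝ) (y k) (y k + h k)).norm_image_sub_le_of_norm_fderiv_le'
      (f := X) (fun z _ ↦ hX.differentiable one_ne_zero z) ?_ (left_mem_segment _ _ _)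
      (right_mem_segment _ _ _)
    intro z hz
    rw [segment_eq_image'] at hz
    obtain ⟨s, hs, rfl⟩ := hz
    -- The whole function `y + s • h` is within `δ` of `y`, so a single `δ` bounds the variation of
    -- the derivative on all the segments.
    have hlt : dist (y + s • h) y < δ := by
      rw [dist_eq_norm, add_sub_cancel_left, norm_smul, Real.norm_eq_abs, abs_of_nonneg hs.1]
      rw [mem_ball_zero_iff] at hh
      exact (mul_le_of_le_one_left (norm_nonneg _) hs.2).trans_lt hh
    have h1 := (hball _ hlt k).le
    rw [dist_eq_norm] at h1
    simpa [D] using h1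
  rw [add_sub_cancel_left] at key
  refine le_trans ?_ (key.trans (mul_le_mul_of_nonneg_left (h.norm_coe_le_norm k) hc.le))
  simp [D]

/-- The derivative of the operator is again postcomposition, with `fderiv ℝ X`, followed by a
bounded linear map, which permits induction on the order. The target changes from `G` to `E →L[ℝ] G`
in each step, hence the quantification over `G` and the common universe. -/
lemma contDiff_postcomp_nat {E : Type u} [NormedAddCommGroup E] [NormedSpace ℝ E] (n : ℕ) :
    ∀ {G : Type u} [NormedAddCommGroup G] [NormedSpace ℝ G] {X : E → G} (hX : ContDiff ℝ ∞ X),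
    ContDiff ℝ n (fun y : C(K, E) ↦ (⟨X, hX.continuous⟩ : C(E, G)).comp y) := by
  induction n with
  | zero =>
    intro G _ _ X hX
    exact contDiff_zero.2 (ContinuousMap.continuous_postcomp _)
  | succ n ih =>
    intro G _ _ X hX
    have h1 : ContDiff ℝ 1 X := hX.of_le (by simp)
    have hD : ContDiff ℝ ∞ (fderiv ℝ X) := hX.fderiv_right (by simp)
    rw [Nat.cast_succ, contDiff_succ_iff_hasFDerivAt]
    exact ⟨_, (postcompBilin K (ContinuousLinearMap.id ℝ (E →L[ℝ] G))).contDiff.comp (ih hD),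
      fun y ↦ hasFDerivAt_postcomp h1 y⟩

lemma contDiff_postcomp {E G : Type u} [NormedAddCommGroup E] [NormedSpace ℝ E]
    [NormedAddCommGroup G] [NormedSpace ℝ G] {X : E → G} (hX : ContDiff ℝ ∞ X) :
    ContDiff ℝ ∞ (fun y : C(K, E) ↦ (⟨X, hX.continuous⟩ : C(E, G)).comp y) :=
  contDiff_infty.2 fun n ↦ contDiff_postcomp_nat n hX

end ContinuousMap

/-! ### Smooth dependence of flows on initial values. -/

section SmoothFlow

variable {E : Type u} [NormedAddCommGroup E] [NormedSpace ℝ E]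

/-- The primitive vanishing at `0`, as a continuous linear operator on `C([0, 1], E)`. -/
noncomputable def primitiveL (E : Type u) [NormedAddCommGroup E] [NormedSpace ℝ E] :
    C(Icc (0 : ℝ) 1, E) →L[ℝ] C(Icc (0 : ℝ) 1, E) :=
  LinearMap.mkContinuous
    { toFun := fun f ↦ ⟨fun τ ↦ ∫ s in (0 : ℝ)..τ, IccExtend zero_le_one f s,
        (intervalIntegral.continuous_primitive
          (fun a b ↦ (f.continuous.Icc_extend' (h := zero_le_one)).intervalIntegrable a b) 0).comp
          continuous_subtype_val⟩
      map_add' := fun f g ↦ by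
        ext τ
        exact intervalIntegral.integral_add
          ((f.continuous.Icc_extend' (h := zero_le_one)).intervalIntegrable _ _)
          ((g.continuous.Icc_extend' (h := zero_le_one)).intervalIntegrable _ _)
      map_smul' := fun c f ↦ by
        ext τ
        exact intervalIntegral.integral_smul c _ } 1
    (fun f ↦ by
      rw [ContinuousMap.norm_le _ (by positivity)]
      intro τ
      have := intervalIntegral.norm_integral_le_of_norm_le_const (a := 0) (b := (τ : ℝ))
        (f := IccExtend zero_le_one f) (C := ‖f‖)
        (fun s _ ↦ f.norm_coe_le_norm _)
      rw [sub_zero, abs_of_nonneg τ.2.1] at this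
      refine this.trans ?_
      rw [mul_comm]
      exact mul_le_mul_of_nonneg_right τ.2.2 (norm_nonneg _))

variable [CompleteSpace E]

/-- The integral equation `y = x + ε ∫ X(y)` is solved in `C([0, 1], E)` by the inverse function
theorem. Rescaling makes the length of time a parameter `ε`. At `ε = 0` the solution is constant and
the linearization in `y` is the identity, so smoothness in `x` is part of the inverse function
theorem. -/
lemma exists_smooth_flow_of_contDiff {X : E → E} (hX : ContDiff ℝ ∞ X) (x₀ : E) {Ω : Set E}
    (hΩ : Ω ∈ 𝓝 x₀) :
    ∃ ε₀ > 0, ∃ W ∈ 𝓝 x₀, ∃ Φ : ℝ → E → ℝ → E, ∀ ε : ℝ, |ε| < ε₀ → ∀ x ∈ W,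
      Φ ε x 0 = x ∧
      (∀ τ ∈ Icc (0 : ℝ) 1, Φ ε x τ ∈ Ω ∧
        HasDerivWithinAt (Φ ε x) (ε • X (Φ ε x τ)) (Icc 0 1) τ) ∧
      ContDiffAt ℝ ∞ (fun x ↦ Φ ε x 1) x := by
  let C := C(Icc (0 : ℝ) 1, E)
  let cst : E →L[ℝ] C := ContinuousLinearMap.const ℝ (Icc (0 : ℝ) 1)
  let nem : C → C := fun y ↦ (⟨X, hX.continuous⟩ : C(E, E)).comp y
  have hnem : ContDiff ℝ ∞ nem := ContinuousMap.contDiff_postcomp hX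
  let R : (E × ℝ) × C → C := fun z ↦ z.2 - cst z.1.1 - z.1.2 • primitiveL E (nem z.2)
  let Ψ : (E × ℝ) × C → (E × ℝ) × C := fun z ↦ (z.1, R z)
  have hRs : ContDiff ℝ ∞ R :=
    ((contDiff_snd.sub (cst.contDiff.comp (contDiff_fst.comp contDiff_fst))).sub
      ((contDiff_snd.comp contDiff_fst).smul
        ((primitiveL E).contDiff.comp (hnem.comp contDiff_snd))))
  have hΨ : ContDiff ℝ ∞ Ψ := contDiff_fst.prodMk hRs
  let p₀ : (E × ℝ) × C := ((x₀, 0), cst x₀)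
  let k : C := primitiveL E (nem (cst x₀))
  -- the derivative at the constant solution
  let S : (E × ℝ) →L[ℝ] C :=
    cst.comp (.fst ℝ E ℝ) + (ContinuousLinearMap.snd ℝ E ℝ).smulRight k
  let T : ((E × ℝ) × C) ≃L[ℝ] ((E × ℝ) × C) :=
    ContinuousLinearEquiv.equivOfInverse
      -- The derivative is unipotent: it subtracts `S` of the first component from the second, and
      -- its inverse adds it back.
      ((ContinuousLinearMap.fst ℝ (E × ℝ) C).prod
        (.snd ℝ (E × ℝ) C - S.comp (.fst ℝ (E × ℝ) C)))
      ((ContinuousLinearMap.fst ℝ (E × ℝ) C).prod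
        (.snd ℝ (E × ℝ) C + S.comp (.fst ℝ (E × ℝ) C)))
      (fun z ↦ by ext <;> simp) (fun z ↦ by ext <;> simp)
  have hT : HasFDerivAt Ψ (T : ((E × ℝ) × C) →L[ℝ] ((E × ℝ) × C)) p₀ := by
    have h1 : HasFDerivAt (fun z : (E × ℝ) × C ↦ primitiveL E (nem z.2))
        (fderiv ℝ (fun z : (E × ℝ) × C ↦ primitiveL E (nem z.2)) p₀) p₀ :=
      ((((primitiveL E).contDiff.comp (hnem.comp contDiff_snd)).differentiable
        (by simp)) p₀).hasFDerivAt
    have h2 : HasFDerivAt (fun z : (E × ℝ) × C ↦ z.1.2)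
        ((ContinuousLinearMap.snd ℝ E ℝ).comp (.fst ℝ (E × ℝ) C)) p₀ :=
      ((ContinuousLinearMap.snd ℝ E ℝ).comp (.fst ℝ (E × ℝ) C)).hasFDerivAt
    have h3 : HasFDerivAt (fun z : (E × ℝ) × C ↦ z.2 - cst z.1.1)
        (.snd ℝ (E × ℝ) C - cst.comp ((ContinuousLinearMap.fst ℝ E ℝ).comp
          (.fst ℝ (E × ℝ) C))) p₀ :=
      (ContinuousLinearMap.snd ℝ (E × ℝ) C - cst.comp ((ContinuousLinearMap.fst ℝ E ℝ).comp
          (.fst ℝ (E × ℝ) C))).hasFDerivAt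
    have h4 := hasFDerivAt_fst.prodMk (h3.sub (h2.smul h1))
    refine h4.congr_fderiv ?_
    ext z <;> simp [T, S, p₀, k, sub_sub]
  let φ := hΨ.contDiffAt.toOpenPartialHomeomorph Ψ hT (by simp)
  have hφ : ∀ z, φ z = Ψ z := fun z ↦ rfl
  have hp₀ : p₀ ∈ φ.source := hΨ.contDiffAt.mem_toOpenPartialHomeomorph_source hT (by simp)
  have hΨp₀ : Ψ p₀ = ((x₀, 0), 0) := by
    ext <;> simp [Ψ, R, p₀]
  have htgt : ((x₀, (0 : ℝ)), (0 : C)) ∈ φ.target := by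
    rw [← hΨp₀]; exact φ.map_source hp₀
  have hsymm : φ.symm ((x₀, (0 : ℝ)), (0 : C)) = p₀ := by
    rw [← hΨp₀]; exact φ.left_inv hp₀
  let ι : E × ℝ → (E × ℝ) × C := fun w ↦ (w, 0)
  have hι : ContDiff ℝ ∞ ι := contDiff_id.prodMk contDiff_const
  have hcont : ContinuousAt (fun w ↦ φ.symm (ι w)) (x₀, 0) :=
    ContinuousAt.comp (g := φ.symm) (φ.symm.continuousAt htgt) hι.continuous.continuousAt
  have hval : φ.symm (ι (x₀, 0)) = p₀ := hsymm
  -- Smoothness of the local inverse at points other than the image of `p₀` needs an invertible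
  -- derivative there; invertibility is an open condition.
  have hinv : ∀ᶠ z in 𝓝 p₀, ∃ T' : ((E × ℝ) × C) ≃L[ℝ] ((E × ℝ) × C),
      HasFDerivAt Ψ (T' : ((E × ℝ) × C) →L[ℝ] ((E × ℝ) × C)) z := by
    have hc : ContinuousAt (fderiv ℝ Ψ) p₀ := (hΨ.continuous_fderiv (by simp)).continuousAt
    have : ∀ᶠ A in 𝓝 (fderiv ℝ Ψ p₀), A ∈ range ((↑) : (((E × ℝ) × C) ≃L[ℝ] ((E × ℝ) × C)) → _) := by
      rw [hT.fderiv]; exact ContinuousLinearEquiv.nhds T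
    filter_upwards [hc.eventually this] with z hz
    obtain ⟨T', hT'⟩ := hz
    exact ⟨T', hT' ▸ (hΨ.differentiable (by simp) z).hasFDerivAt⟩
  obtain ⟨r, hr, hball⟩ := Metric.mem_nhds_iff.1 hΩ
  -- Closeness to the constant curve in the sup norm keeps the whole trajectory in `Ω`.
  have hnear : ∀ᶠ z in 𝓝 p₀, dist z.2 (cst x₀) < r :=
    (continuous_snd.dist continuous_const).continuousAt.eventually_lt continuousAt_const
      (by simpa [p₀] using hr)
  have hall : ∀ᶠ w in 𝓝 (x₀, (0 : ℝ)), ι w ∈ φ.target ∧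
      (∃ T' : ((E × ℝ) × C) ≃L[ℝ] ((E × ℝ) × C),
        HasFDerivAt Ψ (T' : ((E × ℝ) × C) →L[ℝ] ((E × ℝ) × C)) (φ.symm (ι w))) ∧
      dist (φ.symm (ι w)).2 (cst x₀) < r := by
    refine (hι.continuous.continuousAt.eventually (φ.open_target.mem_nhds htgt)).and
      ((hcont.eventually (hval ▸ hinv)).and (hcont.eventually (hval ▸ hnear)))
  rw [nhds_prod_eq] at hall
  obtain ⟨W, hW, V, hV, hWV⟩ := eventually_prod_iff.1 hall
  obtain ⟨ε₀, hε₀, hVε⟩ := Metric.mem_nhds_iff.1 hV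
  refine ⟨ε₀, hε₀, {x | W x}, hW, fun ε x ↦ IccExtend zero_le_one (φ.symm (ι (x, ε))).2, ?_⟩
  intro ε hε x hx
  have hεV : V ε := hVε (by simpa [Real.dist_eq] using hε)
  obtain ⟨h1, ⟨T', hT'⟩, h3⟩ := hWV hx hεV
  set z := φ.symm (ι (x, ε)) with hz
  have hzeq : Ψ z = ι (x, ε) := φ.right_inv h1
  have hz1 : z.1 = (x, ε) := congrArg Prod.fst hzeq
  have hz2 : z.2 = cst x + ε • primitiveL E (nem z.2) := by
    have : R z = 0 := congrArg Prod.snd hzeq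
    simp only [R, hz1, sub_sub] at this
    exact sub_eq_zero.1 this
  have hint : ∀ τ ∈ Icc (0 : ℝ) 1, IccExtend zero_le_one z.2 τ
      = x + ε • ∫ s in (0 : ℝ)..τ, X (IccExtend zero_le_one z.2 s) := by
    intro τ hτ
    rw [IccExtend_of_mem zero_le_one z.2 hτ]
    conv_lhs => rw [hz2]
    rfl
  have hXc : Continuous fun s ↦ X (IccExtend zero_le_one z.2 s) :=
    hX.continuous.comp (z.2.continuous.Icc_extend' (h := zero_le_one))
  refine ⟨?_, ?_, ?_⟩
  · exact (hint 0 (by simp)).trans (by simp)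
  · intro τ hτ
    constructor
    · change IccExtend zero_le_one z.2 τ ∈ Ω
      apply hball
      rw [IccExtend_of_mem zero_le_one z.2 hτ, Metric.mem_ball]
      exact (ContinuousMap.dist_apply_le_dist (f := z.2) (g := cst x₀) ⟨τ, hτ⟩).trans_lt h3
    · have hd : HasDerivAt (fun τ ↦ x + ε • ∫ s in (0 : ℝ)..τ, X (IccExtend zero_le_one z.2 s))
          (ε • X (IccExtend zero_le_one z.2 τ)) τ :=
        ((intervalIntegral.integral_hasDerivAt_right (hXc.intervalIntegrable _ _)
          (hXc.stronglyMeasurableAtFilter _ _) hXc.continuousAt).const_smul ε).const_add x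
      exact hd.hasDerivWithinAt.congr hint (hint τ hτ)
  · have hs : ContDiffAt ℝ ∞ φ.symm (ι (x, ε)) :=
      φ.contDiffAt_symm h1 hT' hΨ.contDiffAt
    have h5 : ContDiffAt ℝ ∞ (fun x ↦ (φ.symm (ι (x, ε))).2) x :=
      contDiffAt_snd.comp x (ContDiffAt.comp x (g := φ.symm) hs
        (hι.contDiffAt.comp x (contDiffAt_id.prodMk contDiffAt_const)))
    have h6 := (ContinuousMap.evalCLM ℝ (⟨1, by simp⟩ : Icc (0 : ℝ) 1)
      (M := E)).contDiff.contDiffAt.comp x h5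
    refine h6.congr_of_eventuallyEq (Eventually.of_forall fun x ↦ ?_)
    simp

/-- `X` is cut off by a bump function equal to `1` on the ball of half the radius. Trajectories are
confined to this ball, where the cut-off field coincides with `X`. -/
lemma exists_smooth_flow {E : Type u} [NormedAddCommGroup E] [NormedSpace ℝ E]
    [FiniteDimensional ℝ E] {X : E → E} {Ω : Set E} (hΩ : IsOpen Ω) (hX : ContDiffOn ℝ ∞ X Ω)
    {x₀ : E} (hx₀ : x₀ ∈ Ω) :
    ∃ ε₀ > 0, ∃ W ∈ 𝓝 x₀, ∃ Φ : ℝ → E → ℝ → E, ∀ ε : ℝ, |ε| < ε₀ → ∀ x ∈ W,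
      Φ ε x 0 = x ∧
      (∀ τ ∈ Icc (0 : ℝ) 1, Φ ε x τ ∈ Ω ∧
        HasDerivWithinAt (Φ ε x) (ε • X (Φ ε x τ)) (Icc 0 1) τ) ∧
      ContDiffAt ℝ ∞ (fun x ↦ Φ ε x 1) x := by
  have : CompleteSpace E := FiniteDimensional.complete ℝ E
  obtain ⟨r, hr, hball⟩ := Metric.nhds_basis_closedBall.mem_iff.1 (hΩ.mem_nhds hx₀)
  let f : ContDiffBump x₀ := ⟨r / 2, r, half_pos hr, half_lt_self hr⟩
  have hfX : ContDiff ℝ ∞ fun x ↦ f x • X x := by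
    rw [contDiff_iff_contDiffAt]
    intro x
    by_cases hx : x ∈ Ω
    · exact f.contDiffAt.smul (hX.contDiffAt (hΩ.mem_nhds hx))
    · have hx' : x ∉ tsupport f := fun h ↦ hx (hball (f.tsupport_eq ▸ h))
      refine contDiffAt_const (c := (0 : E)).congr_of_eventuallyEq ?_
      filter_upwards [(isClosed_tsupport f).isOpen_compl.mem_nhds hx'] with y hy
      rw [image_eq_zero_of_notMem_tsupport hy, zero_smul]
  obtain ⟨ε₀, hε₀, W, hW, Φ, hΦ⟩ := exists_smooth_flow_of_contDiff hfX x₀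
    (Metric.closedBall_mem_nhds x₀ (half_pos hr))
  refine ⟨ε₀, hε₀, W, hW, Φ, fun ε hε x hx ↦ ?_⟩
  obtain ⟨h1, h2, h3⟩ := hΦ ε hε x hx
  refine ⟨h1, fun τ hτ ↦ ⟨hball (Metric.closedBall_subset_closedBall (by linarith) (h2 τ hτ).1),
    ?_⟩, h3⟩
  have := (h2 τ hτ).2
  rwa [f.one_of_mem_closedBall (h2 τ hτ).1, one_smul] at this

end SmoothFlow

/-- A transitive relation between points of `[0, 1]` that holds locally holds between the end
points. -/
lemma Icc_chain {P : ℝ → ℝ → Prop}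
    (hloc : ∀ τ ∈ Icc (0 : ℝ) 1, ∃ ε > 0, ∀ a b, 0 ≤ a → a ≤ b → b ≤ 1 → |a - τ| < ε →
      |b - τ| < ε → P a b)
    (htrans : ∀ a b c, 0 ≤ a → a ≤ b → b ≤ c → c ≤ 1 → P a b → P b c → P a c)
    {t : ℝ} (ht : t ∈ Icc (0 : ℝ) 1) : P 0 t := by
  choose! ε hε hP using hloc
  -- By compactness, any two points at distance less than a Lebesgue number `δ` lie in one of the
  -- good neighbourhoods.
  obtain ⟨δ, hδ, hball⟩ := lebesgue_number_lemma_of_metric (c := fun τ : Icc (0 : ℝ) 1 ↦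
    Metric.ball (τ : ℝ) (ε τ)) (isCompact_Icc (a := (0 : ℝ)) (b := 1))
    (fun _ ↦ Metric.isOpen_ball)
    (fun τ hτ ↦ mem_iUnion.2 ⟨⟨τ, hτ⟩, Metric.mem_ball_self (hε τ hτ)⟩)
  obtain ⟨N, hN⟩ := exists_nat_gt (1 / δ)
  have hN0 : (0 : ℝ) < N := (by positivity : 0 < 1 / δ).trans hN
  have hstep : ∀ a b : ℝ, 0 ≤ a → a ≤ b → b ≤ 1 → b - a ≤ 1 / N → P a b := by
    intro a b ha hab hb hlt
    obtain ⟨⟨τ, hτ⟩, hsub⟩ := hball a ⟨ha, hab.trans hb⟩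
    have hlt' : b - a < δ := by
      refine hlt.trans_lt ?_
      rw [div_lt_iff₀ hδ] at hN
      rw [div_lt_iff₀ hN0]; linarith
    have h1 := hsub (Metric.mem_ball_self hδ)
    have h2 : b ∈ Metric.ball τ (ε τ) := hsub (by
      rw [Metric.mem_ball, Real.dist_eq, abs_of_nonneg (by linarith)]; exact hlt')
    rw [Metric.mem_ball, Real.dist_eq] at h1 h2
    exact hP τ hτ a b ha hab hb h1 h2
  -- The interval `[0, t]` is divided into `N` steps of length `t / N ≤ 1 / N`.
  have hind : ∀ n : ℕ, n ≤ N → P 0 (t * n / N) := by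
    intro n
    induction n with
    | zero => intro _; simpa using hstep 0 0 le_rfl le_rfl zero_le_one (by simp)
    | succ n ih =>
      intro hn
      have hn' : ((n : ℝ) + 1) / N ≤ 1 := by
        rw [div_le_one hN0]; exact_mod_cast hn
      have e : t * (n + 1 : ℕ) / N = t * n / N + t * (1 / N) := by push_cast; ring
      have h0 : 0 ≤ t * n / N := by have := ht.1; positivity
      have h1 : 0 ≤ t * (1 / N) := by have := ht.1; positivity
      have h2 : t * (n + 1 : ℕ) / N ≤ 1 := by
        rw [mul_div_assoc]; push_cast
        exact mul_le_one₀ ht.2 (by positivity) hn'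
      refine htrans 0 (t * n / N) _ le_rfl h0 (by rw [e]; linarith) h2 (ih (by omega)) ?_
      refine hstep _ _ h0 (by rw [e]; linarith) h2 ?_
      rw [e, add_sub_cancel_left]
      exact mul_le_of_le_one_left (by positivity) ht.2
  have := hind N le_rfl
  rwa [mul_div_assoc, div_self hN0.ne', mul_one] at this

/-! ### Existence and uniqueness for differential equations on compact intervals. -/

section LinearODE

variable {G : Type*} [NormedAddCommGroup G] [NormedSpace ℝ G]

open scoped NNReal in
lemma exists_linear_ode_solution [CompleteSpace G] {A : ℝ → G →L[ℝ] G} {a b : ℝ} (hab : a ≤ b)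
    (hA : ContinuousOn A (Icc a b)) {K : ℝ≥0} (hK : ∀ t ∈ Icc a b, ‖A t‖ ≤ K)
    (hKab : K * (b - a) ≤ 1 / 2) (y₀ : G) :
    ∃ y : ℝ → G, y a = y₀ ∧ ∀ t ∈ Icc a b, HasDerivWithinAt y (A t (y t)) (Icc a b) t := by
  -- On the ball of radius `‖y₀‖ + 1` about `y₀` the field is bounded by `K (2 ‖y₀‖ + 1)`. Since `K
  -- (b - a) ≤ 1 / 2`, a solution moves by at most `‖y₀‖ + 1 / 2` and cannot leave the ball.
  have hP : IsPicardLindelof (fun t y ↦ A t y) (⟨a, left_mem_Icc.2 hab⟩ : Icc a b) y₀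
      (‖y₀‖₊ + 1) 0 (K * (2 * ‖y₀‖₊ + 1)) K := by
    constructor
    · intro t ht
      exact ((A t).lipschitz.weaken (by exact_mod_cast hK t ht)).lipschitzOnWith
    · intro x _
      exact hA.clm_apply continuousOn_const
    · intro t ht x hx
      have hx' : ‖x‖ ≤ 2 * ‖y₀‖ + 1 := by
        have := norm_le_norm_add_norm_sub' x y₀
        rw [Metric.mem_closedBall, dist_eq_norm] at hx
        push_cast at hx
        linarith
      push_cast
      exact ((A t).le_opNorm x).trans (mul_le_mul (hK t ht) hx' (norm_nonneg _) K.2)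
    · have : max (b - a) (a - a) = b - a := by rw [sub_self]; exact max_eq_left (by linarith)
      simp only [this]
      push_cast
      nlinarith [norm_nonneg y₀, K.2]
  exact hP.exists_eq_forall_mem_Icc_hasDerivWithinAt₀

/-- Compactness of the interval bounds `‖A t‖`, which gives a Lipschitz constant for the uniqueness
theorem. With `A = 0` and `g = 0` it says that a curve with zero derivative is constant. -/
lemma linear_ode_unique {A : ℝ → G →L[ℝ] G} {g : ℝ → G} {a b : ℝ}
    (hA : ContinuousOn A (Icc a b)) {y z : ℝ → G}
    (hy : ∀ t ∈ Icc a b, HasDerivWithinAt y (A t (y t) + g t) (Icc a b) t)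
    (hz : ∀ t ∈ Icc a b, HasDerivWithinAt z (A t (z t) + g t) (Icc a b) t)
    (h0 : y a = z a) : EqOn y z (Icc a b) := by
  obtain ⟨C, hC⟩ := isCompact_Icc.exists_bound_of_continuousOn hA
  have hIci : ∀ {w : ℝ → G} {w' : G} {t : ℝ}, t ∈ Ico a b → HasDerivWithinAt w w' (Icc a b) t →
      HasDerivWithinAt w w' (Ici t) t := fun ht h ↦
    h.mono_of_mem_nhdsWithin (Icc_mem_nhdsGE_of_mem ht)
  refine ODE_solution_unique_of_mem_Icc_right (v := fun t y ↦ A t y + g t) (K := C.toNNReal)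
    (s := fun _ ↦ univ) (fun t ht ↦ ?_) (fun t ht ↦ (hy t ht).continuousWithinAt)
    (fun t ht ↦ hIci ht (hy t (Ico_subset_Icc_self ht))) (fun _ _ ↦ trivial)
    (fun t ht ↦ (hz t ht).continuousWithinAt)
    (fun t ht ↦ hIci ht (hz t (Ico_subset_Icc_self ht))) (fun _ _ ↦ trivial) h0
  refine LipschitzWith.lipschitzOnWith (LipschitzWith.of_dist_le_mul fun u v ↦ ?_)
  rw [dist_add_right, dist_eq_norm, dist_eq_norm, ← map_sub]
  exact ((A t).le_opNorm _).trans (mul_le_mul_of_nonneg_right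
    ((hC t (Ico_subset_Icc_self ht)).trans (Real.le_coe_toNNReal C)) (norm_nonneg _))

/-- Two solutions of a `C¹` differential equation that agree at a time agree shortly afterwards. -/
lemma ode_eventually_eq_right {X : G → G} {f g : ℝ → G} {a b t₀ : ℝ} (ht₀ : t₀ ∈ Ico a b)
    (hX : ContDiffAt ℝ 1 X (f t₀))
    (hf : ∀ᶠ t in 𝓝[≥] t₀, HasDerivWithinAt f (X (f t)) (Icc a b) t)
    (hg : ∀ᶠ t in 𝓝[≥] t₀, HasDerivWithinAt g (X (g t)) (Icc a b) t)
    (h0 : f t₀ = g t₀) : ∀ᶠ t in 𝓝[≥] t₀, f t = g t := by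
  -- The field is Lipschitz only near the common value, so time is shortened until both solutions
  -- stay in `s`.
  obtain ⟨K, s, hs, hLip⟩ := hX.exists_lipschitzOnWith
  have hIci : ∀ {w : ℝ → G}, (∀ᶠ t in 𝓝[≥] t₀, HasDerivWithinAt w (X (w t)) (Icc a b) t) →
      ContinuousWithinAt w (Ici t₀) t₀ := fun h ↦
    ((h.self_of_nhdsWithin (mem_Ici.2 le_rfl)).mono_of_mem_nhdsWithin
      (Icc_mem_nhdsGE_of_mem ht₀)).continuousWithinAt
  have hfs := (hIci hf).eventually hs
  have hgs := (hIci hg).eventually (h0 ▸ hs)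
  have hall := (hf.and hg).and ((hfs.and hgs).and (Ico_mem_nhdsGE ht₀.2))
  obtain ⟨c, hc, hsub⟩ := mem_nhdsGE_iff_exists_Icc_subset.1 hall
  have hc' : t₀ < c := hc
  filter_upwards [Icc_mem_nhdsGE hc'] with t ht
  refine ODE_solution_unique_of_mem_Icc_right (v := fun _ ↦ X) (K := K) (s := fun _ ↦ s)
    (a := t₀) (b := c) (fun _ _ ↦ hLip) ?_ ?_ ?_ ?_ ?_ ?_ h0 ht
  · intro r hr
    refine (hsub hr).1.1.continuousWithinAt.mono fun x hx ↦ ?_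
    exact ⟨ht₀.1.trans hx.1, (hsub hx).2.2.2.le⟩
  · intro r hr
    have := hsub (Ico_subset_Icc_self hr)
    exact this.1.1.mono_of_mem_nhdsWithin
      (Icc_mem_nhdsGE_of_mem ⟨ht₀.1.trans this.2.2.1, this.2.2.2⟩)
  · exact fun r hr ↦ (hsub (Ico_subset_Icc_self hr)).2.1.1
  · intro r hr
    refine (hsub hr).1.2.continuousWithinAt.mono fun x hx ↦ ?_
    exact ⟨ht₀.1.trans hx.1, (hsub hx).2.2.2.le⟩
  · intro r hr
    have := hsub (Ico_subset_Icc_self hr)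
    exact this.1.2.mono_of_mem_nhdsWithin
      (Icc_mem_nhdsGE_of_mem ⟨ht₀.1.trans this.2.2.1, this.2.2.2⟩)
  · exact fun r hr ↦ (hsub (Ico_subset_Icc_self hr)).2.1.2

end LinearODE

namespace CovariantDerivative

noncomputable section

/-! ### Tangent vectors and vector fields in arbitrary charts. -/

section Coordinates

variable {F : Type*} [NormedAddCommGroup F] [NormedSpace ℝ F]
  {N : Type*} [TopologicalSpace N] [ChartedSpace F N] [IsManifold 𝓘(ℝ, F) ∞ N]

/-- The derivative at `q` of the preferred chart at `p`, as a map on the model space. -/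
def coordMap (p q : N) : F →L[ℝ] F := tangentCoordChange 𝓘(ℝ, F) q p q

/-- The inverse of `coordMap p q`. -/
def coordInv (p q : N) : F →L[ℝ] F := tangentCoordChange 𝓘(ℝ, F) p q q

lemma coordMap_coordInv {p q : N} (h : q ∈ (chartAt F p).source) (v : F) :
    coordMap p q (coordInv p q v) = v := by
  have h' : q ∈ (extChartAt 𝓘(ℝ, F) p).source := by rwa [extChartAt_source]
  unfold coordMap coordInv
  rw [tangentCoordChange_comp ⟨⟨h', mem_extChartAt_source q⟩, h'⟩, tangentCoordChange_self h']

lemma coordInv_coordMap {p q : N} (h : q ∈ (chartAt F p).source) (v : F) :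
    coordInv p q (coordMap p q v) = v := by
  have h' : q ∈ (extChartAt 𝓘(ℝ, F) p).source := by rwa [extChartAt_source]
  unfold coordMap coordInv
  rw [tangentCoordChange_comp ⟨⟨mem_extChartAt_source q, h'⟩, mem_extChartAt_source q⟩,
    tangentCoordChange_self (mem_extChartAt_source q)]

-- The tangent space at `p` is the model space itself, by way of the preferred chart at `p`. This
-- identification jumps with the point, so fields and frames are differentiated only after `coordMap
-- p` has carried them to one fixed chart; at its centre that map may then be dropped.
@[simp] lemma coordMap_self (p : N) : coordMap (F := F) p p = .id ℝ F := by
  ext v; exact tangentCoordChange_self (mem_extChartAt_source p)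

@[simp] lemma coordInv_self (p : N) : coordInv (F := F) p p = .id ℝ F := by
  ext v; exact tangentCoordChange_self (mem_extChartAt_source p)

lemma coordMap_comp_coordInv {p q : N} (h : q ∈ (chartAt F p).source) :
    coordMap (F := F) p q ∘L coordInv p q = .id ℝ F := by
  ext v; exact coordMap_coordInv h v

lemma coordInv_comp_coordMap {p q : N} (h : q ∈ (chartAt F p).source) :
    coordInv (F := F) p q ∘L coordMap p q = .id ℝ F := by
  ext v; exact coordInv_coordMap h v

lemma coordMap_injective {p q : N} (h : q ∈ (chartAt F p).source) :
    Function.Injective (coordMap (F := F) p q) :=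
  Function.LeftInverse.injective (coordInv_coordMap h)

/-- The coordinate change from the chart at `p` to the chart at `p'`. -/
def coordChange (p p' : N) : F → F := extChartAt 𝓘(ℝ, F) p' ∘ (extChartAt 𝓘(ℝ, F) p).symm

lemma coordChange_extChartAt {p p' q : N} (h : q ∈ (chartAt F p).source) :
    coordChange p p' (extChartAt 𝓘(ℝ, F) p q) = extChartAt 𝓘(ℝ, F) p' q := by
  simp only [coordChange, Function.comp_apply]
  rw [(extChartAt 𝓘(ℝ, F) p).left_inv (by rwa [extChartAt_source])]

lemma contDiffAt_coordChange {p p' q : N} (h : q ∈ (chartAt F p).source)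
    (h' : q ∈ (chartAt F p').source) :
    ContDiffAt ℝ ∞ (coordChange (F := F) p p') (extChartAt 𝓘(ℝ, F) p q) := by
  have := contDiffWithinAt_ext_coord_change (I := 𝓘(ℝ, F)) (n := ∞) p' p
    (y := extChartAt 𝓘(ℝ, F) p q) (by
      rw [PartialEquiv.trans_source'', PartialEquiv.symm_symm, PartialEquiv.symm_target]
      exact mem_image_of_mem _ (by simp [h, h']))
  simpa [coordChange, contDiffWithinAt_univ] using this

lemma fderiv_coordChange (p p' q : N) :
    fderiv ℝ (coordChange p p') (extChartAt 𝓘(ℝ, F) p q) = tangentCoordChange 𝓘(ℝ, F) p p' q := by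
  simp [coordChange]

lemma fderiv_coordChange_comp_coordMap {p p' q : N} (h : q ∈ (chartAt F p).source)
    (h' : q ∈ (chartAt F p').source) :
    fderiv ℝ (coordChange p p') (extChartAt 𝓘(ℝ, F) p q) ∘L coordMap p q = coordMap p' q := by
  ext v
  rw [fderiv_coordChange]
  exact tangentCoordChange_comp (by simp [h, h'])

lemma trivializationAt_snd (p : N) (z : TangentBundle 𝓘(ℝ, F) N) :
    (trivializationAt F (TangentSpace 𝓘(ℝ, F)) p z).2 = coordMap (F := F) p z.1 z.2 := rfl

lemma trivializationAt_symmL {p q : N} (h : q ∈ (chartAt F p).source) :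
    (trivializationAt F (TangentSpace 𝓘(ℝ, F)) p).symmL ℝ q = coordInv p q :=
  TangentBundle.symmL_trivializationAt_eq_core h

lemma trivializationAt_symm {p q : N} (h : q ∈ (chartAt F p).source) (b : F) :
    (trivializationAt F (TangentSpace 𝓘(ℝ, F)) p).symm q b = coordInv p q b := by
  rw [← trivializationAt_symmL h]
  exact ((trivializationAt F (TangentSpace 𝓘(ℝ, F)) p).symmL_apply (R := ℝ) h b).symm

lemma hasMFDerivAt_extChartAt {p q : N} (h : q ∈ (chartAt F p).source) :
    HasMFDerivAt 𝓘(ℝ, F) 𝓘(ℝ, F) (extChartAt 𝓘(ℝ, F) p) q (coordMap (F := F) p q) := by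
  have h1 := (mdifferentiableAt_extChartAt (I := 𝓘(ℝ, F)) h).hasMFDerivAt
  rwa [← TangentBundle.continuousLinearMapAt_trivializationAt h,
    TangentBundle.continuousLinearMapAt_trivializationAt_eq_core h] at h1

/-- A vector field read in the chart at `p`. -/
def fieldCoord (p : N) (Z : Π q : N, TangentSpace 𝓘(ℝ, F) q) (z : F) : F :=
  coordMap p ((extChartAt 𝓘(ℝ, F) p).symm z) (Z ((extChartAt 𝓘(ℝ, F) p).symm z))

lemma fieldCoord_extChartAt {p q : N} (h : q ∈ (chartAt F p).source)
    (Z : Π q : N, TangentSpace 𝓘(ℝ, F) q) :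
    fieldCoord p Z (extChartAt 𝓘(ℝ, F) p q) = coordMap (F := F) p q (Z q) := by
  unfold fieldCoord
  rw [(extChartAt 𝓘(ℝ, F) p).left_inv (by rwa [extChartAt_source])]

lemma extChartAt_symm_mem_source {p : N} {z : F} (h : z ∈ (extChartAt 𝓘(ℝ, F) p).target) :
    (extChartAt 𝓘(ℝ, F) p).symm z ∈ (chartAt F p).source := by
  rw [← extChartAt_source 𝓘(ℝ, F)]
  exact (extChartAt 𝓘(ℝ, F) p).map_target h

lemma extChartAt_mem_target {p q : N} (h : q ∈ (chartAt F p).source) :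
    extChartAt 𝓘(ℝ, F) p q ∈ (extChartAt 𝓘(ℝ, F) p).target :=
  (extChartAt 𝓘(ℝ, F) p).map_source (by rwa [extChartAt_source])

lemma extChartAt_symm_extChartAt {p q : N} (h : q ∈ (chartAt F p).source) :
    (extChartAt 𝓘(ℝ, F) p).symm (extChartAt 𝓘(ℝ, F) p q) = q :=
  (extChartAt 𝓘(ℝ, F) p).left_inv (by rwa [extChartAt_source])

lemma contMDiffAt_extChartAt_symm {p : N} {z : F} (h : z ∈ (extChartAt 𝓘(ℝ, F) p).target) :
    ContMDiffAt 𝓘(ℝ, F) 𝓘(ℝ, F) ∞ (extChartAt 𝓘(ℝ, F) p).symm z :=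
  (contMDiffOn_extChartAt_symm p).contMDiffAt (extChartAt_target_mem_nhds' h)

section Functions

variable {G : Type*} [NormedAddCommGroup G] [NormedSpace ℝ G]

lemma contDiffAt_comp_extChartAt_symm {p q : N} (h : q ∈ (chartAt F p).source) {g : N → G}
    (hg : ContMDiffAt 𝓘(ℝ, F) 𝓘(ℝ, G) ∞ g q) :
    ContDiffAt ℝ ∞ (g ∘ (extChartAt 𝓘(ℝ, F) p).symm) (extChartAt 𝓘(ℝ, F) p q) := by
  rw [← contMDiffAt_iff_contDiffAt]
  refine ContMDiffAt.comp _ ?_ (contMDiffAt_extChartAt_symm (extChartAt_mem_target h))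
  rwa [extChartAt_symm_extChartAt h]

lemma differentiableAt_comp_extChartAt_symm {p q : N} (h : q ∈ (chartAt F p).source) {g : N → G}
    (hg : MDifferentiableAt 𝓘(ℝ, F) 𝓘(ℝ, G) g q) :
    DifferentiableAt ℝ (g ∘ (extChartAt 𝓘(ℝ, F) p).symm) (extChartAt 𝓘(ℝ, F) p q) := by
  rw [← mdifferentiableAt_iff_differentiableAt]
  refine MDifferentiableAt.comp _ (I' := 𝓘(ℝ, F)) ?_
    ((contMDiffAt_extChartAt_symm (extChartAt_mem_target h)).mdifferentiableAt (by simp))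
  rwa [extChartAt_symm_extChartAt h]

lemma hasMFDerivAt_of_comp_extChartAt_symm {p q : N} (h : q ∈ (chartAt F p).source) {g : N → G}
    {g' : F →L[ℝ] G}
    (hg : HasFDerivAt (g ∘ (extChartAt 𝓘(ℝ, F) p).symm) g' (extChartAt 𝓘(ℝ, F) p q)) :
    HasMFDerivAt 𝓘(ℝ, F) 𝓘(ℝ, G) g q (g' ∘L coordMap (F := F) p q) := by
  have h1 := hg.hasMFDerivAt.comp q (hasMFDerivAt_extChartAt h)
  refine h1.congr_of_eventuallyEq ?_
  filter_upwards [(chartAt F p).open_source.mem_nhds h] with y hy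
  exact congrArg g (extChartAt_symm_extChartAt hy).symm

end Functions

lemma mdifferentiableAt_section_iff_fieldCoord {p q : N} (h : q ∈ (chartAt F p).source)
    (Z : Π q : N, TangentSpace 𝓘(ℝ, F) q) :
    MDifferentiableAt 𝓘(ℝ, F) (𝓘(ℝ, F).prod 𝓘(ℝ, F))
      (fun y ↦ (⟨y, Z y⟩ : TangentBundle 𝓘(ℝ, F) N)) q ↔
    DifferentiableAt ℝ (fieldCoord p Z) (extChartAt 𝓘(ℝ, F) p q) := by
  rw [(trivializationAt F (TangentSpace 𝓘(ℝ, F)) p).mdifferentiableAt_section_iff 𝓘(ℝ, F) Z h]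
  constructor
  · intro hZ
    exact differentiableAt_comp_extChartAt_symm h hZ
  · intro hZ
    exact (hasMFDerivAt_of_comp_extChartAt_symm h (g := fun y ↦ coordMap (F := F) p y (Z y))
      hZ.hasFDerivAt).mdifferentiableAt

lemma contDiffAt_fieldCoord {p q : N} (h : q ∈ (chartAt F p).source)
    {Z : Π q : N, TangentSpace 𝓘(ℝ, F) q}
    (hZ : ContMDiffAt 𝓘(ℝ, F) (𝓘(ℝ, F).prod 𝓘(ℝ, F)) ∞
      (fun y ↦ (⟨y, Z y⟩ : TangentBundle 𝓘(ℝ, F) N)) q) :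
    ContDiffAt ℝ ∞ (fieldCoord p Z) (extChartAt 𝓘(ℝ, F) p q) := by
  rw [(trivializationAt F (TangentSpace 𝓘(ℝ, F)) p).contMDiffAt_section_iff h] at hZ
  exact contDiffAt_comp_extChartAt_symm h hZ

/-- The vector field which is constant in the chart at `p`. -/
def constField (p : N) (b : F) (q : N) : TangentSpace 𝓘(ℝ, F) q :=
  (trivializationAt F (TangentSpace 𝓘(ℝ, F)) p).symm q b

lemma constField_eq {p q : N} (h : q ∈ (chartAt F p).source) (b : F) :
    constField p b q = coordInv p q b := trivializationAt_symm h b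

lemma fieldCoord_constField {p : N} (b : F) {z : F} (hz : z ∈ (extChartAt 𝓘(ℝ, F) p).target) :
    fieldCoord p (constField p b) z = b := by
  unfold fieldCoord
  rw [constField_eq (extChartAt_symm_mem_source hz), coordMap_coordInv
    (extChartAt_symm_mem_source hz)]

lemma contMDiffOn_constField (p : N) (b : F) :
    ContMDiffOn 𝓘(ℝ, F) (𝓘(ℝ, F).prod 𝓘(ℝ, F)) ∞
      (fun y ↦ (⟨y, constField p b y⟩ : TangentBundle 𝓘(ℝ, F) N)) (chartAt F p).source := by
  intro q hq
  refine ContMDiffAt.contMDiffWithinAt ?_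
  rw [(trivializationAt F (TangentSpace 𝓘(ℝ, F)) p).contMDiffAt_section_iff hq]
  refine contMDiffAt_const (c := b) |>.congr_of_eventuallyEq ?_
  filter_upwards [(chartAt F p).open_source.mem_nhds hq] with y hy
  rw [trivializationAt_snd, constField_eq hy, coordMap_coordInv hy]

lemma extend_eq_constField {p : N} (v : TangentSpace 𝓘(ℝ, F) p) :
    FiberBundle.extend F v = constField (F := F) p v := by
  funext q
  simp only [FiberBundle.extend, constField]
  rw [trivializationAt_snd, coordMap_self]
  rfl

end Coordinates

/-! ### Christoffel symbols: existence, coordinate formula, smoothness. -/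

section Christoffel

variable {F : Type*} [NormedAddCommGroup F] [NormedSpace ℝ F] [FiniteDimensional ℝ F]
  {N : Type*} [TopologicalSpace N] [ChartedSpace F N] [IsManifold 𝓘(ℝ, F) ∞ N]
  (cov : CovariantDerivative 𝓘(ℝ, F) F (TangentSpace 𝓘(ℝ, F) : N → Type _))

/-- The coordinates of `∇_{a} S_b` in the chart at `p`, where `S_b` is constant in that chart. -/
def chrCoeff (p : N) (a b : F) (z : F) : F :=
  fieldCoord p (fun q ↦ cov (constField p b) q (constField p a q)) z

/-- The Christoffel symbols in the chart at `p`: `chr cov p z a b` is the coordinate expression of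
`∇_a b`, where `a` and `b` are constant in the chart. -/
def chr (p : N) (z : F) : F →L[ℝ] F →L[ℝ] F :=
  ∑ j, (LinearMap.toContinuousLinearMap ((Module.finBasis ℝ F).coord j)).smulRight
    (∑ i, (LinearMap.toContinuousLinearMap ((Module.finBasis ℝ F).coord i)).smulRight
      (chrCoeff cov p (Module.finBasis ℝ F j) (Module.finBasis ℝ F i) z))

variable {cov}

lemma mdifferentiableAt_constField {p q : N} (h : q ∈ (chartAt F p).source) (b : F) :
    MDifferentiableAt 𝓘(ℝ, F) (𝓘(ℝ, F).prod 𝓘(ℝ, F))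
      (fun y ↦ (⟨y, constField p b y⟩ : TangentBundle 𝓘(ℝ, F) N)) q :=
  ((contMDiffOn_constField p b).contMDiffAt ((chartAt F p).open_source.mem_nhds h)).mdifferentiableAt
    (by simp)

lemma constField_eq_sum {p q : N} (h : q ∈ (chartAt F p).source) (b : F) :
    constField p b q = ∑ i, (Module.finBasis ℝ F).repr b i • constField p (Module.finBasis ℝ F i) q
      := by
  simp only [constField_eq h]
  conv_lhs => rw [← (Module.finBasis ℝ F).sum_repr b]
  exact (map_sum (coordInv (F := F) p q) _ _).trans
    (Finset.sum_congr rfl fun i _ ↦ map_smul (coordInv (F := F) p q) _ _)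

lemma cov_sum_smul {ι : Type*} (s : Finset ι) {q : N} {c : ι → N → ℝ}
    {S : ι → Π q : N, TangentSpace 𝓘(ℝ, F) q}
    (hc : ∀ i, MDifferentiableAt 𝓘(ℝ, F) 𝓘(ℝ, ℝ) (c i) q)
    (hS : ∀ i, MDifferentiableAt 𝓘(ℝ, F) (𝓘(ℝ, F).prod 𝓘(ℝ, F))
      (fun y ↦ (⟨y, S i y⟩ : TangentBundle 𝓘(ℝ, F) N)) q) :
    cov (fun y ↦ ∑ i ∈ s, c i y • S i y) q =
      ∑ i ∈ s, (c i q • cov (S i) q + (mvfderiv 𝓘(ℝ, F) (c i) q).smulRight (S i q)) := by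
  classical
  induction s using Finset.induction_on with
  | empty =>
    simp only [Finset.sum_empty]
    exact congrFun cov.zero q
  | insert i s hi ih =>
    simp only [Finset.sum_insert hi]
    rw [← ih, ← cov.isCovariantDerivativeOn.leibniz (hS i) (hc i) (mem_univ q)]
    exact cov.isCovariantDerivativeOn.add ((hc i).smul_section (hS i))
      (MDifferentiableAt.sum_section fun j _ ↦ (hc j).smul_section (hS j)) (mem_univ q)

lemma chrCoeff_extChartAt {p q : N} (h : q ∈ (chartAt F p).source) (a b : F) :
    chrCoeff cov p a b (extChartAt 𝓘(ℝ, F) p q) =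
      coordMap (F := F) p q (cov (constField p b) q (constField p a q)) :=
  fieldCoord_extChartAt h _

lemma chr_apply (p : N) (z a b : F) :
    chr cov p z a b = ∑ j, (Module.finBasis ℝ F).repr a j • ∑ i, (Module.finBasis ℝ F).repr b i •
      chrCoeff cov p (Module.finBasis ℝ F j) (Module.finBasis ℝ F i) z := by
  simp [chr]

lemma coordMap_cov_constField {p q : N} (h : q ∈ (chartAt F p).source) (b : F)
    (v : TangentSpace 𝓘(ℝ, F) q) :
    coordMap (F := F) p q (cov (constField p b) q v) =
      ∑ j, (Module.finBasis ℝ F).repr (coordMap (F := F) p q v) j •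
        chrCoeff cov p (Module.finBasis ℝ F j) b (extChartAt 𝓘(ℝ, F) p q) := by
  have hv : v = constField p (coordMap (F := F) p q v) q := by
    rw [constField_eq h]; exact (coordInv_coordMap h v).symm
  conv_lhs => rw [hv, constField_eq_sum h]
  rw [map_sum]
  refine (map_sum (coordMap (F := F) p q) _ _).trans (Finset.sum_congr rfl fun j _ ↦ ?_)
  rw [chrCoeff_extChartAt h, map_smul]
  exact map_smul (coordMap (F := F) p q) _ _

/-- The coordinate expression of a covariant derivative. -/
lemma cov_apply_eq {p q : N} (h : q ∈ (chartAt F p).source) {Z : Π q : N, TangentSpace 𝓘(ℝ, F) q}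
    (hZ : MDifferentiableAt 𝓘(ℝ, F) (𝓘(ℝ, F).prod 𝓘(ℝ, F))
      (fun y ↦ (⟨y, Z y⟩ : TangentBundle 𝓘(ℝ, F) N)) q) (v : TangentSpace 𝓘(ℝ, F) q) :
    coordMap (F := F) p q (cov Z q v) =
      fderiv ℝ (fieldCoord p Z) (extChartAt 𝓘(ℝ, F) p q) (coordMap (F := F) p q v) +
      chr cov p (extChartAt 𝓘(ℝ, F) p q) (coordMap (F := F) p q v)
        (coordMap (F := F) p q (Z q)) := by
  set e := Module.finBasis ℝ F
  let co : Fin (Module.finrank ℝ F) → F →L[ℝ] ℝ := fun i ↦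
    LinearMap.toContinuousLinearMap (e.coord i)
  let c : Fin (Module.finrank ℝ F) → N → ℝ := fun i y ↦ co i (coordMap (F := F) p y (Z y))
  have hco : ∀ i x, co i x = e.repr x i := fun i x ↦ rfl
  have hZd : HasFDerivAt (fieldCoord p Z) (fderiv ℝ (fieldCoord p Z) (extChartAt 𝓘(ℝ, F) p q))
      (extChartAt 𝓘(ℝ, F) p q) :=
    ((mdifferentiableAt_section_iff_fieldCoord h Z).1 hZ).hasFDerivAt
  have hc : ∀ i, HasMFDerivAt 𝓘(ℝ, F) 𝓘(ℝ, ℝ) (c i) q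
      ((co i ∘L fderiv ℝ (fieldCoord p Z) (extChartAt 𝓘(ℝ, F) p q)) ∘L coordMap (F := F) p q) :=
    fun i ↦ hasMFDerivAt_of_comp_extChartAt_symm h ((co i).hasFDerivAt.comp _ hZd)
  have hS : ∀ i, MDifferentiableAt 𝓘(ℝ, F) (𝓘(ℝ, F).prod 𝓘(ℝ, F))
      (fun y ↦ (⟨y, constField p (e i) y⟩ : TangentBundle 𝓘(ℝ, F) N)) q :=
    fun i ↦ mdifferentiableAt_constField h _
  -- The Leibniz rule is applied to the expansion of `Z` in the frame that is constant in the chart: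
  -- derivatives of the components give the term `fderiv`, and derivatives of the frame give the
  -- Christoffel term.
  have hZeq : ∀ᶠ y in 𝓝 q, Z y = ∑ i, c i y • constField p (e i) y := by
    filter_upwards [(chartAt F p).open_source.mem_nhds h] with y hy
    simp only [c, hco]
    rw [← constField_eq_sum hy, constField_eq hy]
    exact (coordInv_coordMap hy _).symm
  have h1 : cov Z q = ∑ i, (c i q • cov (constField p (e i)) q +
      (mvfderiv 𝓘(ℝ, F) (c i) q).smulRight (constField p (e i) q)) := by
    rw [← cov_sum_smul _ (fun i ↦ (hc i).mdifferentiableAt) hS]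
    exact cov.isCovariantDerivativeOn.congr_of_eventuallyEq hZ
      (MDifferentiableAt.sum_section fun j _ ↦ (hc j).mdifferentiableAt.smul_section (hS j))
      univ_mem hZeq
  have h2 : ∀ i, mvfderiv 𝓘(ℝ, F) (c i) q v =
      e.repr (fderiv ℝ (fieldCoord p Z) (extChartAt 𝓘(ℝ, F) p q) (coordMap (F := F) p q v)) i := by
    intro i
    have : mvfderiv 𝓘(ℝ, F) (c i) q v = mfderiv 𝓘(ℝ, F) 𝓘(ℝ, ℝ) (c i) q v := rfl
    rw [this, (hc i).mfderiv]; rfl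
  have h3 : cov Z q v = ∑ i, (c i q • cov (constField p (e i)) q v +
      mvfderiv 𝓘(ℝ, F) (c i) q v • constField p (e i) q) := by
    rw [h1, sum_apply]; rfl
  rw [h3]
  refine (map_sum (coordMap (F := F) p q) _ _).trans ?_
  have h4 : ∀ i, coordMap (F := F) p q (c i q • cov (constField p (e i)) q v +
      mvfderiv 𝓘(ℝ, F) (c i) q v • constField p (e i) q) =
      c i q • (∑ j, e.repr (coordMap (F := F) p q v) j •
        chrCoeff cov p (e j) (e i) (extChartAt 𝓘(ℝ, F) p q)) +
      e.repr (fderiv ℝ (fieldCoord p Z) (extChartAt 𝓘(ℝ, F) p q) (coordMap (F := F) p q v)) i • e i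
      := by
    intro i
    rw [← h2 i, ← coordMap_cov_constField h]
    refine (map_add (coordMap (F := F) p q) _ _).trans (congrArg₂ _ ?_ ?_)
    · exact map_smul (coordMap (F := F) p q) _ _
    · refine (map_smul (coordMap (F := F) p q) _ _).trans ?_
      rw [constField_eq h, coordMap_coordInv h]
  rw [Finset.sum_congr rfl fun i _ ↦ h4 i, Finset.sum_add_distrib, e.sum_repr, add_comm, chr_apply]
  congr 1
  simp only [Finset.smul_sum, c, hco]
  rw [Finset.sum_comm]
  exact Finset.sum_congr rfl fun j _ ↦ Finset.sum_congr rfl fun i _ ↦ smul_comm _ _ _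

/-- Smoothness of the connection is a statement about globally smooth sections, whereas a constant
field is smooth only on its chart domain. Multiplication by a bump function repairs this without
changing the field near `q`. -/
lemma contMDiffAt_cov_constField [T2Space N] [ContMDiffCovariantDerivative cov ∞] {p q : N}
    (hq : q ∈ (chartAt F p).source) (a b : F) :
    ContMDiffAt 𝓘(ℝ, F) (𝓘(ℝ, F).prod 𝓘(ℝ, F)) ∞
      (fun y ↦ (⟨y, cov (constField p b) y (constField p a y)⟩ : TangentBundle 𝓘(ℝ, F) N)) q := by
  obtain ⟨χ, hχ, -⟩ := (SmoothBumpFunction.nhds_basis_support (I := 𝓘(ℝ, F)) (c := q)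
    ((chartAt F p).open_source.mem_nhds hq)).mem_iff.1 ((chartAt F p).open_source.mem_nhds hq)
  have hglob : ContMDiff 𝓘(ℝ, F) (𝓘(ℝ, F).prod 𝓘(ℝ, F)) ∞
      (fun y ↦ (⟨y, ((χ : N → ℝ) • constField p b) y⟩ : TangentBundle 𝓘(ℝ, F) N)) :=
    ContMDiffOn.smul_section_of_tsupport χ.contMDiff.contMDiffOn (chartAt F p).open_source hχ
      (contMDiffOn_constField p b)
  have h1 := (ContMDiffCovariantDerivative.contMDiff (cov := cov) (k := ∞)).contMDiff
    (σ := (χ : N → ℝ) • constField p b) (by simpa using hglob.contMDiffOn)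
  have h2 := (h1.contMDiffAt (x := q) univ_mem).clm_bundle_apply
    ((contMDiffOn_constField p a).contMDiffAt ((chartAt F p).open_source.mem_nhds hq))
  refine h2.congr_of_eventuallyEq ?_
  -- The value of `cov` at `y` depends on the germ of the field at `y`, so the bump function must be
  -- `1` near `y` and not just at `y`.
  have hev : ∀ᶠ y in 𝓝 q, y ∈ (chartAt F p).source ∧ ∀ᶠ y' in 𝓝 y, (χ : N → ℝ) y' = 1 :=
    Filter.Eventually.and ((chartAt F p).open_source.mem_nhds hq)
      (eventually_eventually_nhds.2 χ.eventuallyEq_one)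
  filter_upwards [hev] with y hy
  have : cov (constField p b) y = cov ((χ : N → ℝ) • constField p b) y := by
    refine cov.isCovariantDerivativeOn.congr_of_eventuallyEq (mdifferentiableAt_constField hy.1 b)
      ((hglob.contMDiffAt (x := y)).mdifferentiableAt (by simp)) univ_mem ?_
    filter_upwards [hy.2] with y' hy'
    simp [hy']
  rw [this]

lemma contDiffAt_chrCoeff [T2Space N] [ContMDiffCovariantDerivative cov ∞] {p : N} (a b : F) {z : F}
    (hz : z ∈ (extChartAt 𝓘(ℝ, F) p).target) : ContDiffAt ℝ ∞ (chrCoeff cov p a b) z := by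
  have := contDiffAt_fieldCoord (extChartAt_symm_mem_source hz)
    (contMDiffAt_cov_constField (cov := cov) (extChartAt_symm_mem_source hz) a b)
  rwa [(extChartAt 𝓘(ℝ, F) p).right_inv hz] at this

lemma contDiffOn_chr [T2Space N] [ContMDiffCovariantDerivative cov ∞] (p : N) :
    ContDiffOn ℝ ∞ (chr cov p) (extChartAt 𝓘(ℝ, F) p).target := by
  intro z hz
  refine ContDiffAt.contDiffWithinAt ?_
  unfold chr
  refine ContDiffAt.sum fun j _ ↦ contDiffAt_const.smulRight ?_
  refine ContDiffAt.sum fun i _ ↦ contDiffAt_const.smulRight ?_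
  exact contDiffAt_chrCoeff _ _ hz

end Christoffel

/-! ### Change of chart for Christoffel symbols, maps and frames. -/

section Transformation

variable {F : Type*} [NormedAddCommGroup F] [NormedSpace ℝ F]
  {N : Type*} [TopologicalSpace N] [ChartedSpace F N] [IsManifold 𝓘(ℝ, F) ∞ N]

lemma differentiableAt_fderiv_coordChange {p p' q : N} (h : q ∈ (chartAt F p).source)
    (h' : q ∈ (chartAt F p').source) :
    DifferentiableAt ℝ (fderiv ℝ (coordChange (F := F) p p')) (extChartAt 𝓘(ℝ, F) p q) :=
  ((contDiffAt_coordChange h h').fderiv_right (m := 1) (by norm_cast)).differentiableAt (by simp)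

lemma eventually_extChartAt_symm_mem {p p' q : N} (h : q ∈ (chartAt F p).source)
    (h' : q ∈ (chartAt F p').source) :
    ∀ᶠ z in 𝓝 (extChartAt 𝓘(ℝ, F) p q), z ∈ (extChartAt 𝓘(ℝ, F) p).target ∧
      (extChartAt 𝓘(ℝ, F) p).symm z ∈ (chartAt F p').source := by
  refine Filter.Eventually.and (extChartAt_target_mem_nhds' (extChartAt_mem_target h)) ?_
  have hc : ContinuousAt (extChartAt 𝓘(ℝ, F) p).symm (extChartAt 𝓘(ℝ, F) p q) :=
    (contMDiffAt_extChartAt_symm (extChartAt_mem_target h)).continuousAt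
  refine hc.eventually_mem ?_
  rw [extChartAt_symm_extChartAt h]
  exact (chartAt F p').open_source.mem_nhds h'

lemma fderiv_fieldCoord_constField {p q : N} (h : q ∈ (chartAt F p).source) (b : F) :
    fderiv ℝ (fieldCoord (F := F) p (constField p b)) (extChartAt 𝓘(ℝ, F) p q) = 0 := by
  have : fieldCoord (F := F) p (constField p b) =ᶠ[𝓝 (extChartAt 𝓘(ℝ, F) p q)] fun _ ↦ b := by
    filter_upwards [extChartAt_target_mem_nhds' (extChartAt_mem_target h)] with z' hz'
    exact fieldCoord_constField b hz'
  rw [this.fderiv_eq]; simp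

/-- The transformation law of the Christoffel symbols. -/
lemma chr_coordChange [FiniteDimensional ℝ F]
    (cov : CovariantDerivative 𝓘(ℝ, F) F (TangentSpace 𝓘(ℝ, F) : N → Type _)) {p p' q : N}
    (h : q ∈ (chartAt F p).source) (h' : q ∈ (chartAt F p').source) (a b : F) :
    chr cov p' (extChartAt 𝓘(ℝ, F) p' q)
        (fderiv ℝ (coordChange p p') (extChartAt 𝓘(ℝ, F) p q) a)
        (fderiv ℝ (coordChange p p') (extChartAt 𝓘(ℝ, F) p q) b) =
      fderiv ℝ (coordChange p p') (extChartAt 𝓘(ℝ, F) p q)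
        (chr cov p (extChartAt 𝓘(ℝ, F) p q) a b) -
      fderiv ℝ (fderiv ℝ (coordChange p p')) (extChartAt 𝓘(ℝ, F) p q) a b := by
  set z := extChartAt 𝓘(ℝ, F) p q with hz
  set ψ := coordChange (F := F) p p' with hψ
  have hC : ∀ w : F, coordMap (F := F) p' q w = fderiv ℝ ψ z (coordMap p q w) := fun w ↦
    (DFunLike.congr_fun (fderiv_coordChange_comp_coordMap h h') w).symm
  have hC' : ∀ w : F, coordMap (F := F) p' q (coordInv p q w) = fderiv ℝ ψ z w := fun w ↦ by
    rw [hC, coordMap_coordInv h]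
  have hdiff := mdifferentiableAt_constField h b
  have e1 := cov_apply_eq (cov := cov) h hdiff (coordInv (F := F) p q a)
  have e2 := cov_apply_eq (cov := cov) h' hdiff (coordInv (F := F) p q a)
  have hconst : fderiv ℝ (fieldCoord (F := F) p (constField p b)) z = 0 :=
    fderiv_fieldCoord_constField h b
  have hfield : HasFDerivAt (fieldCoord (F := F) p' (constField p b))
      (fderiv ℝ (fieldCoord (F := F) p' (constField p b)) (extChartAt 𝓘(ℝ, F) p' q))
      (ψ z) := by
    rw [hψ, hz, coordChange_extChartAt h]
    exact ((mdifferentiableAt_section_iff_fieldCoord h' _).1 hdiff).hasFDerivAt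
  have hcomp := hfield.comp z
    (((contDiffAt_coordChange h h').differentiableAt (by simp)).hasFDerivAt)
  have hcomp' : HasFDerivAt (fun z' ↦ fderiv ℝ ψ z' b) _ z :=
    (differentiableAt_fderiv_coordChange h h').hasFDerivAt.clm_apply (hasFDerivAt_const b z)
  -- Seen in the chart at `p'`, the field that is constant in the chart at `p` has components `Dψ
  -- b`; differentiating them produces the inhomogeneous term `D²ψ`.
  have hev : (fun z' ↦ fderiv ℝ ψ z' b) =ᶠ[𝓝 z]
      fieldCoord (F := F) p' (constField p b) ∘ ψ := by
    filter_upwards [eventually_extChartAt_symm_mem h h'] with z' hz'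
    have hq' := extChartAt_symm_mem_source hz'.1
    have e : z' = extChartAt 𝓘(ℝ, F) p ((extChartAt 𝓘(ℝ, F) p).symm z') :=
      ((extChartAt 𝓘(ℝ, F) p).right_inv hz'.1).symm
    rw [Function.comp_apply]
    conv_rhs => rw [e, hψ, coordChange_extChartAt hq', fieldCoord_extChartAt hz'.2,
      constField_eq hq']
    conv_lhs => rw [e, hψ]
    have := DFunLike.congr_fun (fderiv_coordChange_comp_coordMap hq' hz'.2)
      (coordInv p ((extChartAt 𝓘(ℝ, F) p).symm z') b)
    rw [ContinuousLinearMap.comp_apply, coordMap_coordInv hq'] at this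
    exact this
  have hD := DFunLike.congr_fun ((hcomp.congr_of_eventuallyEq hev).unique hcomp') a
  have e3 : coordMap (F := F) p q (cov (constField p b) q (coordInv (F := F) p q a)) =
      chr cov p z a b := by
    refine e1.trans ?_
    rw [hconst, constField_eq h, coordMap_coordInv h, coordMap_coordInv h,
      zero_apply, zero_add]
  have e4 := hC (cov (constField p b) q (coordInv (F := F) p q a))
  rw [e3] at e4
  have e5 : fderiv ℝ (fieldCoord (F := F) p' (constField p b)) (extChartAt 𝓘(ℝ, F) p' q)
      (fderiv ℝ ψ z a) = fderiv ℝ (fderiv ℝ ψ) z a b :=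
    hD.trans (by rw [ContinuousLinearMap.comp_zero, zero_add]; rfl)
  have e6 := e2.symm.trans e4
  rw [constField_eq h, hC', hC', e5] at e6
  rw [← e6]; abel

variable {D K : Type*} [NormedAddCommGroup D] [NormedSpace ℝ D]
  [NormedAddCommGroup K] [NormedSpace ℝ K] {h : D → N} {s : Set D} {x : D} {p p' : N}

lemma eventually_mem_sources (hc : ContinuousWithinAt h s x)
    (hp : h x ∈ (chartAt F p).source) : ∀ᶠ y in 𝓝[s] x, h y ∈ (chartAt F p).source :=
  hc.eventually_mem ((chartAt F p).open_source.mem_nhds hp)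

lemma extChartAt_comp_eventuallyEq (hc : ContinuousWithinAt h s x)
    (hp : h x ∈ (chartAt F p).source) :
    (fun y ↦ extChartAt 𝓘(ℝ, F) p' (h y)) =ᶠ[𝓝[s] x]
      fun y ↦ coordChange p p' (extChartAt 𝓘(ℝ, F) p (h y)) := by
  filter_upwards [eventually_mem_sources hc hp] with y hy
  rw [coordChange_extChartAt hy]

lemma coordMap_comp_eventuallyEq (hc : ContinuousWithinAt h s x)
    (hp : h x ∈ (chartAt F p).source) (hp' : h x ∈ (chartAt F p').source) (X : D → K →L[ℝ] F) :
    (fun y ↦ coordMap p' (h y) ∘L X y) =ᶠ[𝓝[s] x]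
      fun y ↦ fderiv ℝ (coordChange p p') (extChartAt 𝓘(ℝ, F) p (h y)) ∘L
        (coordMap p (h y) ∘L X y) := by
  filter_upwards [eventually_mem_sources hc hp, eventually_mem_sources hc hp'] with y hy hy'
  rw [← fderiv_coordChange_comp_coordMap hy hy', ContinuousLinearMap.comp_assoc]

lemma hasFDerivWithinAt_extChartAt_comp_change (hc : ContinuousWithinAt h s x)
    (hp : h x ∈ (chartAt F p).source) (hp' : h x ∈ (chartAt F p').source) {c' : D →L[ℝ] F}
    (h1 : HasFDerivWithinAt (fun y ↦ extChartAt 𝓘(ℝ, F) p (h y)) c' s x) :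
    HasFDerivWithinAt (fun y ↦ extChartAt 𝓘(ℝ, F) p' (h y))
      (fderiv ℝ (coordChange p p') (extChartAt 𝓘(ℝ, F) p (h x)) ∘L c') s x := by
  have h2 := ((contDiffAt_coordChange hp hp').differentiableAt
    (by simp)).hasFDerivAt.comp_hasFDerivWithinAt x h1
  exact h2.congr_of_eventuallyEq (extChartAt_comp_eventuallyEq hc hp)
    (coordChange_extChartAt hp).symm

/-- The second derivative of the coordinate change is the term that cancels against the
inhomogeneous term of `chr_coordChange`, which makes covariant derivatives independent of the chart.
-/
lemma hasFDerivWithinAt_coordMap_comp_change (hc : ContinuousWithinAt h s x)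
    (hp : h x ∈ (chartAt F p).source) (hp' : h x ∈ (chartAt F p').source) {c' : D →L[ℝ] F}
    (h1 : HasFDerivWithinAt (fun y ↦ extChartAt 𝓘(ℝ, F) p (h y)) c' s x)
    {X : D → K →L[ℝ] F} {X' : D →L[ℝ] K →L[ℝ] F}
    (h2 : HasFDerivWithinAt (fun y ↦ coordMap p (h y) ∘L X y) X' s x) :
    ∃ Y' : D →L[ℝ] K →L[ℝ] F,
      HasFDerivWithinAt (fun y ↦ coordMap p' (h y) ∘L X y) Y' s x ∧
      ∀ w k, Y' w k = fderiv ℝ (coordChange p p') (extChartAt 𝓘(ℝ, F) p (h x)) (X' w k) +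
        fderiv ℝ (fderiv ℝ (coordChange p p')) (extChartAt 𝓘(ℝ, F) p (h x)) (c' w)
          (coordMap p (h x) (X x k)) := by
  have h3 := (differentiableAt_fderiv_coordChange hp hp').hasFDerivAt.comp_hasFDerivWithinAt x h1
  have h4 := h3.clm_comp h2
  refine ⟨_, h4.congr_of_eventuallyEq (coordMap_comp_eventuallyEq hc hp hp' X) ?_, fun w k ↦ ?_⟩
  · simp only [Function.comp_apply]
    rw [← fderiv_coordChange_comp_coordMap hp hp', ContinuousLinearMap.comp_assoc]
  · simp

lemma contDiffAt_extChartAt_comp_change (hc : ContinuousAt h x)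
    (hp : h x ∈ (chartAt F p).source) (hp' : h x ∈ (chartAt F p').source)
    (h1 : ContDiffAt ℝ ∞ (fun y ↦ extChartAt 𝓘(ℝ, F) p (h y)) x) :
    ContDiffAt ℝ ∞ (fun y ↦ extChartAt 𝓘(ℝ, F) p' (h y)) x := by
  refine ((contDiffAt_coordChange hp hp').comp x h1).congr_of_eventuallyEq ?_
  have := extChartAt_comp_eventuallyEq (p' := p') hc.continuousWithinAt (s := univ) hp
  rwa [nhdsWithin_univ] at this

lemma contDiffAt_coordMap_comp_change (hc : ContinuousAt h x)
    (hp : h x ∈ (chartAt F p).source) (hp' : h x ∈ (chartAt F p').source)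
    (h1 : ContDiffAt ℝ ∞ (fun y ↦ extChartAt 𝓘(ℝ, F) p (h y)) x)
    {X : D → K →L[ℝ] F} (h2 : ContDiffAt ℝ ∞ (fun y ↦ coordMap p (h y) ∘L X y) x) :
    ContDiffAt ℝ ∞ (fun y ↦ coordMap p' (h y) ∘L X y) x := by
  have h3 : ContDiffAt ℝ ∞ (fderiv ℝ (coordChange (F := F) p p')) (extChartAt 𝓘(ℝ, F) p (h x)) :=
    (contDiffAt_coordChange hp hp').fderiv_right (by simp)
  refine ((h3.comp x h1).clm_comp h2).congr_of_eventuallyEq ?_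
  have := coordMap_comp_eventuallyEq hc.continuousWithinAt (s := univ) hp hp' X
  rwa [nhdsWithin_univ] at this

lemma hasMFDerivWithinAt_iff_extChartAt_comp {c' : D →L[ℝ] F} :
    HasMFDerivWithinAt 𝓘(ℝ, D) 𝓘(ℝ, F) h s x c' ↔ ContinuousWithinAt h s x ∧
      HasFDerivWithinAt (fun y ↦ extChartAt 𝓘(ℝ, F) (h x) (h y)) c' s x := by
  simp only [HasMFDerivWithinAt, writtenInExtChartAt, mfld_simps]
  rfl

/-- The derivative of a map into a manifold, read in an arbitrary chart. -/
lemma hasFDerivWithinAt_extChartAt_comp (hp : h x ∈ (chartAt F p).source) {c' : D →L[ℝ] F}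
    (hc : HasMFDerivWithinAt 𝓘(ℝ, D) 𝓘(ℝ, F) h s x c') :
    HasFDerivWithinAt (fun y ↦ extChartAt 𝓘(ℝ, F) p (h y)) (coordMap p (h x) ∘L c') s x := by
  obtain ⟨h1, h2⟩ := hasMFDerivWithinAt_iff_extChartAt_comp.1 hc
  have h3 := hasFDerivWithinAt_extChartAt_comp_change h1 (mem_chart_source F (h x)) hp h2
  have h4 := fderiv_coordChange_comp_coordMap (mem_chart_source F (h x)) hp
  rw [coordMap_self] at h4
  rwa [← h4]

end Transformation

/-! ### Covariant derivatives along maps, in a chart. -/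

section Along

variable {F : Type*} [NormedAddCommGroup F] [NormedSpace ℝ F] [FiniteDimensional ℝ F]
  {N : Type*} [TopologicalSpace N] [ChartedSpace F N] [IsManifold 𝓘(ℝ, F) ∞ N]
  (cov : CovariantDerivative 𝓘(ℝ, F) F (TangentSpace 𝓘(ℝ, F) : N → Type _))
  {D : Type*} [NormedAddCommGroup D] [NormedSpace ℝ D]
  {P : Type*} [TopologicalSpace P] [ChartedSpace D P]

lemma cov_constField_self (p : N) (b v : F) :
    (cov (constField p b) p v : F) = chr cov p (extChartAt 𝓘(ℝ, F) p p) v b := by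
  have hm := mem_chart_source F p
  have h1 := cov_apply_eq (cov := cov) hm (mdifferentiableAt_constField hm b) v
  rw [fderiv_fieldCoord_constField hm, constField_eq hm, coordMap_self, coordInv_self,
    zero_apply, zero_add] at h1
  exact h1

/-- The covariant derivative along a map, in the chart at the base point. -/
lemma covAlong_eq (ξ : P → TangentBundle 𝓘(ℝ, F) N) (s : Set P) (x : P) {a b : D →L[ℝ] F}
    (hs : UniqueMDiffWithinAt 𝓘(ℝ, D) s x)
    (ha : HasMFDerivWithinAt 𝓘(ℝ, D) 𝓘(ℝ, F) (fun q ↦ (ξ q).proj) s x a)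
    (hb : HasMFDerivWithinAt 𝓘(ℝ, D) 𝓘(ℝ, F)
      (fun q ↦ coordMap (F := F) (ξ x).proj (ξ q).proj (ξ q).2) s x b) (v : D) :
    (cov.covAlong (I₁ := 𝓘(ℝ, D)) ξ s x v : F) =
      b v + chr cov (ξ x).proj (extChartAt 𝓘(ℝ, F) (ξ x).proj (ξ x).proj) (a v) (ξ x).2 := by
  have hm := mem_chart_source F (ξ x).proj
  unfold covAlong
  simp only [trivializationAt_snd]
  rw [trivializationAt_symmL hm, coordInv_self, extend_eq_constField,
    hb.mfderivWithin hs, ha.mfderivWithin hs]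
  refine congrArg₂ _ rfl ?_
  exact cov_constField_self cov (ξ x).proj (ξ x).2 (a v)

end Along

/-! ### Torsion and curvature in a chart. -/

section Tensors

variable {F : Type*} [NormedAddCommGroup F] [NormedSpace ℝ F]

/-- The coordinate expression of the torsion in terms of the Christoffel symbols. -/
def torsionCoord (Γ : F → F →L[ℝ] F →L[ℝ] F) (z u v : F) : F := Γ z u v - Γ z v u

/-- The coordinate expression of the curvature in terms of the Christoffel symbols. -/
def curvatureCoord (Γ : F → F →L[ℝ] F →L[ℝ] F) (z u v w : F) : F :=
  fderiv ℝ Γ z u v w - fderiv ℝ Γ z v u w + Γ z u (Γ z v w) - Γ z v (Γ z u w)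

variable {N : Type*} [TopologicalSpace N] [ChartedSpace F N] [IsManifold 𝓘(ℝ, F) ∞ N]

lemma hasMFDerivAt_extChartAt_symm {p : N} {z : F} (hz : z ∈ (extChartAt 𝓘(ℝ, F) p).target) :
    HasMFDerivAt 𝓘(ℝ, F) 𝓘(ℝ, F) (extChartAt 𝓘(ℝ, F) p).symm z
      (coordInv (F := F) p ((extChartAt 𝓘(ℝ, F) p).symm z)) := by
  have h1 := ((contMDiffAt_extChartAt_symm hz).mdifferentiableAt (by simp)).hasMFDerivAt
  have hs := extChartAt_symm_mem_source hz
  have h2 := (hasMFDerivAt_extChartAt hs).comp z h1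
  have h3 : HasMFDerivAt 𝓘(ℝ, F) 𝓘(ℝ, F)
      (extChartAt 𝓘(ℝ, F) p ∘ (extChartAt 𝓘(ℝ, F) p).symm) z (.id ℝ F) := by
    refine (hasMFDerivAt_id z).congr_of_eventuallyEq ?_
    filter_upwards [extChartAt_target_mem_nhds' hz] with z' hz'
    exact (extChartAt 𝓘(ℝ, F) p).right_inv hz'
  have h4 := hasMFDerivAt_unique h2 h3
  have h6 : mfderiv 𝓘(ℝ, F) 𝓘(ℝ, F) (extChartAt 𝓘(ℝ, F) p).symm z =
      coordInv (F := F) p ((extChartAt 𝓘(ℝ, F) p).symm z) := by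
    ext v
    have h5 : coordMap (F := F) p ((extChartAt 𝓘(ℝ, F) p).symm z)
      (mfderiv 𝓘(ℝ, F) 𝓘(ℝ, F) (extChartAt 𝓘(ℝ, F) p).symm z v) = v := DFunLike.congr_fun h4 v
    exact (coordInv_coordMap hs _).symm.trans
      (congrArg (coordInv (F := F) p ((extChartAt 𝓘(ℝ, F) p).symm z)) h5)
  rwa [h6] at h1

lemma inverse_coordInv {p q : N} (h : q ∈ (chartAt F p).source) :
    (coordInv (F := F) p q).inverse = coordMap p q :=
  ContinuousLinearMap.inverse_eq (coordInv_comp_coordMap h) (coordMap_comp_coordInv h)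

lemma mlieBracket_eq_fderiv (V W : Π x : F, TangentSpace 𝓘(ℝ, F) x) (z : F) :
    (VectorField.mlieBracket 𝓘(ℝ, F) V W z : F) =
      fderiv (F := F) ℝ W z (V z) - fderiv (F := F) ℝ V z (W z) := by
  rw [← VectorField.mlieBracketWithin_univ,
    VectorField.mlieBracketWithin_eq_lieBracketWithin]
  exact congrFun (VectorField.lieBracketWithin_univ (𝕜 := ℝ) (V := V) (W := W)) z

/-- The Lie bracket of vector fields, in an arbitrary chart. -/
lemma coordMap_mlieBracket [CompleteSpace F] {p q : N} (h : q ∈ (chartAt F p).source)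
    {V W : Π q : N, TangentSpace 𝓘(ℝ, F) q}
    (hV : MDifferentiableAt 𝓘(ℝ, F) (𝓘(ℝ, F).prod 𝓘(ℝ, F))
      (fun y ↦ (⟨y, V y⟩ : TangentBundle 𝓘(ℝ, F) N)) q)
    (hW : MDifferentiableAt 𝓘(ℝ, F) (𝓘(ℝ, F).prod 𝓘(ℝ, F))
      (fun y ↦ (⟨y, W y⟩ : TangentBundle 𝓘(ℝ, F) N)) q) :
    coordMap (F := F) p q (VectorField.mlieBracket 𝓘(ℝ, F) V W q) =
      fderiv ℝ (fieldCoord p W) (extChartAt 𝓘(ℝ, F) p q) (coordMap (F := F) p q (V q)) -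
      fderiv ℝ (fieldCoord p V) (extChartAt 𝓘(ℝ, F) p q) (coordMap (F := F) p q (W q)) := by
  have hz := extChartAt_mem_target h
  have hq := extChartAt_symm_extChartAt h
  have : IsManifold 𝓘(ℝ, F) (minSmoothness ℝ 2) N := by
    rw [minSmoothness_of_isRCLikeNormedField]; infer_instance
  have key := VectorField.mpullback_mlieBracket (I := 𝓘(ℝ, F)) (I' := 𝓘(ℝ, F))
    (f := (extChartAt 𝓘(ℝ, F) p).symm) (x₀ := extChartAt 𝓘(ℝ, F) p q) (V := V) (W := W) (n := ∞)
    (by rwa [hq]) (by rwa [hq]) (contMDiffAt_extChartAt_symm hz)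
    (by rw [minSmoothness_of_isRCLikeNormedField]; norm_cast)
  have hpull : ∀ X : Π q : N, TangentSpace 𝓘(ℝ, F) q, ∀ z ∈ (extChartAt 𝓘(ℝ, F) p).target,
      VectorField.mpullback 𝓘(ℝ, F) 𝓘(ℝ, F) (extChartAt 𝓘(ℝ, F) p).symm X z =
        fieldCoord p X z := by
    intro X z hz
    rw [VectorField.mpullback_apply, (hasMFDerivAt_extChartAt_symm hz).mfderiv]
    exact DFunLike.congr_fun (inverse_coordInv (extChartAt_symm_mem_source hz)) _
  have hev : ∀ X : Π q : N, TangentSpace 𝓘(ℝ, F) q,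
      VectorField.mpullback 𝓘(ℝ, F) 𝓘(ℝ, F) (extChartAt 𝓘(ℝ, F) p).symm X
        =ᶠ[𝓝 (extChartAt 𝓘(ℝ, F) p q)] fieldCoord p X := fun X ↦ by
    filter_upwards [extChartAt_target_mem_nhds' hz] with z' hz'
    exact hpull X z' hz'
  rw [hpull _ _ hz, fieldCoord_extChartAt h, (hev V).mlieBracket_vectorField_eq (hev W)] at key
  refine (key.trans (mlieBracket_eq_fderiv _ _ _)).trans ?_
  rw [fieldCoord_extChartAt h, fieldCoord_extChartAt h]

variable [FiniteDimensional ℝ F] [CompleteSpace F]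
  {cov : CovariantDerivative 𝓘(ℝ, F) F (TangentSpace 𝓘(ℝ, F) : N → Type _)}

lemma coordMap_torsion {p q : N} (h : q ∈ (chartAt F p).source) (u v : TangentSpace 𝓘(ℝ, F) q) :
    coordMap (F := F) p q (cov.torsion q u v) =
      torsionCoord (chr cov p) (extChartAt 𝓘(ℝ, F) p q) (coordMap (F := F) p q u)
        (coordMap (F := F) p q v) := by
  have hu : constField p (coordMap (F := F) p q u) q = u :=
    (constField_eq h _).trans (coordInv_coordMap h u)
  have hv : constField p (coordMap (F := F) p q v) q = v :=
    (constField_eq h _).trans (coordInv_coordMap h v)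
  have hmu := mdifferentiableAt_constField h (coordMap (F := F) p q u)
  have hmv := mdifferentiableAt_constField h (coordMap (F := F) p q v)
  have h1 := cov.torsion_apply hmu hmv
  rw [hu, hv] at h1
  have e1 := cov_apply_eq (cov := cov) h hmu v
  have e2 := cov_apply_eq (cov := cov) h hmv u
  have e3 := coordMap_mlieBracket h hmu hmv
  rw [fderiv_fieldCoord_constField h, zero_apply] at e1 e2
  rw [fderiv_fieldCoord_constField h, fderiv_fieldCoord_constField h, zero_apply, zero_apply,
    sub_zero] at e3
  rw [hu, zero_add] at e1
  rw [hv, zero_add] at e2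
  rw [h1]
  refine (map_sub (coordMap (F := F) p q) _ _).trans ?_
  rw [e3, sub_zero]
  refine (map_sub (coordMap (F := F) p q) _ _).trans ?_
  rw [e1, e2]; rfl

variable [T2Space N] [ContMDiffCovariantDerivative cov ∞]

/-- The second covariant derivative in a chart. -/
lemma coordMap_cov_cov {p q : N} (h : q ∈ (chartAt F p).source)
    {X Y Z : Π q : N, TangentSpace 𝓘(ℝ, F) q}
    (hY : ContDiffAt ℝ ∞ (fieldCoord p Y) (extChartAt 𝓘(ℝ, F) p q))
    (hZ : ContDiffAt ℝ ∞ (fieldCoord p Z) (extChartAt 𝓘(ℝ, F) p q)) :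
    coordMap (F := F) p q (cov (fun y ↦ cov Z y (Y y)) q (X q)) =
      (fun z x y y' ζ (ζ' : F →L[ℝ] F) ↦ fderiv ℝ (fderiv ℝ (fieldCoord p Z)) z x y + ζ' y' +
        fderiv ℝ (chr cov p) z x y ζ + chr cov p z y' ζ + chr cov p z y (ζ' x) +
        chr cov p z x (ζ' y + chr cov p z y ζ)) (extChartAt 𝓘(ℝ, F) p q)
        (fieldCoord p X (extChartAt 𝓘(ℝ, F) p q)) (fieldCoord p Y (extChartAt 𝓘(ℝ, F) p q))
        (fderiv ℝ (fieldCoord p Y) (extChartAt 𝓘(ℝ, F) p q)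
          (fieldCoord p X (extChartAt 𝓘(ℝ, F) p q)))
        (fieldCoord p Z (extChartAt 𝓘(ℝ, F) p q))
        (fderiv ℝ (fieldCoord p Z) (extChartAt 𝓘(ℝ, F) p q)) := by
  set z := extChartAt 𝓘(ℝ, F) p q
  have hz : z ∈ (extChartAt 𝓘(ℝ, F) p).target := extChartAt_mem_target h
  have hΓ : ContDiffAt ℝ ∞ (chr cov p) z :=
    (contDiffOn_chr p).contDiffAt (extChartAt_target_mem_nhds' hz)
  have hev : fieldCoord p (fun y ↦ cov Z y (Y y)) =ᶠ[𝓝 z] fun z' ↦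
      fderiv ℝ (fieldCoord p Z) z' (fieldCoord p Y z') +
        chr cov p z' (fieldCoord p Y z') (fieldCoord p Z z') := by
    have hd := (hZ.of_le (m := 1) (by norm_cast)).eventually (by simp)
    filter_upwards [extChartAt_target_mem_nhds' hz, hd] with z' hz' hd'
    have hs := extChartAt_symm_mem_source hz'
    have e : extChartAt 𝓘(ℝ, F) p ((extChartAt 𝓘(ℝ, F) p).symm z') = z' :=
      (extChartAt 𝓘(ℝ, F) p).right_inv hz'
    have := cov_apply_eq (cov := cov) hs
      ((mdifferentiableAt_section_iff_fieldCoord hs Z).2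
        (by rw [e]; exact hd'.differentiableAt (by simp))) (Y ((extChartAt 𝓘(ℝ, F) p).symm z'))
    rw [e] at this
    exact this
  have hDZ := ((hZ.fderiv_right (m := ∞) (by simp)).differentiableAt (by simp)).hasFDerivAt
  have hYd := (hY.differentiableAt (by simp)).hasFDerivAt
  have hZd := (hZ.differentiableAt (by simp)).hasFDerivAt
  have hΓd := (hΓ.differentiableAt (by simp)).hasFDerivAt
  have hder := (hDZ.clm_apply hYd).add ((hΓd.clm_apply hYd).clm_apply hZd)
  have hder' := hder.congr_of_eventuallyEq hev
  have h1 := cov_apply_eq (cov := cov) h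
    ((mdifferentiableAt_section_iff_fieldCoord h (fun y ↦ cov Z y (Y y))).2
      hder'.differentiableAt) (X q)
  rw [h1, hder'.fderiv]
  have h2 := hev.eq_of_nhds
  rw [← fieldCoord_extChartAt h X, ← fieldCoord_extChartAt h (fun y ↦ cov Z y (Y y)), h2]
  simp only [add_apply, ContinuousLinearMap.comp_apply, ContinuousLinearMap.flip_apply]
  abel

/-- In the difference of the two second covariant derivatives, `D²Z` cancels by symmetry, and so do
the products of `Γ` with first derivatives of `Z`. The terms with derivatives of `X` and `Y` make up
the covariant derivative along the bracket. Only the values of the fields at the point remain: this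
is tensoriality. -/
lemma coordMap_curvatureField {p q : N} (h : q ∈ (chartAt F p).source)
    {X Y Z : Π q : N, TangentSpace 𝓘(ℝ, F) q}
    (hX : ContDiffAt ℝ ∞ (fieldCoord p X) (extChartAt 𝓘(ℝ, F) p q))
    (hY : ContDiffAt ℝ ∞ (fieldCoord p Y) (extChartAt 𝓘(ℝ, F) p q))
    (hZ : ContDiffAt ℝ ∞ (fieldCoord p Z) (extChartAt 𝓘(ℝ, F) p q)) :
    coordMap (F := F) p q (cov.curvatureField X Y Z q) =
      curvatureCoord (chr cov p) (extChartAt 𝓘(ℝ, F) p q) (coordMap (F := F) p q (X q))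
        (coordMap (F := F) p q (Y q)) (coordMap (F := F) p q (Z q)) := by
  have h1 := coordMap_cov_cov (cov := cov) (X := X) h hY hZ
  have h2 := coordMap_cov_cov (cov := cov) (X := Y) h hX hZ
  have hd : ∀ {W : Π q : N, TangentSpace 𝓘(ℝ, F) q},
      ContDiffAt ℝ ∞ (fieldCoord p W) (extChartAt 𝓘(ℝ, F) p q) →
      MDifferentiableAt 𝓘(ℝ, F) (𝓘(ℝ, F).prod 𝓘(ℝ, F))
        (fun y ↦ (⟨y, W y⟩ : TangentBundle 𝓘(ℝ, F) N)) q := fun hW ↦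
    (mdifferentiableAt_section_iff_fieldCoord h _).2 (hW.differentiableAt (by simp))
  have h3 := cov_apply_eq (cov := cov) h (hd hZ) (VectorField.mlieBracket 𝓘(ℝ, F) X Y q)
  rw [coordMap_mlieBracket h (hd hX) (hd hY)] at h3
  have hsymm : IsSymmSndFDerivAt ℝ (fieldCoord p Z) (extChartAt 𝓘(ℝ, F) p q) :=
    hZ.isSymmSndFDerivAt (by simp; norm_cast)
  unfold curvatureField
  refine (map_sub (coordMap (F := F) p q) _ _).trans ?_
  rw [h3]
  refine (congrArg₂ _ (map_sub (coordMap (F := F) p q) _ _) rfl).trans ?_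
  rw [h1, h2]
  simp only [fieldCoord_extChartAt h, curvatureCoord, map_add, map_sub, sub_apply]
  rw [hsymm.eq (coordMap (F := F) p q (X q))]
  abel

/-- The definition of the curvature at `q` extends vectors by fields constant in the chart at `q`,
which are not constant in the chart at `p`; tensoriality makes the choice irrelevant. -/
lemma coordMap_curvature {p q : N} (h : q ∈ (chartAt F p).source)
    (u v w : TangentSpace 𝓘(ℝ, F) q) :
    coordMap (F := F) p q (cov.curvature q u v w) =
      curvatureCoord (chr cov p) (extChartAt 𝓘(ℝ, F) p q) (coordMap (F := F) p q u)
        (coordMap (F := F) p q v) (coordMap (F := F) p q w) := by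
  have hq := mem_chart_source F q
  have hc : ∀ a : F, ContDiffAt ℝ ∞ (fieldCoord p (constField (F := F) q a))
      (extChartAt 𝓘(ℝ, F) p q) := fun a ↦ contDiffAt_fieldCoord h
    ((contMDiffOn_constField q a).contMDiffAt ((chartAt F q).open_source.mem_nhds hq))
  have he : ∀ a : TangentSpace 𝓘(ℝ, F) q, constField (F := F) q a q = a := fun a ↦
    (constField_eq (F := F) hq a).trans (DFunLike.congr_fun (coordInv_self (F := F) q) _)
  unfold curvature
  rw [extend_eq_constField, extend_eq_constField, extend_eq_constField,
    coordMap_curvatureField h (hc u) (hc v) (hc w), he, he, he]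

end Tensors

/-! ### Cartan's structure equations along rays, in coordinates. -/

section StructureEquations

variable {E F : Type*} [NormedAddCommGroup E] [NormedSpace ℝ E]
  [NormedAddCommGroup F] [NormedSpace ℝ F] [CompleteSpace F]

lemma inverse_apply_apply {B : F →L[ℝ] F} (hB : IsUnit B) (x : F) : Ring.inverse B (B x) = x :=
  DFunLike.congr_fun (Ring.inverse_mul_cancel B hB) x

lemma apply_inverse_apply {B : F →L[ℝ] F} (hB : IsUnit B) (x : F) : B (Ring.inverse B x) = x :=
  DFunLike.congr_fun (Ring.mul_inverse_cancel B hB) x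

lemma hasDerivWithinAt_ringInverse {B : ℝ → F →L[ℝ] F} {B' : F →L[ℝ] F} {s : Set ℝ} {t : ℝ}
    (hB : HasDerivWithinAt B B' s t) (hu : IsUnit (B t)) :
    HasDerivWithinAt (fun τ ↦ Ring.inverse (B τ))
      (-(Ring.inverse (B t) ∘L B' ∘L Ring.inverse (B t))) s t := by
  obtain ⟨b, hb⟩ := hu
  have h := hasFDerivAt_ringInverse (𝕜 := ℝ) b
  rw [hb] at h
  have he : (-(ContinuousLinearMap.mulLeftRight ℝ (F →L[ℝ] F)) ↑b⁻¹ ↑b⁻¹) B' =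
      -(Ring.inverse (B t) ∘L B' ∘L Ring.inverse (B t)) := by
    rw [← hb, Ring.inverse_unit]; rfl
  rw [← he]
  exact HasFDerivAt.comp_hasDerivWithinAt (l := Ring.inverse) t h hB

/-- Differentiating the components of a vector with respect to a moving frame. -/
lemma hasDerivWithinAt_inverse_apply {B : ℝ → F →L[ℝ] F} {B' : F →L[ℝ] F} {X : ℝ → F} {X' : F}
    {s : Set ℝ} {t : ℝ} (hB : HasDerivWithinAt B B' s t) (hu : IsUnit (B t))
    (hX : HasDerivWithinAt X X' s t) :
    HasDerivWithinAt (fun τ ↦ Ring.inverse (B τ) (X τ))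
      (Ring.inverse (B t) (X' - B' (Ring.inverse (B t) (X t)))) s t := by
  convert (hasDerivWithinAt_ringInverse hB hu).clm_apply hX using 1
  simp only [map_sub, neg_apply, ContinuousLinearMap.comp_apply]
  abel

lemma hasDerivWithinAt_inverse_comp {B X : ℝ → F →L[ℝ] F} {B' X' : F →L[ℝ] F}
    {s : Set ℝ} {t : ℝ} (hB : HasDerivWithinAt B B' s t) (hu : IsUnit (B t))
    (hX : HasDerivWithinAt X X' s t) :
    HasDerivWithinAt (fun τ ↦ Ring.inverse (B τ) ∘L X τ)
      (Ring.inverse (B t) ∘L (X' - B' ∘L (Ring.inverse (B t) ∘L X t))) s t := by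
  convert (hasDerivWithinAt_ringInverse hB hu).clm_comp hX using 1
  ext k
  simp only [map_sub, neg_apply, add_apply, sub_apply, ContinuousLinearMap.comp_apply]
  abel

/-- The components, with respect to the frame `B` along `c`, of the derivative of `c`. -/
def frameForm (c : E → F) (B : E → F →L[ℝ] F) (v w : E) : F :=
  Ring.inverse (B v) (fderiv ℝ c v w)

/-- The components, with respect to the frame `B` along `c`, of its own covariant derivative. -/
def frameConn (Γ : F → F →L[ℝ] F →L[ℝ] F) (c : E → F) (B : E → F →L[ℝ] F) (v w : E) : F →L[ℝ] F :=
  Ring.inverse (B v) ∘L (fderiv ℝ B v w + Γ (c v) (fderiv ℝ c v w) ∘L B v)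

variable {Γ : F → F →L[ℝ] F →L[ℝ] F} {c : E → F} {B : E → F →L[ℝ] F} {L : E →L[ℝ] F} {u w : E}
  {t : ℝ}

lemma hasDerivAt_comp_smul {G : Type*} [NormedAddCommGroup G] [NormedSpace ℝ G] {f : E → G}
    (hf : DifferentiableAt ℝ f (t • u)) :
    HasDerivAt (fun τ : ℝ ↦ f (τ • u)) (fderiv ℝ f (t • u) u) t := by
  have h : HasDerivAt (fun τ : ℝ ↦ τ • u) u t := by
    simpa using (hasDerivAt_id t).smul_const u
  exact hf.hasFDerivAt.comp_hasDerivAt t h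

/-- Symmetry of the second derivative brings the result into the form on the left of
`fderiv_radial`. The derivative of `f` is evaluated on `τ • w` and not on `w`, so that it vanishes
at `τ = 0`. -/
lemma hasDerivAt_fderiv_smul {G : Type*} [NormedAddCommGroup G] [NormedSpace ℝ G] {f : E → G}
    (hf : ContDiffAt ℝ ∞ f (t • u)) (w : E) :
    HasDerivAt (fun τ : ℝ ↦ fderiv ℝ f (τ • u) (τ • w))
      (fderiv ℝ (fderiv ℝ f) (t • u) w (t • u) + fderiv ℝ f (t • u) w) t := by
  have h1 := hasDerivAt_comp_smul (u := u) (t := t)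
    ((hf.fderiv_right (m := ∞) (by simp)).differentiableAt (by simp))
  have h2 : HasDerivAt (fun τ : ℝ ↦ τ • w) w t := by
    simpa using (hasDerivAt_id t).smul_const w
  have hs : IsSymmSndFDerivAt ℝ f (t • u) := hf.isSymmSndFDerivAt (by simp; norm_cast)
  convert h1.clm_apply h2 using 2
  simp [hs.eq u w]

/-- Differentiating a radial identity `Df(v) v = g(v)`. -/
lemma fderiv_radial {G : Type*} [NormedAddCommGroup G] [NormedSpace ℝ G] {f g : E → G}
    {g' : E →L[ℝ] G} {x : E} (hf : ContDiffAt ℝ ∞ f x) (hg : HasFDerivAt g g' x)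
    (h : ∀ᶠ v in 𝓝 x, fderiv ℝ f v v = g v) (w : E) :
    fderiv ℝ (fderiv ℝ f) x w x + fderiv ℝ f x w = g' w := by
  have h1 := ((hf.fderiv_right (m := ∞) (by simp)).differentiableAt
    (by simp)).hasFDerivAt.clm_apply (hasFDerivAt_id x)
  have h2 := DFunLike.congr_fun (h1.unique (hg.congr_of_eventuallyEq h)) w
  rw [← h2]
  simp [add_comm]

/-- Cartan's first structure equation along a ray, for a frame which is parallel along rays. -/
lemma hasDerivAt_frameForm (hc : ContDiffAt ℝ ∞ c (t • u)) (hB : ContDiffAt ℝ ∞ B (t • u))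
    (hu : IsUnit (B (t • u)))
    (h1 : ∀ᶠ v in 𝓝 (t • u), fderiv ℝ c v v = B v (L v))
    (h2 : fderiv ℝ B (t • u) u = -(Γ (c (t • u)) (B (t • u) (L u)) ∘L B (t • u))) :
    HasDerivAt (fun τ : ℝ ↦ frameForm c B (τ • u) (τ • w))
      (frameConn Γ c B (t • u) (t • w) (L u) + L w + Ring.inverse (B (t • u))
        (torsionCoord Γ (c (t • u)) (B (t • u) (L u))
          (B (t • u) (frameForm c B (t • u) (t • w))))) t := by
  have hS := hasDerivAt_fderiv_smul hc w
  have hBd := hB.differentiableAt (by simp)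
  have hr := fderiv_radial hc (hBd.hasFDerivAt.clm_apply L.hasFDerivAt) h1 w
  -- Differentiating the radial identity `Dc(v) v = B(v) L v` removes all second derivatives of `c`.
  rw [hr] at hS
  have key := hasDerivWithinAt_inverse_apply (hasDerivAt_comp_smul hBd).hasDerivWithinAt hu
    (hS.hasDerivWithinAt (s := univ))
  rw [hasDerivWithinAt_univ] at key
  refine key.congr_deriv ?_
  rw [h2]
  simp only [frameForm, frameConn, torsionCoord, apply_inverse_apply hu,
    add_apply, neg_apply, ContinuousLinearMap.comp_apply,
    ContinuousLinearMap.flip_apply, map_smul, map_add, map_sub, map_neg, smul_apply,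
    inverse_apply_apply hu]
  module

/-- Cartan's second structure equation along a ray, for a frame which is parallel along rays. -/
lemma hasDerivAt_frameConn (hc : ContDiffAt ℝ ∞ c (t • u)) (hB : ContDiffAt ℝ ∞ B (t • u))
    (hΓ : DifferentiableAt ℝ Γ (c (t • u))) (hu : IsUnit (B (t • u)))
    (h1 : ∀ᶠ v in 𝓝 (t • u), fderiv ℝ c v v = B v (L v))
    (h2 : ∀ᶠ v in 𝓝 (t • u), fderiv ℝ B v v = -(Γ (c v) (B v (L v)) ∘L B v))
    (h3 : fderiv ℝ c (t • u) u = B (t • u) (L u))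
    (h4 : fderiv ℝ B (t • u) u = -(Γ (c (t • u)) (B (t • u) (L u)) ∘L B (t • u))) :
    ∃ K : F →L[ℝ] F, HasDerivAt (fun τ : ℝ ↦ frameConn Γ c B (τ • u) (τ • w)) K t ∧
      ∀ k, K k = Ring.inverse (B (t • u))
        (curvatureCoord Γ (c (t • u)) (B (t • u) (L u))
          (B (t • u) (frameForm c B (t • u) (t • w))) (B (t • u) k)) := by
  have hcd := hc.differentiableAt (by simp)
  have hBd := hB.differentiableAt (by simp)
  have hS := hasDerivAt_fderiv_smul hc w
  rw [fderiv_radial hc (hBd.hasFDerivAt.clm_apply L.hasFDerivAt) h1 w] at hS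
  have hDB := hasDerivAt_fderiv_smul hB w
  have hΓc : HasFDerivAt (fun v ↦ Γ (c v)) (fderiv ℝ Γ (c (t • u)) ∘L fderiv ℝ c (t • u)) (t • u) :=
    HasFDerivAt.comp (g := Γ) (t • u) hΓ.hasFDerivAt hcd.hasFDerivAt
  -- The right side of the radial equation for `B` is differentiated; by `fderiv_radial` this
  -- replaces the second derivatives of `B` and brings in the derivative of `Γ` that enters the
  -- curvature.
  have hrad := ((hΓc.clm_apply (hBd.hasFDerivAt.clm_apply L.hasFDerivAt)).clm_comp hBd.hasFDerivAt).neg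
  rw [fderiv_radial hB hrad h2 w] at hDB
  have hB' := hasDerivAt_comp_smul hBd
  have hΓr := hasDerivAt_comp_smul (G := F →L[ℝ] F →L[ℝ] F) (f := fun v ↦ Γ (c v)) hΓc.differentiableAt
  rw [hΓc.fderiv] at hΓr
  have hH := hDB.add ((hΓr.clm_apply hS).clm_comp hB')
  have key := hasDerivWithinAt_inverse_comp hB'.hasDerivWithinAt hu
    (hH.hasDerivWithinAt (s := univ))
  rw [hasDerivWithinAt_univ] at key
  refine ⟨_, key, fun k ↦ ?_⟩
  rw [h4]
  simp only [frameForm, curvatureCoord, apply_inverse_apply hu, h3,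
    add_apply, neg_apply, sub_apply, ContinuousLinearMap.comp_apply,
    ContinuousLinearMap.flip_apply, map_smul, map_add, map_sub, map_neg, smul_apply,
    Pi.add_apply, ContinuousLinearMap.compL_apply]
  module

end StructureEquations

/-! ### Solder and connection forms of a radial frame on a manifold. -/

section RadialFrame

variable {E : Type*} [NormedAddCommGroup E] [NormedSpace ℝ E]
  {F : Type*} [NormedAddCommGroup F] [NormedSpace ℝ F] [FiniteDimensional ℝ F]
  {N : Type*} [TopologicalSpace N] [ChartedSpace F N] [IsManifold 𝓘(ℝ, F) ∞ N]
  {cov : CovariantDerivative 𝓘(ℝ, F) F (TangentSpace 𝓘(ℝ, F) : N → Type _)}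

/-- A map `y : U → N` and a frame `Q` along it, such that every ray `t ↦ y (t u)` has velocity
`Q (L u)` and `Q` is parallel along it. -/
structure IsRadialFrame (cov : CovariantDerivative 𝓘(ℝ, F) F (TangentSpace 𝓘(ℝ, F) : N → Type _))
    (U : Set E) (L : E →L[ℝ] F) (y : E → N) (Q : E → F →L[ℝ] F) : Prop where
  continuousAt : ∀ v ∈ U, ContinuousAt y v
  contDiffAt_base : ∀ v ∈ U, ∀ p, y v ∈ (chartAt F p).source →
    ContDiffAt ℝ ∞ (fun v ↦ extChartAt 𝓘(ℝ, F) p (y v)) v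
  contDiffAt_frame : ∀ v ∈ U, ∀ p, y v ∈ (chartAt F p).source →
    ContDiffAt ℝ ∞ (fun v ↦ coordMap p (y v) ∘L Q v) v
  isUnit : ∀ v ∈ U, IsUnit (Q v)
  fderiv_base : ∀ u ∈ U, ∀ t ∈ Icc (0 : ℝ) 1, ∀ p, y (t • u) ∈ (chartAt F p).source →
    fderiv ℝ (fun v ↦ extChartAt 𝓘(ℝ, F) p (y v)) (t • u) u =
      coordMap p (y (t • u)) (Q (t • u) (L u))
  fderiv_frame : ∀ u ∈ U, ∀ t ∈ Icc (0 : ℝ) 1, ∀ p, y (t • u) ∈ (chartAt F p).source →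
    fderiv ℝ (fun v ↦ coordMap p (y v) ∘L Q v) (t • u) u =
      -((chr cov p (extChartAt 𝓘(ℝ, F) p (y (t • u)))
        (coordMap p (y (t • u)) (Q (t • u) (L u)))) ∘L (coordMap p (y (t • u)) ∘L Q (t • u)))

/-- The form `Q⁻¹ dy`, computed in the chart at `p`. -/
def solder (p : N) (y : E → N) (Q : E → F →L[ℝ] F) (v w : E) : F :=
  frameForm (fun v ↦ extChartAt 𝓘(ℝ, F) p (y v)) (fun v ↦ coordMap p (y v) ∘L Q v) v w

variable (cov) in
/-- The form `Q⁻¹ ∇Q`, computed in the chart at `p`. -/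
def connForm (p : N) (y : E → N) (Q : E → F →L[ℝ] F) (v w : E) : F →L[ℝ] F :=
  frameConn (chr cov p) (fun v ↦ extChartAt 𝓘(ℝ, F) p (y v))
    (fun v ↦ coordMap p (y v) ∘L Q v) v w

lemma isUnit_coordMap {p q : N} (h : q ∈ (chartAt F p).source) :
    IsUnit (coordMap (F := F) p q) :=
  ⟨⟨coordMap p q, coordInv p q, coordMap_comp_coordInv h, coordInv_comp_coordMap h⟩, rfl⟩

lemma isUnit_coordMap_comp {p q : N} (h : q ∈ (chartAt F p).source) {A : F →L[ℝ] F}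
    (hA : IsUnit A) : IsUnit (coordMap p q ∘L A) := (isUnit_coordMap h).mul hA

variable [CompleteSpace F]

lemma inverse_coordMap_comp {p q : N} (h : q ∈ (chartAt F p).source) {A : F →L[ℝ] F}
    (hA : IsUnit A) (x : F) :
    Ring.inverse (coordMap p q ∘L A) (coordMap p q x) = Ring.inverse A x := by
  conv_lhs => rw [← apply_inverse_apply hA x]
  exact inverse_apply_apply (isUnit_coordMap_comp h hA) _

lemma inverse_coordMap_comp_change {p p' q : N} (h : q ∈ (chartAt F p).source)
    (h' : q ∈ (chartAt F p').source) {A : F →L[ℝ] F} (hA : IsUnit A) (x : F) :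
    Ring.inverse (coordMap p' q ∘L A)
        (fderiv ℝ (coordChange p p') (extChartAt 𝓘(ℝ, F) p q) x) =
      Ring.inverse (coordMap p q ∘L A) x := by
  conv_lhs => rw [← coordMap_coordInv h x]
  conv_rhs => rw [← coordMap_coordInv h x]
  rw [inverse_coordMap_comp h hA, ← inverse_coordMap_comp h' hA,
    ← fderiv_coordChange_comp_coordMap h h']
  rfl

lemma torsion_eq (p : N) (u v : F) :
    (cov.torsion p u v : F) = torsionCoord (chr cov p) (extChartAt 𝓘(ℝ, F) p p) u v := by
  have := coordMap_torsion (cov := cov) (mem_chart_source F p) u v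
  rw [coordMap_self] at this
  exact this

section

variable {U : Set E} {L : E →L[ℝ] F} {y : E → N} {Q : E → F →L[ℝ] F}
  {v : E} {p p' : N}

lemma IsRadialFrame.fderiv_base_change (hQ : IsRadialFrame cov U L y Q)
    (hv : v ∈ U) (hp : y v ∈ (chartAt F p).source)
    (hp' : y v ∈ (chartAt F p').source) :
    fderiv ℝ (fun v ↦ extChartAt 𝓘(ℝ, F) p' (y v)) v =
      fderiv ℝ (coordChange p p') (extChartAt 𝓘(ℝ, F) p (y v)) ∘L
        fderiv ℝ (fun v ↦ extChartAt 𝓘(ℝ, F) p (y v)) v := by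
  have h1 := ((hQ.contDiffAt_base v hv p hp).differentiableAt (by simp)).hasFDerivAt
  have h2 := hasFDerivWithinAt_extChartAt_comp_change
    (hQ.continuousAt v hv).continuousWithinAt hp hp' (h1.hasFDerivWithinAt (s := univ))
  exact (hasFDerivWithinAt_univ.1 h2).fderiv

lemma IsRadialFrame.solder_eq (hQ : IsRadialFrame cov U L y Q)
    (hv : v ∈ U) (hp : y v ∈ (chartAt F p).source)
    (hp' : y v ∈ (chartAt F p').source) (w : E) : solder p' y Q v w = solder p y Q v w := by
  unfold solder frameForm
  rw [hQ.fderiv_base_change hv hp hp']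
  exact inverse_coordMap_comp_change hp hp' (hQ.isUnit v hv) _

/-- The second derivatives of the coordinate change, from the frame and from the Christoffel
symbols, cancel. The remaining factor, its first derivative, is absorbed by the inverse frame. -/
lemma IsRadialFrame.connForm_eq (hQ : IsRadialFrame cov U L y Q)
    (hv : v ∈ U) (hp : y v ∈ (chartAt F p).source)
    (hp' : y v ∈ (chartAt F p').source) (w : E) :
    connForm cov p' y Q v w = connForm cov p y Q v w := by
  have h1 := ((hQ.contDiffAt_base v hv p hp).differentiableAt (by simp)).hasFDerivAt
  have h2 := ((hQ.contDiffAt_frame v hv p hp).differentiableAt (by simp)).hasFDerivAt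
  obtain ⟨Y', hY', hY⟩ := hasFDerivWithinAt_coordMap_comp_change
    (hQ.continuousAt v hv).continuousWithinAt hp hp' (h1.hasFDerivWithinAt (s := univ))
    (h2.hasFDerivWithinAt (s := univ))
  have hY2 := (hasFDerivWithinAt_univ.1 hY').fderiv
  have hC : ∀ k : F, coordMap p' (y v) k =
      fderiv ℝ (coordChange p p') (extChartAt 𝓘(ℝ, F) p (y v)) (coordMap p (y v) k) := fun k ↦
    (DFunLike.congr_fun (fderiv_coordChange_comp_coordMap hp hp') k).symm
  ext k
  set x := (fderiv ℝ (fun v ↦ coordMap p (y v) ∘L Q v) v w +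
    chr cov p (extChartAt 𝓘(ℝ, F) p (y v)) (fderiv ℝ (fun v ↦ extChartAt 𝓘(ℝ, F) p (y v)) v w) ∘L
      (coordMap p (y v) ∘L Q v)) k with hx
  have key : (fderiv ℝ (fun v ↦ coordMap p' (y v) ∘L Q v) v w +
    chr cov p' (extChartAt 𝓘(ℝ, F) p' (y v)) (fderiv ℝ (fun v ↦ extChartAt 𝓘(ℝ, F) p' (y v)) v w)
      ∘L (coordMap p' (y v) ∘L Q v)) k =
      fderiv ℝ (coordChange p p') (extChartAt 𝓘(ℝ, F) p (y v)) x := by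
    rw [hY2, hQ.fderiv_base_change hv hp hp', hx]
    simp only [add_apply, ContinuousLinearMap.comp_apply, hY, hC, map_add,
      chr_coordChange cov hp hp']
    abel
  exact (congrArg (fun z ↦ Ring.inverse (coordMap p' (y v) ∘L Q v) z) key).trans
    (inverse_coordMap_comp_change hp hp' (hQ.isUnit v hv) _)

end

variable {U : Set E} {L : E →L[ℝ] F} {y : E → N} {Q : E → F →L[ℝ] F}

lemma eventually_smul_mem {u : E} {t : ℝ} {s : Set E} (hs : s ∈ 𝓝 (t • u)) :
    ∀ᶠ τ : ℝ in 𝓝 t, τ • u ∈ s :=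
  (continuous_id.smul continuous_const).continuousAt.eventually_mem hs

lemma IsRadialFrame.eventually_mem (hQ : IsRadialFrame cov U L y Q) (hU : IsOpen U) {v : E}
    (hv : v ∈ U) {p : N} (hp : y v ∈ (chartAt F p).source) :
    ∀ᶠ v' in 𝓝 v, v' ∈ U ∧ y v' ∈ (chartAt F p).source :=
  Filter.Eventually.and (hU.mem_nhds hv)
    ((hQ.continuousAt v hv).eventually_mem ((chartAt F p).open_source.mem_nhds hp))

lemma IsRadialFrame.fderiv_base_self (hQ : IsRadialFrame cov U L y Q) {v : E}
    (hv : v ∈ U) {p : N} (hp : y v ∈ (chartAt F p).source) :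
    fderiv ℝ (fun v ↦ extChartAt 𝓘(ℝ, F) p (y v)) v v = coordMap p (y v) (Q v (L v)) := by
  have := hQ.fderiv_base v hv 1 (by simp) p (by rwa [one_smul])
  rwa [one_smul] at this

lemma IsRadialFrame.fderiv_frame_self (hQ : IsRadialFrame cov U L y Q) {v : E}
    (hv : v ∈ U) {p : N} (hp : y v ∈ (chartAt F p).source) :
    fderiv ℝ (fun v ↦ coordMap p (y v) ∘L Q v) v v =
      -((chr cov p (extChartAt 𝓘(ℝ, F) p (y v)) (coordMap p (y v) (Q v (L v)))) ∘L
        (coordMap p (y v) ∘L Q v)) := by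
  have := hQ.fderiv_frame v hv 1 (by simp) p (by rwa [one_smul])
  rwa [one_smul] at this

/-- The form is written in the chart at the moving point `y (τ • u)`. Chart independence replaces it
near `t` by the chart at `y (t • u)`, where the coordinate computation applies and where, at time
`t`, coordinates of vectors are the vectors themselves. -/
lemma IsRadialFrame.hasDerivAt_solder (hQ : IsRadialFrame cov U L y Q) (hU : IsOpen U)
    (hstar : StarConvex ℝ 0 U) {u : E} (hu : u ∈ U) (w : E) {t : ℝ} (ht : t ∈ Icc (0 : ℝ) 1) :
    HasDerivAt (fun τ : ℝ ↦ solder (y (τ • u)) y Q (τ • u) (τ • w))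
      (connForm cov (y (t • u)) y Q (t • u) (t • w) (L u) + L w + Ring.inverse (Q (t • u))
        (cov.torsion (y (t • u)) (Q (t • u) (L u))
          (Q (t • u) (solder (y (t • u)) y Q (t • u) (t • w))))) t := by
  have htu : t • u ∈ U := hstar.smul_mem hu ht.1 ht.2
  have hp := mem_chart_source F (y (t • u))
  have hev := hQ.eventually_mem hU htu hp
  have h := hasDerivAt_frameForm (L := L) (w := w) (Γ := chr cov (y (t • u)))
    (hQ.contDiffAt_base _ htu _ hp) (hQ.contDiffAt_frame _ htu _ hp)
    (isUnit_coordMap_comp hp (hQ.isUnit _ htu))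
    (by filter_upwards [hev] with v hv using hQ.fderiv_base_self hv.1 hv.2)
    (hQ.fderiv_frame u hu t ht _ hp)
  refine (h.congr_of_eventuallyEq (f₁ := fun τ : ℝ ↦ solder (y (τ • u)) y Q (τ • u) (τ • w))
    ?_).congr_deriv ?_
  · filter_upwards [eventually_smul_mem hev] with τ hτ
    exact hQ.solder_eq hτ.1 hτ.2 (mem_chart_source F _) _
  · rw [torsion_eq, coordMap_self, ContinuousLinearMap.id_comp]
    rfl

variable [T2Space N] [ContMDiffCovariantDerivative cov ∞]

lemma curvature_eq (p : N) (u v w : F) :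
    (cov.curvature p u v w : F) =
      curvatureCoord (chr cov p) (extChartAt 𝓘(ℝ, F) p p) u v w := by
  have := coordMap_curvature (cov := cov) (mem_chart_source F p) u v w
  rw [coordMap_self] at this
  exact this

lemma contDiffAt_chr {p q : N} (h : q ∈ (chartAt F p).source) :
    ContDiffAt ℝ ∞ (chr cov p) (extChartAt 𝓘(ℝ, F) p q) :=
  (contDiffOn_chr p).contDiffAt (extChartAt_target_mem_nhds' (extChartAt_mem_target h))

lemma IsRadialFrame.hasDerivAt_connForm (hQ : IsRadialFrame cov U L y Q) (hU : IsOpen U)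
    (hstar : StarConvex ℝ 0 U) {u : E} (hu : u ∈ U) (w : E) {t : ℝ} (ht : t ∈ Icc (0 : ℝ) 1) :
    ∃ K : F →L[ℝ] F,
      HasDerivAt (fun τ : ℝ ↦ connForm cov (y (τ • u)) y Q (τ • u) (τ • w)) K t ∧
      ∀ k, K k = Ring.inverse (Q (t • u)) (cov.curvature (y (t • u)) (Q (t • u) (L u))
        (Q (t • u) (solder (y (t • u)) y Q (t • u) (t • w))) (Q (t • u) k)) := by
  have htu : t • u ∈ U := hstar.smul_mem hu ht.1 ht.2
  have hp := mem_chart_source F (y (t • u))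
  have hev := hQ.eventually_mem hU htu hp
  obtain ⟨K, h, hK⟩ := hasDerivAt_frameConn (L := L) (w := w) (Γ := chr cov (y (t • u)))
    (hQ.contDiffAt_base _ htu _ hp) (hQ.contDiffAt_frame _ htu _ hp)
    ((contDiffAt_chr hp).differentiableAt (by simp))
    (isUnit_coordMap_comp hp (hQ.isUnit _ htu))
    (by filter_upwards [hev] with v hv using hQ.fderiv_base_self hv.1 hv.2)
    (by filter_upwards [hev] with v hv using hQ.fderiv_frame_self hv.1 hv.2)
    (hQ.fderiv_base u hu t ht _ hp) (hQ.fderiv_frame u hu t ht _ hp)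
  refine ⟨K, h.congr_of_eventuallyEq ?_, fun k ↦ ?_⟩
  · filter_upwards [eventually_smul_mem hev] with τ hτ
    exact hQ.connForm_eq hτ.1 hτ.2 (mem_chart_source F _) _
  · rw [hK, curvature_eq, coordMap_self, ContinuousLinearMap.id_comp]
    rfl

end RadialFrame

/-! ### The structure equations as a linear differential equation. -/

section StructureOperator

variable {E : Type*} [NormedAddCommGroup E] [NormedSpace ℝ E]
  {F : Type*} [NormedAddCommGroup F] [NormedSpace ℝ F]

/-- The torsion in coordinates, as a continuous linear map in the second argument. -/
def torsionCoordL (Γ : F → F →L[ℝ] F →L[ℝ] F) (z u : F) : F →L[ℝ] F := Γ z u - (Γ z).flip u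

/-- The curvature in coordinates, as a continuous linear map in the last two arguments. -/
def curvatureCoordL (Γ : F → F →L[ℝ] F →L[ℝ] F) (z u : F) : F →L[ℝ] F →L[ℝ] F :=
  fderiv ℝ Γ z u - (fderiv ℝ Γ z).flip u + ContinuousLinearMap.compL ℝ F F F (Γ z u) ∘L Γ z -
    (ContinuousLinearMap.compL ℝ F F F).flip (Γ z u) ∘L Γ z

lemma torsionCoordL_apply (Γ : F → F →L[ℝ] F →L[ℝ] F) (z u v : F) :
    torsionCoordL Γ z u v = torsionCoord Γ z u v := rfl

lemma curvatureCoordL_apply (Γ : F → F →L[ℝ] F →L[ℝ] F) (z u v w : F) :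
    curvatureCoordL Γ z u v w = curvatureCoord Γ z u v w := rfl

/-- The operator of the linear differential equation that the structure equations impose on the
pair of forms `Q⁻¹ dy` and `(Q⁻¹ ∇Q) ∘ L` along the ray in the direction `u`. -/
def structureOp (Γ : F → F →L[ℝ] F →L[ℝ] F) (z : F) (B : F →L[ℝ] F) (L : E →L[ℝ] F) (u : E) :
    F × (E →L[ℝ] F) →L[ℝ] F × (E →L[ℝ] F) :=
  .inl ℝ F (E →L[ℝ] F) ∘L ((ContinuousLinearMap.apply ℝ F u) ∘L .snd ℝ F (E →L[ℝ] F) +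
    Ring.inverse B ∘L torsionCoordL Γ z (B (L u)) ∘L B ∘L .fst ℝ F (E →L[ℝ] F)) +
  .inr ℝ F (E →L[ℝ] F) ∘L (ContinuousLinearMap.compL ℝ E F F (Ring.inverse B) ∘L
    (ContinuousLinearMap.compL ℝ E F F).flip (B ∘L L) ∘L curvatureCoordL Γ z (B (L u)) ∘L B ∘L
      .fst ℝ F (E →L[ℝ] F))

lemma structureOp_fst (Γ : F → F →L[ℝ] F →L[ℝ] F) (z : F) (B : F →L[ℝ] F) (L : E →L[ℝ] F) (u : E)
    (x : F × (E →L[ℝ] F)) :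
    (structureOp Γ z B L u x).1 =
      x.2 u + Ring.inverse B (torsionCoord Γ z (B (L u)) (B x.1)) := by
  simp [structureOp, torsionCoordL_apply]

lemma structureOp_snd (Γ : F → F →L[ℝ] F →L[ℝ] F) (z : F) (B : F →L[ℝ] F) (L : E →L[ℝ] F) (u : E)
    (x : F × (E →L[ℝ] F)) (k : E) :
    (structureOp Γ z B L u x).2 k =
      Ring.inverse B (curvatureCoord Γ z (B (L u)) (B x.1) (B (L k))) := by
  simp [structureOp, curvatureCoordL_apply]

lemma continuousAt_flip_apply {G : Type*} [NormedAddCommGroup G] [NormedSpace ℝ G]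
    {f : ℝ → F →L[ℝ] F →L[ℝ] G} {u : ℝ → F} {t : ℝ} (hf : ContinuousAt f t)
    (hu : ContinuousAt u t) : ContinuousAt (fun t ↦ (f t).flip (u t)) t :=
  ContinuousAt.clm_apply (f := fun t ↦ (f t).flip)
    (ContinuousAt.comp (g := fun f : F →L[ℝ] F →L[ℝ] G ↦ f.flip)
      (ContinuousLinearMap.flipₗᵢ ℝ F F G).continuous.continuousAt hf) hu

lemma continuousAt_compL_apply {G₁ G₂ G₃ : Type*} [NormedAddCommGroup G₁] [NormedSpace ℝ G₁]
    [NormedAddCommGroup G₂] [NormedSpace ℝ G₂] [NormedAddCommGroup G₃] [NormedSpace ℝ G₃]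
    {f : ℝ → G₂ →L[ℝ] G₃} {t : ℝ} (hf : ContinuousAt f t) :
    ContinuousAt (fun t ↦ ContinuousLinearMap.compL ℝ G₁ G₂ G₃ (f t)) t :=
  ContinuousAt.comp (g := ContinuousLinearMap.compL ℝ G₁ G₂ G₃)
    (ContinuousLinearMap.compL ℝ G₁ G₂ G₃).continuous.continuousAt hf

lemma continuousAt_compL_flip_apply {G₁ G₂ G₃ : Type*} [NormedAddCommGroup G₁] [NormedSpace ℝ G₁]
    [NormedAddCommGroup G₂] [NormedSpace ℝ G₂] [NormedAddCommGroup G₃] [NormedSpace ℝ G₃]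
    {f : ℝ → G₁ →L[ℝ] G₂} {t : ℝ} (hf : ContinuousAt f t) :
    ContinuousAt (fun t ↦ (ContinuousLinearMap.compL ℝ G₁ G₂ G₃).flip (f t)) t :=
  ContinuousAt.comp (g := (ContinuousLinearMap.compL ℝ G₁ G₂ G₃).flip)
    (ContinuousLinearMap.compL ℝ G₁ G₂ G₃).flip.continuous.continuousAt hf

lemma continuousAt_torsionCoordL {Γ : F → F →L[ℝ] F →L[ℝ] F} {z u : ℝ → F} {t : ℝ}
    (hΓ : ContDiffAt ℝ ∞ Γ (z t)) (hz : ContinuousAt z t) (hu : ContinuousAt u t) :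
    ContinuousAt (fun t ↦ torsionCoordL Γ (z t) (u t)) t := by
  have h1 : ContinuousAt (fun t ↦ Γ (z t)) t := ContinuousAt.comp (g := Γ) hΓ.continuousAt hz
  exact (h1.clm_apply hu).sub (continuousAt_flip_apply h1 hu)

lemma continuousAt_curvatureCoordL {Γ : F → F →L[ℝ] F →L[ℝ] F} {z u : ℝ → F} {t : ℝ}
    (hΓ : ContDiffAt ℝ ∞ Γ (z t)) (hz : ContinuousAt z t) (hu : ContinuousAt u t) :
    ContinuousAt (fun t ↦ curvatureCoordL Γ (z t) (u t)) t := by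
  have h1 : ContinuousAt (fun t ↦ Γ (z t)) t := ContinuousAt.comp (g := Γ) hΓ.continuousAt hz
  have h2 : ContinuousAt (fun t ↦ fderiv ℝ Γ (z t)) t :=
    ContinuousAt.comp (g := fderiv ℝ Γ) (hΓ.fderiv_right (m := ∞) (by simp)).continuousAt hz
  have h3 := h1.clm_apply hu
  exact (((h2.clm_apply hu).sub (continuousAt_flip_apply h2 hu)).add
    ((continuousAt_compL_apply h3).clm_comp h1)).sub
    ((continuousAt_compL_flip_apply h3).clm_comp h1)

lemma continuousAt_structureOp [CompleteSpace F] {Γ : F → F →L[ℝ] F →L[ℝ] F} {z : ℝ → F}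
    {B : ℝ → F →L[ℝ] F} {t : ℝ} (hΓ : ContDiffAt ℝ ∞ Γ (z t)) (hz : ContinuousAt z t)
    (hB : ContinuousAt B t) (hu : IsUnit (B t)) (L : E →L[ℝ] F) (u : E) :
    ContinuousAt (fun t ↦ structureOp Γ (z t) (B t) L u) t := by
  have h3 : ContinuousAt (fun t ↦ Ring.inverse (B t)) t := by
    obtain ⟨b, hb⟩ := hu
    exact ContinuousAt.comp (g := Ring.inverse)
      (by rw [← hb]; exact NormedRing.inverse_continuousAt b) hB
  have hBu : ContinuousAt (fun t ↦ B t (L u)) t := hB.clm_apply continuousAt_const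
  have hBL : ContinuousAt (fun t ↦ B t ∘L L) t := hB.clm_comp continuousAt_const
  have hBf : ContinuousAt (fun t ↦ B t ∘L ContinuousLinearMap.fst ℝ F (E →L[ℝ] F)) t :=
    hB.clm_comp continuousAt_const
  exact ContinuousAt.add (continuousAt_const.clm_comp (continuousAt_const.add
    (h3.clm_comp ((continuousAt_torsionCoordL hΓ hz hBu).clm_comp hBf))))
    (continuousAt_const.clm_comp ((continuousAt_compL_apply h3).clm_comp
      ((continuousAt_compL_flip_apply hBL).clm_comp
        ((continuousAt_curvatureCoordL hΓ hz hBu).clm_comp hBf))))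

end StructureOperator

/-! ### Comparison of two radial frames by uniqueness for the structure equations. -/

section Comparison

variable {E : Type*} [NormedAddCommGroup E] [NormedSpace ℝ E] [FiniteDimensional ℝ E]
  [CompleteSpace E]
  {M : Type*} [TopologicalSpace M] [T2Space M] [ChartedSpace E M] [IsManifold 𝓘(ℝ, E) ∞ M]
  {F : Type*} [NormedAddCommGroup F] [NormedSpace ℝ F] [FiniteDimensional ℝ F] [CompleteSpace F]
  {N : Type*} [TopologicalSpace N] [T2Space N] [ChartedSpace F N] [IsManifold 𝓘(ℝ, F) ∞ N]
  {covM : CovariantDerivative 𝓘(ℝ, E) E (TangentSpace 𝓘(ℝ, E) : M → Type _)}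
  [ContMDiffCovariantDerivative covM ∞]
  {covN : CovariantDerivative 𝓘(ℝ, F) F (TangentSpace 𝓘(ℝ, F) : N → Type _)}
  [ContMDiffCovariantDerivative covN ∞]

lemma torsionCoord_coordMap {p q : N} (h : q ∈ (chartAt F p).source) (u v : F) :
    torsionCoord (chr covN p) (extChartAt 𝓘(ℝ, F) p q) (coordMap p q u) (coordMap p q v) =
      coordMap p q (torsionCoord (chr covN q) (extChartAt 𝓘(ℝ, F) q q) u v) :=
  (coordMap_torsion (cov := covN) h u v).symm.trans (congrArg (coordMap p q) (torsion_eq q u v))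

lemma curvatureCoord_coordMap {p q : N} (h : q ∈ (chartAt F p).source) (u v w : F) :
    curvatureCoord (chr covN p) (extChartAt 𝓘(ℝ, F) p q) (coordMap p q u) (coordMap p q v)
        (coordMap p q w) =
      coordMap p q (curvatureCoord (chr covN q) (extChartAt 𝓘(ℝ, F) q q) u v w) :=
  (coordMap_curvature (cov := covN) h u v w).symm.trans
    (congrArg (coordMap p q) (curvature_eq q u v w))

/-- Torsion and curvature are tensors and the frame is invertible, so the operator does not see the
chart. Its continuity along a ray follows: written in the chart at the moving point, the continuity
is not visible. -/
lemma structureOp_coordMap {p q : N} (h : q ∈ (chartAt F p).source) {A : F →L[ℝ] F} (hA : IsUnit A)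
    (L : E →L[ℝ] F) (u : E) :
    structureOp (chr covN p) (extChartAt 𝓘(ℝ, F) p q) (coordMap p q ∘L A) L u =
      structureOp (chr covN q) (extChartAt 𝓘(ℝ, F) q q) A L u := by
  refine ContinuousLinearMap.ext fun x ↦ Prod.ext ?_ (ContinuousLinearMap.ext fun k ↦ ?_)
  · simp only [structureOp_fst, ContinuousLinearMap.comp_apply, torsionCoord_coordMap h,
      inverse_coordMap_comp h hA]
  · simp only [structureOp_snd, ContinuousLinearMap.comp_apply, curvatureCoord_coordMap h,
      inverse_coordMap_comp h hA]

variable {U : Set E} {σ : E →L[ℝ] F} {x : E → M} {P : E → E →L[ℝ] E} {y : E → N}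
  {Q : E → F →L[ℝ] F}

lemma IsRadialFrame.continuousAt_structureOp_ray (hQ : IsRadialFrame covN U σ y Q) (hU : IsOpen U)
    (L : E →L[ℝ] F) (u : E) {t : ℝ} (htu : t • u ∈ U) :
    ContinuousAt (fun t : ℝ ↦ structureOp (chr covN (y (t • u)))
      (extChartAt 𝓘(ℝ, F) (y (t • u)) (y (t • u))) (Q (t • u)) L u) t := by
  have hp := mem_chart_source F (y (t • u))
  have hs : ContinuousAt (fun τ : ℝ ↦ τ • u) t :=
    (continuous_id.smul continuous_const).continuousAt
  have h1 := continuousAt_structureOp (z := fun τ ↦ extChartAt 𝓘(ℝ, F) (y (t • u)) (y (τ • u)))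
    (B := fun τ ↦ coordMap (y (t • u)) (y (τ • u)) ∘L Q (τ • u)) (t := t)
    (contDiffAt_chr (cov := covN) hp)
    (ContinuousAt.comp (f := fun τ : ℝ ↦ τ • u) (hQ.contDiffAt_base _ htu _ hp).continuousAt hs)
    (ContinuousAt.comp (f := fun τ : ℝ ↦ τ • u) (hQ.contDiffAt_frame _ htu _ hp).continuousAt hs)
    (isUnit_coordMap_comp hp (hQ.isUnit _ htu)) L u
  refine h1.congr ?_
  filter_upwards [eventually_smul_mem (hQ.eventually_mem hU htu hp)] with τ hτ
  exact structureOp_coordMap hτ.2 (hQ.isUnit _ hτ.1) L u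

/-- Two radial frames whose torsion and curvature correspond under a linear map `σ` have
corresponding coframes and connection forms. -/
lemma IsRadialFrame.solder_eq_and_connForm_eq (hU : IsOpen U) (hstar : StarConvex ℝ 0 U)
    (hP : IsRadialFrame covM U (.id ℝ E) x P) (hQ : IsRadialFrame covN U σ y Q)
    (hT : ∀ v ∈ U, ∀ a b : E, σ (Ring.inverse (P v) (covM.torsion (x v) (P v a) (P v b))) =
      Ring.inverse (Q v) (covN.torsion (y v) (Q v (σ a)) (Q v (σ b))))
    (hR : ∀ v ∈ U, ∀ a b k : E,
      σ (Ring.inverse (P v) (covM.curvature (x v) (P v a) (P v b) (P v k))) =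
      Ring.inverse (Q v) (covN.curvature (y v) (Q v (σ a)) (Q v (σ b)) (Q v (σ k))))
    {u : E} (hu : u ∈ U) (w : E) :
    solder (y u) y Q u w = σ (solder (x u) x P u w) ∧
      connForm covN (y u) y Q u w ∘L σ = σ ∘L connForm covM (x u) x P u w := by
  have hmem : ∀ t ∈ Icc (0 : ℝ) 1, t • u ∈ U := fun t ht ↦ hstar.smul_mem hu ht.1 ht.2
  -- Since `σ` may fail to be invertible, the connection forms are compared as maps from `E` to `F`:
  -- composed with `σ` on the right for `N`, on the left for `M`.
  let X : ℝ → F × (E →L[ℝ] F) := fun t ↦ (solder (y (t • u)) y Q (t • u) (t • w),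
    connForm covN (y (t • u)) y Q (t • u) (t • w) ∘L σ)
  let Y : ℝ → F × (E →L[ℝ] F) := fun t ↦ (σ (solder (x (t • u)) x P (t • u) (t • w)),
    σ ∘L connForm covM (x (t • u)) x P (t • u) (t • w))
  have hA : ContinuousOn (fun t : ℝ ↦ structureOp (chr covN (y (t • u)))
      (extChartAt 𝓘(ℝ, F) (y (t • u)) (y (t • u))) (Q (t • u)) σ u) (Icc 0 1) := fun t ht ↦
    (hQ.continuousAt_structureOp_ray hU σ u (hmem t ht)).continuousWithinAt
  -- The inhomogeneous term `σ w` comes from the growth of the argument `t • w`.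
  have key := linear_ode_unique (y := X) (z := Y) (g := fun _ ↦ (σ w, 0)) hA ?_ ?_ ?_
  · have h1 := key (show (1 : ℝ) ∈ Icc 0 1 by simp)
    simp only [X, Y, one_smul, Prod.mk.injEq] at h1
    exact h1
  · intro t ht
    refine HasDerivAt.hasDerivWithinAt ?_
    obtain ⟨K, hK, hK'⟩ := hQ.hasDerivAt_connForm hU hstar hu w ht
    have h2 := (hQ.hasDerivAt_solder hU hstar hu w ht).prodMk
      (hK.clm_comp (hasDerivAt_const t σ))
    refine h2.congr_deriv (Prod.ext ?_ (ContinuousLinearMap.ext fun k ↦ ?_))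
    · rw [Prod.fst_add, structureOp_fst, ← torsion_eq]
      simp only [X, ContinuousLinearMap.comp_apply]
      abel
    · simp only [Prod.snd_add, add_zero, structureOp_snd, ← curvature_eq]
      simp [hK', X]
  · intro t ht
    refine HasDerivAt.hasDerivWithinAt ?_
    obtain ⟨K, hK, hK'⟩ := hP.hasDerivAt_connForm hU hstar hu w ht
    have h2 := (σ.hasFDerivAt.comp_hasDerivAt t
      (hP.hasDerivAt_solder hU hstar hu w ht)).prodMk ((hasDerivAt_const t σ).clm_comp hK)
    refine h2.congr_deriv (Prod.ext ?_ (ContinuousLinearMap.ext fun k ↦ ?_))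
    · rw [Prod.fst_add, structureOp_fst, ← torsion_eq]
      simp only [Y, ContinuousLinearMap.comp_apply, map_add]
      -- The correspondence of torsions turns the image under `σ` of the equation for `M` into the
      -- equation for `N`.
      rw [← hT _ (hmem t ht)]
      simp only [ContinuousLinearMap.id_apply]
      abel
    · simp only [Prod.snd_add, add_zero, structureOp_snd, ← curvature_eq]
      simp only [Y]
      rw [← hR _ (hmem t ht)]
      simp [hK']
  -- Both pairs vanish at `t = 0`, where the forms are evaluated on the zero vector.
  · have h0 : ∀ v : E, solder (y v) y Q v 0 = 0 ∧ connForm covN (y v) y Q v 0 = 0 ∧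
        solder (x v) x P v 0 = 0 ∧ connForm covM (x v) x P v 0 = 0 := fun v ↦ by
      simp [solder, connForm, frameForm, frameConn]
    simp [X, Y, h0]

end Comparison

/-! ### Geodesics with parallel frames as integral curves; uniqueness. -/

section Development

variable {F : Type*} [NormedAddCommGroup F] [NormedSpace ℝ F] [FiniteDimensional ℝ F]
  {N : Type*} [TopologicalSpace N] [ChartedSpace F N] [IsManifold 𝓘(ℝ, F) ∞ N]

/-- In the chart at `p`, the curve `γ` has velocity `v` at time `t`, and the frame `A` along `γ`
is parallel at time `t`. -/
def IsParallelFrameAt (cov : CovariantDerivative 𝓘(ℝ, F) F (TangentSpace 𝓘(ℝ, F) : N → Type _))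
    (γ : ℝ → N) (A : ℝ → F →L[ℝ] F) (v : F) (s : Set ℝ) (t : ℝ) (p : N) : Prop :=
  HasDerivWithinAt (fun τ ↦ extChartAt 𝓘(ℝ, F) p (γ τ)) (coordMap p (γ t) v) s t ∧
  HasDerivWithinAt (fun τ ↦ coordMap p (γ τ) ∘L A τ)
    (-((chr cov p (extChartAt 𝓘(ℝ, F) p (γ t)) (coordMap p (γ t) v)) ∘L
      (coordMap p (γ t) ∘L A t))) s t

/-- `A` is a parallel frame along `γ`, whose velocity is `v`. -/
def IsParallelFrameOn (cov : CovariantDerivative 𝓘(ℝ, F) F (TangentSpace 𝓘(ℝ, F) : N → Type _))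
    (γ : ℝ → N) (A : ℝ → F →L[ℝ] F) (v : ℝ → F) (s : Set ℝ) : Prop :=
  ∀ t ∈ s, ContinuousWithinAt γ s t ∧
    ∀ p, γ t ∈ (chartAt F p).source → IsParallelFrameAt cov γ A (v t) s t p

variable {cov : CovariantDerivative 𝓘(ℝ, F) F (TangentSpace 𝓘(ℝ, F) : N → Type _)}
  {γ : ℝ → N} {A : ℝ → F →L[ℝ] F} {s : Set ℝ} {t : ℝ}

lemma IsParallelFrameAt.change {v : F} {p p' : N} (h : IsParallelFrameAt cov γ A v s t p)
    (hc : ContinuousWithinAt γ s t) (hp : γ t ∈ (chartAt F p).source)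
    (hp' : γ t ∈ (chartAt F p').source) : IsParallelFrameAt cov γ A v s t p' := by
  have hC : ∀ k : F, coordMap p' (γ t) k =
      fderiv ℝ (coordChange p p') (extChartAt 𝓘(ℝ, F) p (γ t)) (coordMap p (γ t) k) := fun k ↦
    (DFunLike.congr_fun (fderiv_coordChange_comp_coordMap hp hp') k).symm
  constructor
  · have := (hasFDerivWithinAt_extChartAt_comp_change hc hp hp'
      h.1.hasFDerivWithinAt).hasDerivWithinAt
    simpa [hC] using this
  · obtain ⟨Y', hY', hY⟩ := hasFDerivWithinAt_coordMap_comp_change hc hp hp'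
      h.1.hasFDerivWithinAt h.2.hasFDerivWithinAt
    refine hY'.hasDerivWithinAt.congr_deriv (ContinuousLinearMap.ext fun k ↦ ?_)
    rw [hY]
    simp only [ContinuousLinearMap.toSpanSingleton_apply, one_smul, neg_apply,
      ContinuousLinearMap.comp_apply, hC, chr_coordChange cov hp hp', map_neg]
    abel

/-- The vector field on `F × End F × F` whose integral curves are the curves with constant velocity
with respect to a parallel frame. -/
def devField (Γ : F → F →L[ℝ] F →L[ℝ] F) (x : F × (F →L[ℝ] F) × F) : F × (F →L[ℝ] F) × F :=
  (x.2.1 x.2.2, -((Γ x.1 (x.2.1 x.2.2)) ∘L x.2.1), 0)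

lemma contDiffAt_devField {Γ : F → F →L[ℝ] F →L[ℝ] F} {x : F × (F →L[ℝ] F) × F}
    (hΓ : ContDiffAt ℝ ∞ Γ x.1) : ContDiffAt ℝ ∞ (devField Γ) x := by
  have h1 : ContDiffAt ℝ ∞ (fun x : F × (F →L[ℝ] F) × F ↦ x.2.1) x :=
    contDiffAt_fst.comp x contDiffAt_snd
  have h2 : ContDiffAt ℝ ∞ (fun x : F × (F →L[ℝ] F) × F ↦ x.2.2) x :=
    contDiffAt_snd.comp x contDiffAt_snd
  have h3 := h1.clm_apply h2
  have h4 : ContDiffAt ℝ ∞ (fun x : F × (F →L[ℝ] F) × F ↦ Γ x.1) x :=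
    ContDiffAt.comp (g := Γ) x hΓ contDiffAt_fst
  exact h3.prodMk (((h4.clm_apply h3).clm_comp h1).neg.prodMk contDiffAt_const)

/-- The curve `γ` with its parallel frame `A`, in the chart at `p`, together with a constant. -/
def devState (γ : ℝ → N) (A : ℝ → F →L[ℝ] F) (ℓ : F) (p : N) (t : ℝ) : F × (F →L[ℝ] F) × F :=
  (extChartAt 𝓘(ℝ, F) p (γ t), coordMap p (γ t) ∘L A t, ℓ)

lemma IsParallelFrameAt.hasDerivWithinAt_devState {ℓ : F} {p : N}
    (h : IsParallelFrameAt cov γ A (A t ℓ) s t p) :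
    HasDerivWithinAt (devState γ A ℓ p) (devField (chr cov p) (devState γ A ℓ p t)) s t :=
  h.1.prodMk (h.2.prodMk (hasDerivWithinAt_const t s ℓ))

/-- `A` is a parallel frame along `γ`, and the velocity of `γ` has the constant components `ℓ`. -/
def IsDevelopment (cov : CovariantDerivative 𝓘(ℝ, F) F (TangentSpace 𝓘(ℝ, F) : N → Type _))
    (γ : ℝ → N) (A : ℝ → F →L[ℝ] F) (ℓ : F) (s : Set ℝ) : Prop :=
  IsParallelFrameOn cov γ A (fun t ↦ A t ℓ) s

/-- The Hausdorff property shows that the curves agree at a limit point. The frames, read in the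
chart centred there, then have equal limits, and at the centre the chart acts as the identity. -/
lemma isClosed_setOf_eq_inter_Icc [T2Space N] {γ₁ γ₂ : ℝ → N} {A₁ A₂ : ℝ → F →L[ℝ] F} {ℓ₁ ℓ₂ : F}
    {a b : ℝ} (h₁ : IsDevelopment cov γ₁ A₁ ℓ₁ (Icc a b))
    (h₂ : IsDevelopment cov γ₂ A₂ ℓ₂ (Icc a b)) :
    IsClosed ({t | γ₁ t = γ₂ t ∧ A₁ t = A₂ t} ∩ Icc a b) := by
  set S := {t | γ₁ t = γ₂ t ∧ A₁ t = A₂ t} ∩ Icc a b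
  refine isClosed_of_closure_subset fun t ht ↦ ?_
  have htI : t ∈ Icc a b := closure_minimal inter_subset_right isClosed_Icc ht
  have : (𝓝[S] t).NeBot := mem_closure_iff_nhdsWithin_neBot.1 ht
  have hle : 𝓝[S] t ≤ 𝓝[Icc a b] t := nhdsWithin_mono t inter_subset_right
  have hγ : γ₁ t = γ₂ t := by
    refine tendsto_nhds_unique ((h₁ t htI).1.tendsto.mono_left hle)
      (((h₂ t htI).1.tendsto.mono_left hle).congr' ?_)
    filter_upwards [self_mem_nhdsWithin] with τ hτ using hτ.1.1.symm
  refine ⟨⟨hγ, ?_⟩, htI⟩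
  have hs := mem_chart_source F (γ₁ t)
  have e1 := ((h₁ t htI).2 (γ₁ t) hs).2.continuousWithinAt.tendsto.mono_left hle
  have e2 := ((h₂ t htI).2 (γ₁ t) (hγ ▸ hs)).2.continuousWithinAt.tendsto.mono_left hle
  have e3 := tendsto_nhds_unique e1 (e2.congr' (by
    filter_upwards [self_mem_nhdsWithin] with τ hτ
    rw [hτ.1.1, hτ.1.2]))
  rw [← hγ, coordMap_self] at e3
  exact e3

lemma IsParallelFrameOn.eventually_mem {v : ℝ → F} (h : IsParallelFrameOn cov γ A v s) (ht : t ∈ s)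
    {p : N} (hp : γ t ∈ (chartAt F p).source) :
    ∀ᶠ τ in 𝓝[s] t, τ ∈ s ∧ γ τ ∈ (chartAt F p).source :=
  Filter.Eventually.and self_mem_nhdsWithin
    ((h t ht).1.eventually_mem ((chartAt F p).open_source.mem_nhds hp))

lemma contDiffAt_chr_of_mem [T2Space N] [ContMDiffCovariantDerivative cov ∞] {p : N} {z : F}
    (h : z ∈ (extChartAt 𝓘(ℝ, F) p).target) : ContDiffAt ℝ ∞ (chr cov p) z :=
  (contDiffOn_chr p).contDiffAt (extChartAt_target_mem_nhds' h)

/-- A development is determined by its initial values. -/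
lemma IsDevelopment.eqOn [T2Space N] [ContMDiffCovariantDerivative cov ∞] {γ₁ γ₂ : ℝ → N}
    {A₁ A₂ : ℝ → F →L[ℝ] F} {ℓ : F} {a b : ℝ} (h₁ : IsDevelopment cov γ₁ A₁ ℓ (Icc a b))
    (h₂ : IsDevelopment cov γ₂ A₂ ℓ (Icc a b)) (hγ : γ₁ a = γ₂ a) (hA : A₁ a = A₂ a)
    (ht : t ∈ Icc a b) : γ₁ t = γ₂ t ∧ A₁ t = A₂ t := by
  -- A continuity argument: the set of agreement is closed, and local uniqueness in a chart extends
  -- it to the right.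
  refine IsClosed.Icc_subset_of_forall_mem_nhdsWithin (isClosed_setOf_eq_inter_Icc h₁ h₂)
    ⟨hγ, hA⟩ (fun t ht ↦ ?_) ht
  obtain ⟨⟨e1, e2⟩, htI⟩ := ht
  have hp := mem_chart_source F (γ₁ t)
  set p := γ₁ t with hpdef
  have hp2 : γ₂ t ∈ (chartAt F p).source := by rw [← e1]; exact hp
  have htc : t ∈ Icc a b := Ico_subset_Icc_self htI
  have hle : 𝓝[≥] t ≤ 𝓝[Icc a b] t := nhdsWithin_le_of_mem (Icc_mem_nhdsGE_of_mem htI)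
  have ev1 := (h₁.eventually_mem htc hp).filter_mono hle
  have ev2 := (h₂.eventually_mem htc hp2).filter_mono hle
  have key := ode_eventually_eq_right (X := devField (chr cov p)) (f := devState γ₁ A₁ ℓ p)
    (g := devState γ₂ A₂ ℓ p) htI
    ((contDiffAt_devField (contDiffAt_chr_of_mem (extChartAt_mem_target hp))).of_le (by norm_cast))
    (by filter_upwards [ev1] with τ hτ
        using ((h₁ τ hτ.1).2 p hτ.2).hasDerivWithinAt_devState)
    (by filter_upwards [ev2] with τ hτ
        using ((h₂ τ hτ.1).2 p hτ.2).hasDerivWithinAt_devState)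
    (by simp only [devState]; rw [← e1, e2])
  have key' : ∀ᶠ τ in 𝓝[>] t, _ := key.filter_mono (nhdsWithin_mono t Ioi_subset_Ici_self)
  filter_upwards [key', ev1.filter_mono (nhdsWithin_mono t Ioi_subset_Ici_self),
    ev2.filter_mono (nhdsWithin_mono t Ioi_subset_Ici_self)] with τ hτ h1 h2
  simp only [devState, Prod.mk.injEq] at hτ
  have hγτ : γ₁ τ = γ₂ τ := by
    rw [← extChartAt_symm_extChartAt h1.2, ← extChartAt_symm_extChartAt h2.2, hτ.1]
  refine ⟨hγτ, ContinuousLinearMap.ext fun k ↦ coordMap_injective h1.2 ?_⟩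
  have := DFunLike.congr_fun hτ.2.1 k
  rw [← hγτ] at this
  exact this

/-- The equation of a parallel frame is linear in the velocity, so slowing down time by `r` rescales
the velocity components and leaves the frame alone. -/
lemma IsParallelFrameAt.comp_affine {ℓ : F} {p : N} {a r τ : ℝ} {s' : Set ℝ}
    (h : IsParallelFrameAt cov γ A (A (a + r * τ) ℓ) s (a + r * τ) p)
    (hs : MapsTo (fun τ ↦ a + r * τ) s' s) :
    IsParallelFrameAt cov (fun τ ↦ γ (a + r * τ)) (fun τ ↦ A (a + r * τ)) (A (a + r * τ) (r • ℓ))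
      s' τ p := by
  have hd : HasDerivWithinAt (fun τ : ℝ ↦ a + r * τ) r s' τ := by
    simpa using ((hasDerivWithinAt_id τ s').const_mul r).const_add a
  constructor
  · refine (h.1.scomp τ hd hs).congr_deriv ?_
    rw [map_smul, map_smul]
  · refine (h.2.scomp τ hd hs).congr_deriv ?_
    rw [map_smul, map_smul, map_smul, ContinuousLinearMap.smul_comp, smul_neg]

lemma IsDevelopment.comp_affine {ℓ : F} (h : IsDevelopment cov γ A ℓ (Icc 0 1)) {a r : ℝ}
    (ha : 0 ≤ a) (hr : 0 ≤ r) (har : a + r ≤ 1) :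
    IsDevelopment cov (fun τ ↦ γ (a + r * τ)) (fun τ ↦ A (a + r * τ)) (r • ℓ) (Icc 0 1) := by
  have hs : MapsTo (fun τ ↦ a + r * τ) (Icc (0 : ℝ) 1) (Icc 0 1) := fun τ hτ ↦
    ⟨by have := mul_nonneg hr hτ.1; linarith, by have := mul_le_mul_of_nonneg_left hτ.2 hr; linarith⟩
  intro τ hτ
  refine ⟨ContinuousWithinAt.comp (h _ (hs hτ)).1 (by fun_prop) hs, fun p hp ↦ ?_⟩
  exact ((h _ (hs hτ)).2 p hp).comp_affine hs

/-- An integral curve of `devField` in a chart is a development. -/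
lemma isDevelopment_of_devField {p : N} {Ψ : ℝ → F × (F →L[ℝ] F) × F} {r : ℝ}
    (hΨ : ∀ τ ∈ Icc (0 : ℝ) 1, (Ψ τ).1 ∈ (extChartAt 𝓘(ℝ, F) p).target ∧
      HasDerivWithinAt Ψ (r • devField (chr cov p) (Ψ τ)) (Icc 0 1) τ) :
    IsDevelopment cov (fun τ ↦ (extChartAt 𝓘(ℝ, F) p).symm (Ψ τ).1)
      (fun τ ↦ coordInv p ((extChartAt 𝓘(ℝ, F) p).symm (Ψ τ).1) ∘L (Ψ τ).2.1) (r • (Ψ 0).2.2)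
      (Icc 0 1) := by
  -- The last component of the field is zero, so the components of the velocity are a constant
  -- parameter.
  have hconst : ∀ τ ∈ Icc (0 : ℝ) 1, (Ψ τ).2.2 = (Ψ 0).2.2 := by
    have h1 : ∀ τ ∈ Icc (0 : ℝ) 1, HasDerivWithinAt (fun τ ↦ (Ψ τ).2.2) 0 (Icc 0 1) τ := by
      intro τ hτ
      have h2 := (hasFDerivAt_snd (𝕜 := ℝ) (p := (Ψ τ).2)).comp_hasDerivWithinAt τ
        ((hasFDerivAt_snd (𝕜 := ℝ) (p := Ψ τ)).comp_hasDerivWithinAt τ (hΨ τ hτ).2)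
      refine h2.congr_deriv ?_
      simp [devField]
    exact linear_ode_unique (A := fun _ ↦ 0) (g := fun _ ↦ 0) (z := fun _ ↦ (Ψ 0).2.2)
      continuousOn_const (by simpa using h1)
      (fun τ _ ↦ by simpa using hasDerivWithinAt_const τ _ _) rfl
  intro τ hτ
  have hsrc := fun τ hτ ↦ extChartAt_symm_mem_source (hΨ τ hτ).1
  have e1 : ∀ τ ∈ Icc (0 : ℝ) 1,
      extChartAt 𝓘(ℝ, F) p ((extChartAt 𝓘(ℝ, F) p).symm (Ψ τ).1) = (Ψ τ).1 := fun τ hτ ↦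
    (extChartAt 𝓘(ℝ, F) p).right_inv (hΨ τ hτ).1
  have e2 : ∀ τ ∈ Icc (0 : ℝ) 1, coordMap p ((extChartAt 𝓘(ℝ, F) p).symm (Ψ τ).1) ∘L
      (coordInv p ((extChartAt 𝓘(ℝ, F) p).symm (Ψ τ).1) ∘L (Ψ τ).2.1) = (Ψ τ).2.1 := fun τ hτ ↦ by
    rw [← ContinuousLinearMap.comp_assoc, coordMap_comp_coordInv (hsrc τ hτ),
      ContinuousLinearMap.id_comp]
  have hd1 : HasDerivWithinAt (fun τ ↦ (Ψ τ).1) _ (Icc 0 1) τ :=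
    (hasFDerivAt_fst (𝕜 := ℝ) (p := Ψ τ)).comp_hasDerivWithinAt τ (hΨ τ hτ).2
  have hd2 : HasDerivWithinAt (fun τ ↦ (Ψ τ).2.1) _ (Icc 0 1) τ :=
    (hasFDerivAt_fst (𝕜 := ℝ) (p := (Ψ τ).2)).comp_hasDerivWithinAt τ
      ((hasFDerivAt_snd (𝕜 := ℝ) (p := Ψ τ)).comp_hasDerivWithinAt τ (hΨ τ hτ).2)
  have hcont : ContinuousWithinAt (fun τ ↦ (extChartAt 𝓘(ℝ, F) p).symm (Ψ τ).1) (Icc 0 1) τ :=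
    ContinuousAt.comp_continuousWithinAt (f := fun τ ↦ (Ψ τ).1)
      (contMDiffAt_extChartAt_symm (hΨ τ hτ).1).continuousAt hd1.continuousWithinAt
  refine ⟨hcont, fun p' hp' ↦ IsParallelFrameAt.change (p := p) ?_ hcont (hsrc τ hτ) hp'⟩
  have e3 : coordMap p ((extChartAt 𝓘(ℝ, F) p).symm (Ψ τ).1)
      ((coordInv p ((extChartAt 𝓘(ℝ, F) p).symm (Ψ τ).1) ∘L (Ψ τ).2.1) (r • (Ψ 0).2.2)) =
      r • (Ψ τ).2.1 (Ψ τ).2.2 := by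
    rw [← ContinuousLinearMap.comp_apply, e2 τ hτ, map_smul, hconst τ hτ]
  constructor
  · refine (hd1.congr_deriv ?_).congr e1 (e1 τ hτ)
    rw [e3]; simp [devField]
  · refine (hd2.congr_deriv ?_).congr e2 (e2 τ hτ)
    rw [e3, e2 τ hτ, e1 τ hτ]; simp [devField]

end Development

/-! ### Invertible solutions of linear equations for frames. -/

section LinearEquation

variable {F : Type*} [NormedAddCommGroup F] [NormedSpace ℝ F]

lemma isUnit_of_comp_eq_id [FiniteDimensional ℝ F] {A B : F →L[ℝ] F} (h : B ∘L A = .id ℝ F) :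
    IsUnit A := by
  have : CompleteSpace F := FiniteDimensional.complete ℝ F
  rw [ContinuousLinearMap.isUnit_iff_bijective]
  have hinj : Function.Injective A :=
    Function.LeftInverse.injective (g := B) fun x ↦ DFunLike.congr_fun h x
  exact ⟨hinj, (LinearMap.injective_iff_surjective (f := (A : F →ₗ[ℝ] F))).1 hinj⟩

lemma norm_compL_apply_le (M : F →L[ℝ] F) : ‖ContinuousLinearMap.compL ℝ F F F M‖ ≤ ‖M‖ :=
  ContinuousLinearMap.opNorm_le_bound _ (norm_nonneg _) fun X ↦ M.opNorm_comp_le X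

lemma norm_neg_compL_flip_apply_le (M : F →L[ℝ] F) :
    ‖-(ContinuousLinearMap.compL ℝ F F F).flip M‖ ≤ ‖M‖ := by
  rw [norm_neg]
  refine ContinuousLinearMap.opNorm_le_bound _ (norm_nonneg _) fun X ↦ ?_
  rw [mul_comm]
  exact X.opNorm_comp_le M

/-- A linear equation for frames has invertible solutions on short intervals. -/
lemma exists_isUnit_linear_ode_solution [FiniteDimensional ℝ F] {M : ℝ → F →L[ℝ] F} {a b : ℝ}
    (hab : a ≤ b) (hM : ContinuousOn M (Icc a b)) {K : NNReal} (hK : ∀ t ∈ Icc a b, ‖M t‖ ≤ K)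
    (hKab : K * (b - a) ≤ 1 / 2) {A₀ : F →L[ℝ] F} (hA₀ : IsUnit A₀) :
    ∃ A : ℝ → F →L[ℝ] F, A a = A₀ ∧ ∀ t ∈ Icc a b, IsUnit (A t) ∧
      HasDerivWithinAt A (M t ∘L A t) (Icc a b) t := by
  have : CompleteSpace F := FiniteDimensional.complete ℝ F
  obtain ⟨A, hA, hA'⟩ := exists_linear_ode_solution hab
    (A := fun t ↦ ContinuousLinearMap.compL ℝ F F F (M t))
    ((ContinuousLinearMap.compL ℝ F F F).continuous.comp_continuousOn hM)
    (fun t ht ↦ (norm_compL_apply_le _).trans (hK t ht)) hKab A₀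
  -- `Z` solves the dual equation `Z' = -Z M`, hence `Z A` is constant and equal to the identity. In
  -- finite dimension a left inverse suffices for invertibility.
  obtain ⟨Z, hZ, hZ'⟩ := exists_linear_ode_solution hab
    (A := fun t ↦ -(ContinuousLinearMap.compL ℝ F F F).flip (M t))
    ((ContinuousLinearMap.compL ℝ F F F).flip.continuous.comp_continuousOn hM).neg
    (fun t ht ↦ (norm_neg_compL_flip_apply_le _).trans (hK t ht)) hKab (Ring.inverse A₀)
  have hid : EqOn (fun t ↦ Z t ∘L A t) (fun _ ↦ .id ℝ F) (Icc a b) := by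
    refine linear_ode_unique (A := fun _ ↦ 0) (g := fun _ ↦ 0) continuousOn_const
      (fun t ht ↦ ?_) (fun t _ ↦ ?_) ?_
    · refine ((hZ' t ht).clm_comp (hA' t ht)).congr_deriv ?_
      ext x
      simp
    · refine (hasDerivWithinAt_const t _ _).congr_deriv ?_
      simp
    · rw [hA, hZ]
      exact Ring.inverse_mul_cancel _ hA₀
  exact ⟨A, hA, fun t ht ↦ ⟨isUnit_of_comp_eq_id (hid ht), hA' t ht⟩⟩

/-- At the junction the two one-sided derivatives combine; at other times one of the two intervals
does not have `t` in its closure, and the condition within it is vacuous. -/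
lemma hasDerivWithinAt_Icc_glue {G : Type*} [NormedAddCommGroup G] [NormedSpace ℝ G] {f : ℝ → G}
    {f' : G} {a b c t : ℝ} (hab : a ≤ b) (hbc : b ≤ c)
    (h1 : t ∈ Icc a b → HasDerivWithinAt f f' (Icc a b) t)
    (h2 : t ∈ Icc b c → HasDerivWithinAt f f' (Icc b c) t) :
    HasDerivWithinAt f f' (Icc a c) t := by
  have key : ∀ {d e : ℝ}, (t ∈ Icc d e → HasDerivWithinAt f f' (Icc d e) t) →
      HasDerivWithinAt f f' (Icc d e) t := fun {d e} h ↦ by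
    by_cases ht : t ∈ Icc d e
    · exact h ht
    · exact HasFDerivWithinAt.of_notMem_closure (by rwa [isClosed_Icc.closure_eq])
  rw [← Icc_union_Icc_eq_Icc hab hbc]
  exact (key h1).union (key h2)

end LinearEquation

/-! ### Parallel frames along curves; geodesics as developments. -/

section ParallelFrame

variable {F : Type*} [NormedAddCommGroup F] [NormedSpace ℝ F] [FiniteDimensional ℝ F]
  {N : Type*} [TopologicalSpace N] [ChartedSpace F N] [IsManifold 𝓘(ℝ, F) ∞ N]
  {cov : CovariantDerivative 𝓘(ℝ, F) F (TangentSpace 𝓘(ℝ, F) : N → Type _)}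
  {γ : ℝ → N}

lemma contMDiff_unitField : ContMDiff 𝓘(ℝ, ℝ) 𝓘(ℝ, ℝ).tangent ∞
    (fun t : ℝ ↦ (⟨t, (1 : ℝ)⟩ : TangentBundle 𝓘(ℝ, ℝ) ℝ)) := by
  intro t
  rw [Bundle.contMDiffAt_totalSpace]
  refine ⟨contMDiffAt_id, contMDiffAt_const (c := (1 : ℝ)) |>.congr_of_eventuallyEq ?_⟩
  refine Eventually.of_forall fun τ ↦ ?_
  simp

lemma uniqueMDiffOn_Icc_zero_one : UniqueMDiffOn 𝓘(ℝ, ℝ) (Icc (0 : ℝ) 1) :=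
  (uniqueDiffOn_Icc zero_lt_one).uniqueMDiffOn

lemma contMDiffOn_velocity (hγ : ContMDiffOn 𝓘(ℝ, ℝ) 𝓘(ℝ, F) ∞ γ (Icc 0 1)) :
    ContMDiffOn 𝓘(ℝ, ℝ) 𝓘(ℝ, F).tangent ∞ (velocity 𝓘(ℝ, F) γ (Icc 0 1)) (Icc 0 1) :=
  (hγ.contMDiffOn_tangentMapWithin (m := ∞) (by simp) uniqueMDiffOn_Icc_zero_one).comp
    contMDiff_unitField.contMDiffOn fun _ ht ↦ ht

/-- The velocity of a curve on `[0, 1]` as a vector in the model space. -/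
def speed (γ : ℝ → N) (t : ℝ) : F := (velocity 𝓘(ℝ, F) γ (Icc 0 1) t).2

lemma hasDerivWithinAt_extChartAt_speed (hγ : ContMDiffOn 𝓘(ℝ, ℝ) 𝓘(ℝ, F) ∞ γ (Icc 0 1)) {t : ℝ}
    (ht : t ∈ Icc (0 : ℝ) 1) {p : N} (hp : γ t ∈ (chartAt F p).source) :
    HasDerivWithinAt (fun τ ↦ extChartAt 𝓘(ℝ, F) p (γ τ)) (coordMap p (γ t) (speed γ t))
      (Icc 0 1) t :=
  (hasFDerivWithinAt_extChartAt_comp hp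
    ((hγ t ht).mdifferentiableWithinAt (by simp)).hasMFDerivWithinAt).hasDerivWithinAt

lemma differentiableWithinAt_coordMap_snd {ξ : ℝ → TangentBundle 𝓘(ℝ, F) N}
    (hξ : ContMDiffOn 𝓘(ℝ, ℝ) 𝓘(ℝ, F).tangent ∞ ξ (Icc 0 1)) {t : ℝ} (ht : t ∈ Icc (0 : ℝ) 1)
    {p : N} (hp : (ξ t).proj ∈ (chartAt F p).source) :
    DifferentiableWithinAt ℝ (fun τ ↦ coordMap (F := F) p (ξ τ).proj (ξ τ).2) (Icc 0 1) t := by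
  have h1 := (((trivializationAt F (TangentSpace 𝓘(ℝ, F)) p).contMDiffWithinAt_iff
    ((trivializationAt F (TangentSpace 𝓘(ℝ, F)) p).mem_source.2 hp)).1 (hξ t ht)).2
  exact mdifferentiableWithinAt_iff_differentiableWithinAt.1 (h1.mdifferentiableWithinAt (by simp))

variable [T2Space N] [ContMDiffCovariantDerivative cov ∞]

lemma continuousWithinAt_chr_speed (hγ : ContMDiffOn 𝓘(ℝ, ℝ) 𝓘(ℝ, F) ∞ γ (Icc 0 1)) {t : ℝ}
    (ht : t ∈ Icc (0 : ℝ) 1) {p : N} (hp : γ t ∈ (chartAt F p).source) :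
    ContinuousWithinAt (fun t ↦ -(chr cov p (extChartAt 𝓘(ℝ, F) p (γ t))
      (coordMap p (γ t) (speed γ t)))) (Icc 0 1) t := by
  have h1 := (differentiableWithinAt_coordMap_snd (contMDiffOn_velocity hγ) ht
    (p := p) hp).continuousWithinAt
  have h2 := (hasDerivWithinAt_extChartAt_speed hγ ht hp).continuousWithinAt
  have h3 : ContinuousWithinAt (fun t ↦ chr cov p (extChartAt 𝓘(ℝ, F) p (γ t))) (Icc 0 1) t :=
    ContinuousAt.comp_continuousWithinAt (f := fun t ↦ extChartAt 𝓘(ℝ, F) p (γ t))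
      (contDiffAt_chr hp).continuousAt h2
  exact (h3.clm_apply h1).neg

/-- Parallel frames along a smooth curve exist. -/
lemma exists_isParallelFrameOn (hγ : ContMDiffOn 𝓘(ℝ, ℝ) 𝓘(ℝ, F) ∞ γ (Icc 0 1)) :
    ∃ A : ℝ → F →L[ℝ] F, A 0 = .id ℝ F ∧ IsParallelFrameOn cov γ A (speed γ) (Icc 0 1) ∧
      ∀ t ∈ Icc (0 : ℝ) 1, IsUnit (A t) := by
  let Par : (ℝ → F →L[ℝ] F) → ℝ → ℝ → Prop := fun A a b ↦ ∀ t ∈ Icc a b, IsUnit (A t) ∧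
    ∀ p, γ t ∈ (chartAt F p).source → IsParallelFrameAt cov γ A (speed γ t) (Icc a b) t p
  have main : ∀ A₀ : F →L[ℝ] F, IsUnit A₀ → ∃ A, A 0 = A₀ ∧ Par A 0 1 := by
    -- Solvability from every invertible initial frame is the transitive form of the assertion: the
    -- second solution starts at the end of the first, which is invertible.
    refine Icc_chain (t := 1) (P := fun a b ↦ ∀ A₀ : F →L[ℝ] F, IsUnit A₀ → ∃ A, A a = A₀ ∧ Par A a b)
      (fun τ hτ ↦ ?_) (fun a b c ha hab hbc hc h1 h2 A₀ hA₀ ↦ ?_) (by simp)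
    · set p := γ τ with hpdef
      have hp := mem_chart_source F p
      have hM := continuousWithinAt_chr_speed (cov := cov) hγ hτ (p := p) hp
      set M := fun t ↦ -(chr cov p (extChartAt 𝓘(ℝ, F) p (γ t)) (coordMap p (γ t) (speed γ t)))
        with hMdef
      have hev : ∀ᶠ t in 𝓝[Icc 0 1] τ, ‖M t‖ < ‖M τ‖ + 1 ∧ γ t ∈ (chartAt F p).source :=
        Filter.Eventually.and (hM.norm.eventually_lt_const (by simp))
          ((hγ τ hτ).continuousWithinAt.eventually_mem ((chartAt F p).open_source.mem_nhds hp))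
      obtain ⟨ε, hε, hball⟩ := Metric.mem_nhdsWithin_iff.1 hev
      -- Points this close to `τ` are at most `1 / (2 (‖M τ‖ + 1))` apart, as the short-interval
      -- existence lemma requires when the coefficient is bounded by `‖M τ‖ + 1`.
      refine ⟨min ε (1 / (4 * (‖M τ‖ + 1))), by positivity, fun a b ha hab hb haτ hbτ A₀ hA₀ ↦ ?_⟩
      have hin : ∀ t ∈ Icc a b, t ∈ Icc (0 : ℝ) 1 ∧ ‖M t‖ < ‖M τ‖ + 1 ∧
          γ t ∈ (chartAt F p).source := fun t ht ↦ by
        have h01 : t ∈ Icc (0 : ℝ) 1 := ⟨ha.trans ht.1, ht.2.trans hb⟩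
        refine ⟨h01, hball ⟨?_, h01⟩⟩
        rw [Metric.mem_ball, Real.dist_eq]
        have h1 := abs_lt.1 (haτ.trans_le (min_le_left _ _))
        have h2 := abs_lt.1 (hbτ.trans_le (min_le_left _ _))
        exact abs_lt.2 ⟨by linarith [ht.1], by linarith [ht.2]⟩
      have hsub : Icc a b ⊆ Icc 0 1 := fun t ht ↦ (hin t ht).1
      have hpos : 0 < ‖M τ‖ + 1 := by positivity
      have hlen : (‖M τ‖ + 1) * (b - a) ≤ 1 / 2 := by
        have h1 := abs_lt.1 (haτ.trans_le (min_le_right _ _))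
        have h2 := abs_lt.1 (hbτ.trans_le (min_le_right _ _))
        have h3 : b - a ≤ 2 * (1 / (4 * (‖M τ‖ + 1))) := by linarith
        calc (‖M τ‖ + 1) * (b - a) ≤ (‖M τ‖ + 1) * (2 * (1 / (4 * (‖M τ‖ + 1)))) := by gcongr
          _ = 1 / 2 := by field_simp; norm_num
      obtain ⟨A, hA, hA'⟩ := exists_isUnit_linear_ode_solution hab (M := M)
        (K := ⟨‖M τ‖ + 1, hpos.le⟩)
        (fun t ht ↦ (continuousWithinAt_chr_speed (cov := cov) hγ (hin t ht).1
          (hin t ht).2.2).mono hsub) (fun t ht ↦ (hin t ht).2.1.le) hlen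
        (isUnit_coordMap_comp (hin a (left_mem_Icc.2 hab)).2.2 hA₀)
      have hunit : ∀ t ∈ Icc a b, IsUnit (coordInv (F := F) p (γ t)) := fun t ht ↦
        ⟨⟨coordInv p (γ t), coordMap p (γ t), coordInv_comp_coordMap (hin t ht).2.2,
          coordMap_comp_coordInv (hin t ht).2.2⟩, rfl⟩
      have hback : ∀ t ∈ Icc a b, coordMap p (γ t) ∘L (coordInv p (γ t) ∘L A t) = A t :=
        fun t ht ↦ by
          rw [← ContinuousLinearMap.comp_assoc, coordMap_comp_coordInv (hin t ht).2.2,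
            ContinuousLinearMap.id_comp]
      refine ⟨fun t ↦ coordInv p (γ t) ∘L A t, ?_, fun t ht ↦
        ⟨(hunit t ht).mul (hA' t ht).1, fun p' hp' ↦ ?_⟩⟩
      · change coordInv p (γ a) ∘L A a = A₀
        rw [hA, ← ContinuousLinearMap.comp_assoc,
          coordInv_comp_coordMap (hin a (left_mem_Icc.2 hab)).2.2, ContinuousLinearMap.id_comp]
      · refine IsParallelFrameAt.change (p := p) ⟨?_, ?_⟩
          ((hγ t (hsub ht)).continuousWithinAt.mono hsub) (hin t ht).2.2 hp'
        · exact (hasDerivWithinAt_extChartAt_speed hγ (hsub ht) (hin t ht).2.2).mono hsub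
        · refine ((hA' t ht).2.congr_deriv ?_).congr hback (hback t ht)
          rw [hback t ht, ← ContinuousLinearMap.neg_comp]
    · obtain ⟨A₁, e₁, hA₁⟩ := h1 A₀ hA₀
      obtain ⟨A₂, e₂, hA₂⟩ := h2 (A₁ b) (hA₁ b (right_mem_Icc.2 hab)).1
      let A : ℝ → F →L[ℝ] F := fun t ↦ if t ≤ b then A₁ t else A₂ t
      have E₁ : ∀ t ∈ Icc a b, A t = A₁ t := fun t ht ↦ if_pos ht.2
      have E₂ : ∀ t ∈ Icc b c, A t = A₂ t := fun t ht ↦ by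
        rcases ht.1.eq_or_lt with rfl | h
        · rw [e₂]; exact if_pos le_rfl
        · exact if_neg h.not_ge
      refine ⟨A, (E₁ a (left_mem_Icc.2 hab)).trans e₁, fun t ht ↦ ⟨?_, fun p hp ↦ ⟨?_, ?_⟩⟩⟩
      · rcases le_total t b with h | h
        · rw [E₁ t ⟨ht.1, h⟩]; exact (hA₁ t ⟨ht.1, h⟩).1
        · rw [E₂ t ⟨h, ht.2⟩]; exact (hA₂ t ⟨h, ht.2⟩).1
      · exact (hasDerivWithinAt_extChartAt_speed hγ (p := p) ⟨ha.trans ht.1, ht.2.trans hc⟩ hp).mono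
          (Icc_subset_Icc ha hc)
      · refine hasDerivWithinAt_Icc_glue hab hbc (fun ht' ↦ ?_) (fun ht' ↦ ?_)
        · refine HasDerivWithinAt.congr (f := fun τ ↦ coordMap p (γ τ) ∘L A₁ τ) ?_
            (fun τ hτ ↦ by rw [E₁ τ hτ]) (by rw [E₁ t ht'])
          rw [E₁ t ht']
          exact ((hA₁ t ht').2 p hp).2
        · refine HasDerivWithinAt.congr (f := fun τ ↦ coordMap p (γ τ) ∘L A₂ τ) ?_
            (fun τ hτ ↦ by rw [E₂ τ hτ]) (by rw [E₂ t ht'])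
          rw [E₂ t ht']
          exact ((hA₂ t ht').2 p hp).2
  obtain ⟨A, h0, hA⟩ := main (.id ℝ F) isUnit_one
  exact ⟨A, h0, fun t ht ↦ ⟨(hγ t ht).continuousWithinAt, (hA t ht).2⟩, fun t ht ↦ (hA t ht).1⟩

/-- A vector field along a curve that satisfies the equation of parallel transport has constant
components with respect to a parallel frame. -/
lemma IsParallelFrameOn.eq_apply {A : ℝ → F →L[ℝ] F} {v : ℝ → F}
    (hA : IsParallelFrameOn cov γ A v (Icc 0 1)) (hu : ∀ t ∈ Icc (0 : ℝ) 1, IsUnit (A t))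
    {X : ℝ → F} (hX : ∀ t ∈ Icc (0 : ℝ) 1, HasDerivWithinAt (fun τ ↦ coordMap (γ t) (γ τ) (X τ))
      (-(chr cov (γ t) (extChartAt 𝓘(ℝ, F) (γ t) (γ t)) (v t) (X t))) (Icc 0 1) t)
    {t : ℝ} (ht : t ∈ Icc (0 : ℝ) 1) : X t = A t (Ring.inverse (A 0) (X 0)) := by
  have : CompleteSpace F := FiniteDimensional.complete ℝ F
  have hconst : EqOn (fun t ↦ Ring.inverse (A t) (X t)) (fun _ ↦ Ring.inverse (A 0) (X 0))
      (Icc 0 1) := by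
    refine linear_ode_unique (A := fun _ ↦ 0) (g := fun _ ↦ 0) continuousOn_const
      (fun t ht ↦ ?_) (fun t _ ↦ (hasDerivWithinAt_const t _ _).congr_deriv (by simp)) rfl
    have hp := mem_chart_source F (γ t)
    have h1 := hasDerivWithinAt_inverse_apply ((hA t ht).2 (γ t) hp).2
      (isUnit_coordMap_comp hp (hu t ht)) (hX t ht)
    refine (h1.congr_deriv ?_).congr_of_eventuallyEq ?_ ?_
    -- The field and the frame satisfy the same linear equation, so the derivative of the components
    -- is zero.
    · simp [apply_inverse_apply (hu t ht)]
    · filter_upwards [hA.eventually_mem ht hp] with τ hτ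
      exact (inverse_coordMap_comp hτ.2 (hu τ hτ.1) _).symm
    · exact (inverse_coordMap_comp hp (hu t ht) _).symm
  have := hconst ht
  simp only at this
  rw [← this, apply_inverse_apply (hu t ht)]

lemma IsParallelOn.hasDerivWithinAt {ξ : ℝ → TangentBundle 𝓘(ℝ, F) N}
    (hξ : cov.IsParallelOn ξ (Icc 0 1)) {t : ℝ} (ht : t ∈ Icc (0 : ℝ) 1) :
    HasDerivWithinAt (fun τ ↦ coordMap (F := F) (ξ t).proj (ξ τ).proj (ξ τ).2)
      (-(chr cov (ξ t).proj (extChartAt 𝓘(ℝ, F) (ξ t).proj (ξ t).proj)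
        (speed (fun t ↦ (ξ t).proj) t) (ξ t).2)) (Icc 0 1) t := by
  have hγ : ContMDiffOn 𝓘(ℝ, ℝ) 𝓘(ℝ, F) ∞ (fun t ↦ (ξ t).proj) (Icc 0 1) := fun t ht ↦
    (Bundle.contMDiffWithinAt_totalSpace.1 (hξ.1 t ht)).1
  have hd := (differentiableWithinAt_coordMap_snd hξ.1 ht
    (mem_chart_source F (ξ t).proj)).hasDerivWithinAt
  have h1 := covAlong_eq cov ξ (Icc 0 1) t (uniqueMDiffOn_Icc_zero_one t ht)
    ((hγ t ht).mdifferentiableWithinAt (by simp)).hasMFDerivWithinAt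
    hd.hasFDerivWithinAt.hasMFDerivWithinAt (1 : ℝ)
  have h2 := (hξ.2 t ht).symm.trans h1
  refine hd.congr_deriv ?_
  rw [ContinuousLinearMap.toSpanSingleton_apply, one_smul] at h2
  exact eq_neg_of_add_eq_zero_left h2.symm

/-- A geodesic is a development. -/
lemma IsGeodesicOn.exists_isDevelopment (hγ : cov.IsGeodesicOn γ (Icc 0 1)) :
    ∃ A : ℝ → F →L[ℝ] F, A 0 = .id ℝ F ∧ IsDevelopment cov γ A (speed γ 0) (Icc 0 1) ∧
      ∀ t ∈ Icc (0 : ℝ) 1, IsUnit (A t) := by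
  obtain ⟨A, h0, hA, hu⟩ := exists_isParallelFrameOn (cov := cov) hγ.1
  refine ⟨A, h0, fun t ht ↦ ?_, hu⟩
  -- The velocity of a geodesic is itself parallel, hence has constant components in the parallel
  -- frame.
  have h1 := hA.eq_apply hu (X := speed γ) (fun t ht ↦
    IsParallelOn.hasDerivWithinAt (cov := cov) ⟨contMDiffOn_velocity hγ.1, hγ.2⟩ ht) ht
  have h2 : Ring.inverse (A 0) (speed γ 0) = speed γ 0 := by
    rw [h0]
    exact DFunLike.congr_fun (Ring.inverse_one (F →L[ℝ] F)) _
  rw [h2] at h1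
  simp only [← h1]
  exact hA t ht

end ParallelFrame

/-! ### Smooth dependence of geodesics and parallel frames on the initial velocity. -/

section SmoothDependence

variable {E : Type*} [NormedAddCommGroup E] [NormedSpace ℝ E]
  {F : Type*} [NormedAddCommGroup F] [NormedSpace ℝ F] [FiniteDimensional ℝ F]
  {N : Type*} [TopologicalSpace N] [ChartedSpace F N] [IsManifold 𝓘(ℝ, F) ∞ N]
  {cov : CovariantDerivative 𝓘(ℝ, F) F (TangentSpace 𝓘(ℝ, F) : N → Type _)}

/-- A map `y` to `N` and a frame `Q` along it are smooth at `u`. -/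
structure IsSmoothFrameAt (y : E → N) (Q : E → F →L[ℝ] F) (u : E) : Prop where
  continuousAt : ContinuousAt y u
  contDiffAt_base : ∀ p, y u ∈ (chartAt F p).source →
    ContDiffAt ℝ ∞ (fun v ↦ extChartAt 𝓘(ℝ, F) p (y v)) u
  contDiffAt_frame : ∀ p, y u ∈ (chartAt F p).source →
    ContDiffAt ℝ ∞ (fun v ↦ coordMap p (y v) ∘L Q v) u

/-- Chart values are meaningless off the chart domain, so smooth coordinates alone do not give
continuity of `y`; the eventual membership in the domain does, and then every other chart can be
used. -/
lemma isSmoothFrameAt_of_chart {y : E → N} {Q : E → F →L[ℝ] F} {u : E} {p : N}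
    (hp : y u ∈ (chartAt F p).source) {Ψ : E → F × (F →L[ℝ] F)} (hΨ : ContDiffAt ℝ ∞ Ψ u)
    (hev : ∀ᶠ v in 𝓝 u, y v ∈ (chartAt F p).source ∧
      Ψ v = (extChartAt 𝓘(ℝ, F) p (y v), coordMap p (y v) ∘L Q v)) :
    IsSmoothFrameAt y Q u := by
  have h1 : ContDiffAt ℝ ∞ (fun v ↦ extChartAt 𝓘(ℝ, F) p (y v)) u :=
    (contDiffAt_fst.comp u hΨ).congr_of_eventuallyEq (by
      filter_upwards [hev] with v hv
      simp [hv.2])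
  have h2 : ContDiffAt ℝ ∞ (fun v ↦ coordMap p (y v) ∘L Q v) u :=
    (contDiffAt_snd.comp u hΨ).congr_of_eventuallyEq (by
      filter_upwards [hev] with v hv
      simp [hv.2])
  have hc : ContinuousAt y u := by
    have h3 : ContinuousAt (fun v ↦ (extChartAt 𝓘(ℝ, F) p).symm (extChartAt 𝓘(ℝ, F) p (y v))) u :=
      ContinuousAt.comp (f := fun v ↦ extChartAt 𝓘(ℝ, F) p (y v))
        (contMDiffAt_extChartAt_symm (extChartAt_mem_target hp)).continuousAt h1.continuousAt
    refine h3.congr ?_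
    filter_upwards [hev] with v hv
    exact extChartAt_symm_extChartAt hv.1
  exact ⟨hc, fun p' hp' ↦ contDiffAt_extChartAt_comp_change hc hp hp' h1,
    fun p' hp' ↦ contDiffAt_coordMap_comp_change hc hp hp' h1 h2⟩

variable [T2Space N] [ContMDiffCovariantDerivative cov ∞]

lemma IsDevelopment.continuousWithinAt_devState {γ : ℝ → N} {A : ℝ → F →L[ℝ] F} {ℓ : F}
    {s : Set ℝ} {t : ℝ} (h : IsDevelopment cov γ A ℓ s) (ht : t ∈ s) {p : N}
    (hp : γ t ∈ (chartAt F p).source) : ContinuousWithinAt (devState γ A ℓ p) s t :=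
  ((h t ht).2 p hp).hasDerivWithinAt_devState.continuousWithinAt

/-- Developments depend smoothly on the components of the velocity. -/
lemma isSmoothFrameAt_of_isDevelopment {U : Set E} (hU : IsOpen U) {L : E →L[ℝ] F} {q₀ : N}
    {γ : E → ℝ → N} {A : E → ℝ → F →L[ℝ] F}
    (hdev : ∀ u ∈ U, IsDevelopment cov (γ u) (A u) (L u) (Icc 0 1))
    (hγ : ∀ u ∈ U, γ u 0 = q₀) (hA : ∀ u ∈ U, A u 0 = .id ℝ F) {u₀ : E} (hu₀ : u₀ ∈ U) {t : ℝ}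
    (ht : t ∈ Icc (0 : ℝ) 1) : IsSmoothFrameAt (fun u ↦ γ u t) (fun u ↦ A u t) u₀ := by
  have hstart : IsSmoothFrameAt (fun u ↦ γ u 0) (fun u ↦ A u 0) u₀ := by
    refine isSmoothFrameAt_of_chart (mem_chart_source F (γ u₀ 0))
      (Ψ := fun _ ↦ (extChartAt 𝓘(ℝ, F) (γ u₀ 0) q₀, coordMap (γ u₀ 0) q₀ ∘L .id ℝ F))
      contDiffAt_const ?_
    filter_upwards [hU.mem_nhds hu₀] with v hv
    rw [hγ v hv, hA v hv, hγ u₀ hu₀]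
    exact ⟨mem_chart_source F q₀, rfl⟩
  -- What is chained is the propagation of smoothness at `u₀` from time `a` to time `b`.
  refine Icc_chain (P := fun a b ↦ IsSmoothFrameAt (fun u ↦ γ u a) (fun u ↦ A u a) u₀ →
    IsSmoothFrameAt (fun u ↦ γ u b) (fun u ↦ A u b) u₀) (fun τ hτ ↦ ?_)
    (fun a b c _ _ _ _ h1 h2 h ↦ h2 (h1 h)) ht hstart
  set p := γ u₀ τ with hpdef
  have hp := mem_chart_source F p
  have hΩ : IsOpen ((extChartAt 𝓘(ℝ, F) p).target ×ˢ (univ : Set ((F →L[ℝ] F) × F))) :=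
    (isOpen_extChartAt_target p).prod isOpen_univ
  have hX : ContDiffOn ℝ ∞ (devField (chr cov p))
      ((extChartAt 𝓘(ℝ, F) p).target ×ˢ (univ : Set ((F →L[ℝ] F) × F))) := fun x hx ↦
    (contDiffAt_devField (contDiffAt_chr_of_mem hx.1)).contDiffWithinAt
  obtain ⟨ε₀, hε₀, W, hW, Φ, hΦ⟩ := exists_smooth_flow hΩ hX
    (x₀ := devState (γ u₀) (A u₀) (L u₀) p τ) ⟨extChartAt_mem_target hp, mem_univ _⟩
  have hev : ∀ᶠ t in 𝓝[Icc 0 1] τ, γ u₀ t ∈ (chartAt F p).source ∧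
      devState (γ u₀) (A u₀) (L u₀) p t ∈ interior W :=
    Filter.Eventually.and ((hdev u₀ hu₀ τ hτ).1.eventually_mem
      ((chartAt F p).open_source.mem_nhds hp))
      (((hdev u₀ hu₀).continuousWithinAt_devState hτ hp).eventually_mem
        (isOpen_interior.mem_nhds (mem_interior_iff_mem_nhds.2 hW)))
  obtain ⟨ε, hε, hball⟩ := Metric.mem_nhdsWithin_iff.1 hev
  -- Two times within `ε₀ / 2` of `τ` differ by less than `ε₀`, so the local flow covers the passage
  -- from `a` to `b`; `ε` keeps the state of `u₀` where the flow is defined.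
  refine ⟨min ε (ε₀ / 2), by positivity, fun a b ha hab hb haτ hbτ hsm ↦ ?_⟩
  have hin : ∀ t, 0 ≤ t → t ≤ 1 → |t - τ| < min ε (ε₀ / 2) → γ u₀ t ∈ (chartAt F p).source ∧
      devState (γ u₀) (A u₀) (L u₀) p t ∈ interior W := fun t h0 h1 ht ↦
    hball ⟨by rw [Metric.mem_ball, Real.dist_eq]; exact ht.trans_le (min_le_left _ _), h0, h1⟩
  obtain ⟨has, haW⟩ := hin a ha (hab.trans hb) haτ
  obtain ⟨hbs, -⟩ := hin b (ha.trans hab) hb hbτ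
  have hlen : |b - a| < ε₀ := by
    have h1 := abs_lt.1 (haτ.trans_le (min_le_right _ _))
    have h2 := abs_lt.1 (hbτ.trans_le (min_le_right _ _))
    exact abs_lt.2 ⟨by linarith, by linarith⟩
  -- The velocity components `L u` belong to the state, so dependence on this parameter becomes
  -- dependence on initial values.
  have hstate : ContDiffAt ℝ ∞ (fun u ↦ devState (γ u) (A u) (L u) p a) u₀ :=
    (hsm.contDiffAt_base p has).prodMk ((hsm.contDiffAt_frame p has).prodMk L.contDiff.contDiffAt)
  have hWa : ∀ᶠ u in 𝓝 u₀, (u ∈ U ∧ γ u a ∈ (chartAt F p).source) ∧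
      devState (γ u) (A u) (L u) p a ∈ W :=
    Filter.Eventually.and (Filter.Eventually.and (hU.mem_nhds hu₀)
      (hsm.continuousAt.eventually_mem ((chartAt F p).open_source.mem_nhds has)))
      ((hstate.continuousAt.eventually_mem (isOpen_interior.mem_nhds haW)).mono
        fun u hu ↦ interior_subset hu)
  have hΨ : ContDiffAt ℝ ∞ (fun u ↦ Φ (b - a) (devState (γ u) (A u) (L u) p a) 1) u₀ :=
    ContDiffAt.comp (g := fun x ↦ Φ (b - a) x 1) u₀
      (hΦ (b - a) hlen _ (interior_subset haW)).2.2 hstate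
  refine isSmoothFrameAt_of_chart hbs
    (Ψ := fun u ↦ ((Φ (b - a) (devState (γ u) (A u) (L u) p a) 1).1,
      (Φ (b - a) (devState (γ u) (A u) (L u) p a) 1).2.1))
    ((contDiffAt_fst.comp u₀ hΨ).prodMk (contDiffAt_fst.comp u₀ (contDiffAt_snd.comp u₀ hΨ))) ?_
  filter_upwards [hWa] with u hu
  obtain ⟨⟨huU, hua⟩, huW⟩ := hu
  obtain ⟨h0, hflow, -⟩ := hΦ (b - a) hlen _ huW
  -- The trajectory of the flow and the given development on `[a, b]`, rescaled to `[0, 1]`, start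
  -- alike, so uniqueness identifies their endpoints.
  have hd1 := isDevelopment_of_devField (cov := cov) (p := p)
    (Ψ := Φ (b - a) (devState (γ u) (A u) (L u) p a)) (r := b - a)
    (fun τ hτ ↦ ⟨((hflow τ hτ).1).1, (hflow τ hτ).2⟩)
  have hd2 := (hdev u huU).comp_affine ha (sub_nonneg.2 hab) (by linarith)
  rw [h0] at hd1
  have hone : (1 : ℝ) ∈ Icc (0 : ℝ) 1 := by simp
  have heq := hd1.eqOn hd2 (by
      rw [h0]
      simpa [devState] using extChartAt_symm_extChartAt hua) (by
      rw [h0]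
      simp only [devState, mul_zero, add_zero]
      rw [extChartAt_symm_extChartAt hua, ← ContinuousLinearMap.comp_assoc,
        coordInv_comp_coordMap hua, ContinuousLinearMap.id_comp]) hone
  have hab1 : a + (b - a) * 1 = b := by ring
  simp only [hab1] at heq
  have htar := ((hflow 1 hone).1).1
  rw [← heq.1, ← heq.2, (extChartAt 𝓘(ℝ, F) p).right_inv htar, ← ContinuousLinearMap.comp_assoc,
    coordMap_comp_coordInv (extChartAt_symm_mem_source htar), ContinuousLinearMap.id_comp]
  exact ⟨extChartAt_symm_mem_source htar, rfl⟩

/-- Developments along all rays form a radial frame. -/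
lemma exists_isRadialFrame {U : Set E} (hU : IsOpen U) (hstar : StarConvex ℝ 0 U) {L : E →L[ℝ] F}
    {q₀ : N} {γ : E → ℝ → N} {A : E → ℝ → F →L[ℝ] F}
    (hdev : ∀ u ∈ U, IsDevelopment cov (γ u) (A u) (L u) (Icc 0 1))
    (hγ : ∀ u ∈ U, γ u 0 = q₀) (hA : ∀ u ∈ U, A u 0 = .id ℝ F)
    (hunit : ∀ u ∈ U, IsUnit (A u 1)) :
    IsRadialFrame cov U L (fun u ↦ γ u 1) (fun u ↦ A u 1) ∧
      ∀ u ∈ U, ∀ t ∈ Icc (0 : ℝ) 1, γ (t • u) 1 = γ u t ∧ A (t • u) 1 = A u t := by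
  have hone : (1 : ℝ) ∈ Icc (0 : ℝ) 1 := by simp
  have hmem : ∀ u ∈ U, ∀ t ∈ Icc (0 : ℝ) 1, t • u ∈ U := fun u hu t ht ↦
    hstar.smul_mem hu ht.1 ht.2
  -- The development for `t • u` is that for `u` slowed down by the factor `t`.
  have hray : ∀ u ∈ U, ∀ t ∈ Icc (0 : ℝ) 1, γ (t • u) 1 = γ u t ∧ A (t • u) 1 = A u t := by
    intro u hu t ht
    have h1 := (hdev u hu).comp_affine le_rfl ht.1 (by linarith [ht.2])
    have h2 := hdev _ (hmem u hu t ht)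
    rw [map_smul] at h2
    have := h2.eqOn h1 (by simp [hγ _ hu, hγ _ (hmem u hu t ht)])
      (by simp [hA _ hu, hA _ (hmem u hu t ht)]) hone
    simpa using this
  have hsm := fun u (hu : u ∈ U) ↦ isSmoothFrameAt_of_isDevelopment hU hdev hγ hA hu hone
  refine ⟨⟨fun v hv ↦ (hsm v hv).continuousAt, fun v hv ↦ (hsm v hv).contDiffAt_base,
    fun v hv ↦ (hsm v hv).contDiffAt_frame, hunit, fun u hu t ht p hp ↦ ?_,
    fun u hu t ht p hp ↦ ?_⟩, hray⟩
  all_goals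
    have htu := hmem u hu t ht
    have hpar := (hdev u hu t ht).2 p (by rw [← (hray u hu t ht).1]; exact hp)
  · have h1 := (hasDerivAt_comp_smul (((hsm _ htu).contDiffAt_base p hp).differentiableAt
      (by simp))).hasDerivWithinAt (s := Icc 0 1)
    have h2 := hpar.1.congr (f₁ := fun τ : ℝ ↦ extChartAt 𝓘(ℝ, F) p (γ (τ • u) 1))
      (fun τ hτ ↦ by rw [(hray u hu τ hτ).1]) (by rw [(hray u hu t ht).1])
    rw [(hray u hu t ht).1, (hray u hu t ht).2]
    exact (uniqueDiffOn_Icc zero_lt_one t ht).eq_deriv _ h1 h2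
  · have h1 := (hasDerivAt_comp_smul (((hsm _ htu).contDiffAt_frame p hp).differentiableAt
      (by simp))).hasDerivWithinAt (s := Icc 0 1)
    have h2 := hpar.2.congr (f₁ := fun τ : ℝ ↦ coordMap p (γ (τ • u) 1) ∘L A (τ • u) 1)
      (fun τ hτ ↦ by rw [(hray u hu τ hτ).1, (hray u hu τ hτ).2])
      (by rw [(hray u hu t ht).1, (hray u hu t ht).2])
    rw [(hray u hu t ht).1, (hray u hu t ht).2]
    exact (uniqueDiffOn_Icc zero_lt_one t ht).eq_deriv _ h1 h2

end SmoothDependence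

/-! ### Parallel transport and the exponential map in terms of developments. -/

section Transport

variable {E : Type*} [NormedAddCommGroup E] [NormedSpace ℝ E]
  {F : Type*} [NormedAddCommGroup F] [NormedSpace ℝ F] [FiniteDimensional ℝ F]
  {N : Type*} [TopologicalSpace N] [ChartedSpace F N] [IsManifold 𝓘(ℝ, F) ∞ N]
  {cov : CovariantDerivative 𝓘(ℝ, F) F (TangentSpace 𝓘(ℝ, F) : N → Type _)}
  {γ γ' : ℝ → N} {A : ℝ → F →L[ℝ] F} {v : ℝ → F} {ℓ : F}

lemma tangentBundle_mk_eq {p q : N} (h : p = q) {v w : F} (hv : v = w) :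
    (⟨p, v⟩ : TangentBundle 𝓘(ℝ, F) N) = ⟨q, w⟩ := by
  subst h hv; rfl

lemma proj_eq_of_eq_mk {z : TangentBundle 𝓘(ℝ, F) N} {q : N} {v : TangentSpace 𝓘(ℝ, F) q}
    (h : z = ⟨q, v⟩) : z.proj = q := congrArg TotalSpace.proj h

lemma snd_eq_of_eq_mk {z : TangentBundle 𝓘(ℝ, F) N} {q : N} {v : TangentSpace 𝓘(ℝ, F) q}
    (h : z = ⟨q, v⟩) : (z.2 : F) = v := congrArg (fun z : TangentBundle 𝓘(ℝ, F) N ↦ (z.2 : F)) h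

lemma IsParallelFrameOn.congr {s : Set ℝ} (h : IsParallelFrameOn cov γ A v s) (he : EqOn γ' γ s) :
    IsParallelFrameOn cov γ' A v s := by
  intro t ht
  refine ⟨(h t ht).1.congr he (he ht), fun p hp ↦ ?_⟩
  obtain ⟨h1, h2⟩ := (h t ht).2 p (by rwa [← he ht])
  unfold IsParallelFrameAt
  rw [he ht]
  exact ⟨h1.congr (fun τ hτ ↦ by rw [he hτ]) (by rw [he ht]),
    h2.congr (fun τ hτ ↦ by rw [he hτ]) (by rw [he ht])⟩

lemma IsParallelFrameOn.speed_eq (h : IsParallelFrameOn cov γ A v (Icc 0 1))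
    (hγ : ContMDiffOn 𝓘(ℝ, ℝ) 𝓘(ℝ, F) ∞ γ (Icc 0 1)) {t : ℝ} (ht : t ∈ Icc (0 : ℝ) 1) :
    speed γ t = v t := by
  have hp := mem_chart_source F (γ t)
  have h1 := hasDerivWithinAt_extChartAt_speed hγ ht hp
  have h2 := ((h t ht).2 _ hp).1
  rw [coordMap_self] at h1 h2
  exact (uniqueDiffOn_Icc zero_lt_one t ht).eq_deriv _ h1 h2

variable [T2Space N] [ContMDiffCovariantDerivative cov ∞]

/-- A parallel field has constant components in the frame, which starts at the identity; transport
to time 1 is therefore `A 1`. Curves are only compared on `[0, 1]`, since their values elsewhere are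
arbitrary. -/
lemma IsDevelopment.snd_eq_of_isParallelTransport (h : IsDevelopment cov γ A ℓ (Icc 0 1))
    (h0 : A 0 = .id ℝ F) (hu : ∀ t ∈ Icc (0 : ℝ) 1, IsUnit (A t)) (he : EqOn γ' γ (Icc 0 1))
    {p q : TangentBundle 𝓘(ℝ, F) N} (hpq : cov.IsParallelTransport γ' 0 1 p q) :
    (q.2 : F) = A 1 p.2 := by
  obtain ⟨ξ, hξ, hproj, rfl, rfl⟩ := hpq
  have hγ : ContMDiffOn 𝓘(ℝ, ℝ) 𝓘(ℝ, F) ∞ (fun t ↦ (ξ t).proj) (Icc 0 1) := fun t ht ↦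
    (Bundle.contMDiffWithinAt_totalSpace.1 (hξ.1 t ht)).1
  have hframe : IsParallelFrameOn cov (fun t ↦ (ξ t).proj) A (fun t ↦ A t ℓ) (Icc 0 1) :=
    IsParallelFrameOn.congr h fun t ht ↦ (hproj t ht).trans (he ht)
  have h1 := hframe.eq_apply hu (X := fun t ↦ ((ξ t).2 : F)) (fun t ht ↦ by
    rw [← hframe.speed_eq hγ ht]
    exact hξ.hasDerivWithinAt ht) (t := 1) (by simp)
  rw [h0] at h1
  exact h1.trans (congrArg (A 1) (DFunLike.congr_fun (Ring.inverse_one (F →L[ℝ] F)) _))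

lemma IsDevelopment.eqOn_of_isGeodesicOn {q₀ : N} (h : IsDevelopment cov γ A ℓ (Icc 0 1))
    (h0 : A 0 = .id ℝ F) (hγ0 : γ 0 = q₀) (hγ' : cov.IsGeodesicOn γ' (Icc 0 1))
    (hv : velocity 𝓘(ℝ, F) γ' (Icc 0 1) 0 = ⟨q₀, ℓ⟩) : EqOn γ' γ (Icc 0 1) := by
  obtain ⟨A', hA0, hA', -⟩ := hγ'.exists_isDevelopment
  have hs : speed γ' 0 = ℓ := snd_eq_of_eq_mk hv
  rw [hs] at hA'
  intro t ht
  exact (hA'.eqOn h ((proj_eq_of_eq_mk hv).trans hγ0.symm) (hA0.trans h0.symm) ht).1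

/-- Geodesics and parallel frames along them for all initial velocities `L u`, `u ∈ U`. -/
structure IsRadialFamily
    (cov : CovariantDerivative 𝓘(ℝ, F) F (TangentSpace 𝓘(ℝ, F) : N → Type _))
    (U : Set E) (L : E →L[ℝ] F) (q₀ : N) (γ : E → ℝ → N) (A : E → ℝ → F →L[ℝ] F) : Prop where
  isGeodesicOn : ∀ u ∈ U, cov.IsGeodesicOn (γ u) (Icc 0 1)
  velocity_eq : ∀ u ∈ U, velocity 𝓘(ℝ, F) (γ u) (Icc 0 1) 0 = ⟨q₀, L u⟩
  isDevelopment : ∀ u ∈ U, IsDevelopment cov (γ u) (A u) (L u) (Icc 0 1)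
  frame_zero : ∀ u ∈ U, A u 0 = .id ℝ F
  isUnit : ∀ u ∈ U, ∀ t ∈ Icc (0 : ℝ) 1, IsUnit (A u t)

lemma exists_isRadialFamily {U : Set E} {L : E →L[ℝ] F} {q₀ : N}
    (hdom : ∀ u ∈ U, (L u : TangentSpace 𝓘(ℝ, F) q₀) ∈ cov.expDomain q₀) :
    ∃ γ A, IsRadialFamily cov U L q₀ γ A := by
  have : ∀ u, ∃ (γ : ℝ → N) (A : ℝ → F →L[ℝ] F), u ∈ U → cov.IsGeodesicOn γ (Icc 0 1) ∧
      velocity 𝓘(ℝ, F) γ (Icc 0 1) 0 = ⟨q₀, L u⟩ ∧ IsDevelopment cov γ A (L u) (Icc 0 1) ∧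
      A 0 = .id ℝ F ∧ ∀ t ∈ Icc (0 : ℝ) 1, IsUnit (A t) := by
    intro u
    by_cases hu : u ∈ U
    · obtain ⟨γ, hγ, hv⟩ := hdom u hu
      obtain ⟨A, h0, hA, hA'⟩ := hγ.exists_isDevelopment
      have hs : speed γ 0 = L u := snd_eq_of_eq_mk hv
      rw [hs] at hA
      exact ⟨γ, A, fun _ ↦ ⟨hγ, hv, hA, h0, hA'⟩⟩
    · exact ⟨fun _ ↦ q₀, fun _ ↦ 0, fun h ↦ absurd h hu⟩
  choose γ A h using this
  exact ⟨γ, A, fun u hu ↦ (h u hu).1, fun u hu ↦ (h u hu).2.1, fun u hu ↦ (h u hu).2.2.1,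
    fun u hu ↦ (h u hu).2.2.2.1, fun u hu ↦ (h u hu).2.2.2.2⟩

namespace IsRadialFamily

variable {U : Set E} {L : E →L[ℝ] F} {q₀ : N} {γ : E → ℝ → N} {A : E → ℝ → F →L[ℝ] F} {u : E}

lemma base_zero (h : IsRadialFamily cov U L q₀ γ A) (hu : u ∈ U) : γ u 0 = q₀ :=
  proj_eq_of_eq_mk (h.velocity_eq u hu)

lemma isRadialFrame (h : IsRadialFamily cov U L q₀ γ A) (hU : IsOpen U)
    (hstar : StarConvex ℝ 0 U) : IsRadialFrame cov U L (fun u ↦ γ u 1) (fun u ↦ A u 1) :=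
  (exists_isRadialFrame hU hstar h.isDevelopment (fun _ hu ↦ h.base_zero hu) h.frame_zero
    fun u hu ↦ h.isUnit u hu 1 (by simp)).1

lemma apply_smul (h : IsRadialFamily cov U L q₀ γ A) (hU : IsOpen U)
    (hstar : StarConvex ℝ 0 U) (hu : u ∈ U) {t : ℝ} (ht : t ∈ Icc (0 : ℝ) 1) :
    γ (t • u) 1 = γ u t ∧ A (t • u) 1 = A u t :=
  (exists_isRadialFrame hU hstar h.isDevelopment (fun _ hu ↦ h.base_zero hu) h.frame_zero
    fun u hu ↦ h.isUnit u hu 1 (by simp)).2 u hu t ht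

lemma apply_zero (h : IsRadialFamily cov U L q₀ γ A) (hU : IsOpen U)
    (hstar : StarConvex ℝ 0 U) (h0 : (0 : E) ∈ U) : γ 0 1 = q₀ ∧ A 0 1 = .id ℝ F := by
  have := h.apply_smul hU hstar h0 (t := 0) (by simp)
  rw [zero_smul] at this
  exact ⟨this.1.trans (h.base_zero h0), this.2.trans (h.frame_zero 0 h0)⟩

lemma eqOn_of_isGeodesicOn (h : IsRadialFamily cov U L q₀ γ A) (hu : u ∈ U) {γ' : ℝ → N}
    (hγ' : cov.IsGeodesicOn γ' (Icc 0 1))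
    (hv : velocity 𝓘(ℝ, F) γ' (Icc 0 1) 0 = ⟨q₀, L u⟩) : EqOn γ' (γ u) (Icc 0 1) :=
  (h.isDevelopment u hu).eqOn_of_isGeodesicOn (h.frame_zero u hu) (h.base_zero hu) hγ' hv

/-- The exponential map is defined through a chosen geodesic; uniqueness makes the choice harmless.
-/
lemma expMap_eq (h : IsRadialFamily cov U L q₀ γ A) (hu : u ∈ U) :
    cov.expMap q₀ (L u) = γ u 1 := by
  have hdom : (L u : TangentSpace 𝓘(ℝ, F) q₀) ∈ cov.expDomain q₀ :=
    ⟨γ u, h.isGeodesicOn u hu, h.velocity_eq u hu⟩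
  unfold expMap
  exact (dif_pos hdom).trans
    (h.eqOn_of_isGeodesicOn hu hdom.choose_spec.1 hdom.choose_spec.2 (by simp))

lemma isParallelTransport (h : IsRadialFamily cov U L q₀ γ A) (hU : IsOpen U)
    (hstar : StarConvex ℝ 0 U) (hu : u ∈ U) (w : F) :
    cov.IsParallelTransport (γ u) 0 1 ⟨q₀, w⟩ ⟨γ u 1, A u 1 w⟩ := by
  have hQ := h.isRadialFrame hU hstar
  refine ⟨fun t ↦ ⟨γ u t, A u t w⟩, ⟨fun t ht ↦ ?_, fun t ht ↦ ?_⟩, fun t _ ↦ rfl,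
    tangentBundle_mk_eq (h.base_zero hu) (by rw [h.frame_zero u hu]; rfl), rfl⟩
  · rw [ModelWithCorners.tangent, Bundle.contMDiffWithinAt_totalSpace]
    refine ⟨(h.isGeodesicOn u hu).1 t ht, contMDiffWithinAt_iff_contDiffWithinAt.2 ?_⟩
    simp only [trivializationAt_snd]
    have htu : t • u ∈ U := hstar.smul_mem hu ht.1 ht.2
    -- The equation of a parallel frame directly provides only one derivative in `t`. Since the
    -- frame for `u` at time `t` is the frame for `t • u` at time 1, smoothness in `t` follows from
    -- smoothness in the initial velocity.
    have h1 := hQ.contDiffAt_frame _ htu (γ u t)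
      (by rw [(h.apply_smul hU hstar hu ht).1]; exact mem_chart_source F _)
    have h2 : ContDiffAt ℝ ∞ (fun τ : ℝ ↦ coordMap (γ u t) (γ (τ • u) 1) ∘L A (τ • u) 1) t :=
      ContDiffAt.comp (f := fun τ : ℝ ↦ τ • u) t h1 (contDiffAt_id.smul contDiffAt_const)
    refine (h2.clm_apply (contDiffAt_const (c := w))).contDiffWithinAt.congr (fun τ hτ ↦ ?_) ?_
    · rw [(h.apply_smul hU hstar hu hτ).1, (h.apply_smul hU hstar hu hτ).2]; rfl
    · rw [(h.apply_smul hU hstar hu ht).1, (h.apply_smul hU hstar hu ht).2]; rfl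
  · obtain ⟨hc, hpar⟩ := h.isDevelopment u hu t ht
    obtain ⟨h1, h2⟩ := hpar (γ u t) (mem_chart_source F _)
    have h3 := (h2.clm_apply (hasDerivWithinAt_const t _ w)).hasFDerivWithinAt.hasMFDerivWithinAt
    refine (covAlong_eq cov (fun t ↦ (⟨γ u t, A u t w⟩ : TangentBundle 𝓘(ℝ, F) N)) (Icc 0 1) t
      (uniqueMDiffOn_Icc_zero_one t ht)
      (hasMFDerivWithinAt_iff_extChartAt_comp.2 ⟨hc, h1.hasFDerivWithinAt⟩) h3 (1 : ℝ)).trans ?_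
    simp
    rfl

end IsRadialFamily

end Transport

/-! ### Differentials and covariant derivatives expressed by the forms of a radial frame. -/

section FrameDerivative

variable {E : Type*} [NormedAddCommGroup E] [NormedSpace ℝ E]
  {F : Type*} [NormedAddCommGroup F] [NormedSpace ℝ F] [FiniteDimensional ℝ F] [CompleteSpace F]
  {N : Type*} [TopologicalSpace N] [ChartedSpace F N] [IsManifold 𝓘(ℝ, F) ∞ N]
  {cov : CovariantDerivative 𝓘(ℝ, F) F (TangentSpace 𝓘(ℝ, F) : N → Type _)}
  {U : Set E} {L : E →L[ℝ] F} {y : E → N} {Q : E → F →L[ℝ] F} {u : E}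

namespace IsRadialFrame

lemma contMDiffAt (hQ : IsRadialFrame cov U L y Q) (hu : u ∈ U) :
    ContMDiffAt 𝓘(ℝ, E) 𝓘(ℝ, F) ∞ y u :=
  contMDiffAt_iff_target.2 ⟨hQ.continuousAt u hu,
    (hQ.contDiffAt_base u hu (y u) (mem_chart_source F _)).contMDiffAt⟩

lemma fderiv_base_eq (hQ : IsRadialFrame cov U L y Q) (hu : u ∈ U) {p : N}
    (hp : y u ∈ (chartAt F p).source) (w : E) :
    fderiv ℝ (fun v ↦ extChartAt 𝓘(ℝ, F) p (y v)) u w =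
      coordMap p (y u) (Q u (solder p y Q u w)) :=
  (apply_inverse_apply (isUnit_coordMap_comp hp (hQ.isUnit u hu)) _).symm

/-- The derivative of the base map of a radial frame is `Q` applied to the solder form. -/
lemma exists_hasMFDerivAt (hQ : IsRadialFrame cov U L y Q) (hu : u ∈ U) :
    ∃ Y : E →L[ℝ] F, HasMFDerivAt 𝓘(ℝ, E) 𝓘(ℝ, F) y u Y ∧
      ∀ w, Y w = Q u (solder (y u) y Q u w) := by
  have hp := mem_chart_source F (y u)
  refine ⟨fderiv ℝ (fun v ↦ extChartAt 𝓘(ℝ, F) (y u) (y v)) u, ?_, fun w ↦ ?_⟩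
  · refine hasMFDerivWithinAt_univ.1 ?_
    exact hasMFDerivWithinAt_iff_extChartAt_comp.2 ⟨(hQ.continuousAt u hu).continuousWithinAt,
      ((hQ.contDiffAt_base u hu _ hp).differentiableAt (by simp)).hasFDerivAt.hasFDerivWithinAt⟩
  · rw [hQ.fderiv_base_eq hu hp, coordMap_self]
    rfl

/-- The covariant derivative of the field `Q k` along `y`, in the chart at `p`. -/
lemma exists_hasFDerivAt_frame_apply (hQ : IsRadialFrame cov U L y Q) (hu : u ∈ U) {p : N}
    (hp : y u ∈ (chartAt F p).source) {k : E → F} {k' : E →L[ℝ] F} (hk : HasFDerivAt k k' u) :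
    ∃ b : E →L[ℝ] F, HasFDerivAt (fun v ↦ coordMap p (y v) (Q v (k v))) b u ∧
      ∀ w, b w + chr cov p (extChartAt 𝓘(ℝ, F) p (y u)) (coordMap p (y u)
        (Q u (solder p y Q u w))) (coordMap p (y u) (Q u (k u))) =
        coordMap p (y u) (Q u (connForm cov p y Q u w (k u) + k' w)) := by
  have hB := ((hQ.contDiffAt_frame u hu p hp).differentiableAt (by simp)).hasFDerivAt
  refine ⟨_, hB.clm_apply hk, fun w ↦ ?_⟩
  have h1 := apply_inverse_apply (isUnit_coordMap_comp hp (hQ.isUnit u hu))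
    ((fderiv ℝ (fun v ↦ coordMap p (y v) ∘L Q v) u w +
      chr cov p (extChartAt 𝓘(ℝ, F) p (y u)) (fderiv ℝ (fun v ↦ extChartAt 𝓘(ℝ, F) p (y v)) u w) ∘L
      (coordMap p (y u) ∘L Q u)) (k u))
  have h2 : coordMap p (y u) (Q u (connForm cov p y Q u w (k u))) = _ := h1
  rw [map_add, map_add, h2, hQ.fderiv_base_eq hu hp]
  simp only [add_apply, ContinuousLinearMap.comp_apply, ContinuousLinearMap.flip_apply]
  abel

/-- The covariant derivative of a vector field, in terms of its components in a radial frame. -/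
lemma exists_hasFDerivAt_components (hQ : IsRadialFrame cov U L y Q) (hU : IsOpen U) (hu : u ∈ U)
    {X : N → F}
    (hX : MDifferentiableAt 𝓘(ℝ, F) (𝓘(ℝ, F).prod 𝓘(ℝ, F))
      (fun q ↦ (⟨q, X q⟩ : TangentBundle 𝓘(ℝ, F) N)) (y u)) :
    ∃ k' : E →L[ℝ] F, HasFDerivAt (fun v ↦ Ring.inverse (Q v) (X (y v))) k' u ∧
      ∀ w, (cov (X : Π q : N, TangentSpace 𝓘(ℝ, F) q) (y u) (Q u (solder (y u) y Q u w)) : F) =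
        Q u (connForm cov (y u) y Q u w (Ring.inverse (Q u) (X (y u))) + k' w) := by
  have hp := mem_chart_source F (y u)
  have hev := hQ.eventually_mem hU hu hp
  have hB := (hQ.contDiffAt_frame u hu _ hp).differentiableAt (by simp)
  have hc := (hQ.contDiffAt_base u hu _ hp).differentiableAt (by simp)
  have hZ := (mdifferentiableAt_section_iff_fieldCoord hp X).1 hX
  have hZc : HasFDerivAt (fun v ↦ fieldCoord (y u) X (extChartAt 𝓘(ℝ, F) (y u) (y v)))
      (fderiv ℝ (fieldCoord (y u) X) (extChartAt 𝓘(ℝ, F) (y u) (y u)) ∘L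
        fderiv ℝ (fun v ↦ extChartAt 𝓘(ℝ, F) (y u) (y v)) u) u :=
    HasFDerivAt.comp (f := fun v ↦ extChartAt 𝓘(ℝ, F) (y u) (y v)) u hZ.hasFDerivAt hc.hasFDerivAt
  have hinv : DifferentiableAt ℝ
      (fun v ↦ Ring.inverse (coordMap (y u) (y v) ∘L Q v)) u := by
    obtain ⟨B, hB'⟩ := isUnit_coordMap_comp hp (hQ.isUnit u hu)
    have h1 : DifferentiableAt ℝ (Ring.inverse : (F →L[ℝ] F) → _)
        (coordMap (y u) (y u) ∘L Q u) := by
      rw [← hB']; exact (hasFDerivAt_ringInverse B).differentiableAt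
    exact DifferentiableAt.comp (f := fun v ↦ coordMap (y u) (y v) ∘L Q v) u h1 hB
  have hk : DifferentiableAt ℝ (fun v ↦ Ring.inverse (Q v) (X (y v))) u := by
    refine (hinv.clm_apply hZc.differentiableAt).congr_of_eventuallyEq ?_
    filter_upwards [hev] with v hv
    exact ((congrArg (fun z : F ↦ Ring.inverse (coordMap (y u) (y v) ∘L Q v) z)
      (fieldCoord_extChartAt hv.2 X)).trans
        (inverse_coordMap_comp hv.2 (hQ.isUnit v hv.1) _)).symm
  refine ⟨_, hk.hasFDerivAt, fun w ↦ ?_⟩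
  obtain ⟨b, hb, hbw⟩ := hQ.exists_hasFDerivAt_frame_apply hu hp hk.hasFDerivAt
  -- Recombining the components with the frame returns `X ∘ y`, so the derivative from the product
  -- rule is that of the coordinates of `X` along `y`.
  have hb' := hb.unique (hZc.congr_of_eventuallyEq (by
    filter_upwards [hev] with v hv
    rw [apply_inverse_apply (hQ.isUnit v hv.1)]
    exact (fieldCoord_extChartAt hv.2 X).symm))
  have h1 := cov_apply_eq (cov := cov) hp hX (Q u (solder (y u) y Q u w))
  have h2 := hbw w
  rw [hb', apply_inverse_apply (hQ.isUnit u hu), ContinuousLinearMap.comp_apply,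
    hQ.fderiv_base_eq hu hp] at h2
  have h3 := h1.trans h2
  simp only [coordMap_self, ContinuousLinearMap.id_apply] at h3
  exact h3

end IsRadialFrame

end FrameDerivative

/-! ### Equality of forms from the hypothesis on torsion and curvature. -/

section Comparison

variable {E : Type*} [NormedAddCommGroup E] [NormedSpace ℝ E] [FiniteDimensional ℝ E]
  [CompleteSpace E]
  {M : Type*} [TopologicalSpace M] [T2Space M] [ChartedSpace E M] [IsManifold 𝓘(ℝ, E) ∞ M]
  {F : Type*} [NormedAddCommGroup F] [NormedSpace ℝ F] [FiniteDimensional ℝ F] [CompleteSpace F]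
  {N : Type*} [TopologicalSpace N] [T2Space N] [ChartedSpace F N] [IsManifold 𝓘(ℝ, F) ∞ N]
  {covM : CovariantDerivative 𝓘(ℝ, E) E (TangentSpace 𝓘(ℝ, E) : M → Type _)}
  [ContMDiffCovariantDerivative covM ∞]
  {covN : CovariantDerivative 𝓘(ℝ, F) F (TangentSpace 𝓘(ℝ, F) : N → Type _)}
  [ContMDiffCovariantDerivative covN ∞]
  {U : Set E} {σ₀ : E →L[ℝ] F} {x : E → M} {P : E → E →L[ℝ] E} {y : E → N} {Q : E → F →L[ℝ] F}

/-- If the map `σ` which carries the frame `P` to the frame `Q` relates torsions and curvatures,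
then the solder and connection forms of the two frames are related. -/
lemma IsRadialFrame.solder_eq_and_connForm_eq_of_related (hU : IsOpen U) (hstar : StarConvex ℝ 0 U)
    (hP : IsRadialFrame covM U (.id ℝ E) x P) (hQ : IsRadialFrame covN U σ₀ y Q)
    {f : M → N} {σ : M → E →L[ℝ] F} (hf : ∀ u ∈ U, f (x u) = y u)
    (hσ : ∀ u ∈ U, ∀ k, σ (x u) (P u k) = Q u (σ₀ k))
    (hT : ∀ u ∈ U, ∀ a b : E,
      (σ (x u) (covM.torsion (x u) a b) : F) =
        covN.torsion (f (x u)) (σ (x u) a) (σ (x u) b))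
    (hR : ∀ u ∈ U, ∀ a b c : E,
      (σ (x u) (covM.curvature (x u) a b c) : F) =
        covN.curvature (f (x u)) (σ (x u) a) (σ (x u) b) (σ (x u) c))
    {u : E} (hu : u ∈ U) (w : E) :
    solder (y u) y Q u w = σ₀ (solder (x u) x P u w) ∧
      connForm covN (y u) y Q u w ∘L σ₀ = σ₀ ∘L connForm covM (x u) x P u w := by
  -- In the frames `P` and `Q` the map `σ` is the constant map `σ₀`; this turns the relations
  -- between tensors into relations between their components.
  have hinv : ∀ v ∈ U, ∀ z : E, σ₀ (Ring.inverse (P v) z) = Ring.inverse (Q v) (σ (x v) z) := by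
    intro v hv z
    have h := hσ v hv (Ring.inverse (P v) z)
    rw [apply_inverse_apply (hP.isUnit v hv)] at h
    rw [h, inverse_apply_apply (hQ.isUnit v hv)]
  refine hP.solder_eq_and_connForm_eq hU hstar hQ (fun v hv a b ↦ ?_) (fun v hv a b k ↦ ?_) hu w
  · refine (hinv v hv _).trans (congrArg (fun z : F ↦ Ring.inverse (Q v) z) ((hT v hv _ _).trans ?_))
    rw [hσ v hv, hσ v hv]
    exact congrArg (fun q ↦ (covN.torsion q (Q v (σ₀ a)) (Q v (σ₀ b)) : F)) (hf v hv)
  · refine (hinv v hv _).trans (congrArg (fun z : F ↦ Ring.inverse (Q v) z) ((hR v hv _ _ _).trans ?_))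
    rw [hσ v hv, hσ v hv, hσ v hv]
    exact congrArg (fun q ↦ (covN.curvature q (Q v (σ₀ a)) (Q v (σ₀ b)) (Q v (σ₀ k)) : F))
      (hf v hv)

end Comparison

/-! ### The differential of `f` and its affinity. -/

section Affine

variable {E : Type*} [NormedAddCommGroup E] [NormedSpace ℝ E] [FiniteDimensional ℝ E]
  [CompleteSpace E]
  {M : Type*} [TopologicalSpace M] [T2Space M] [ChartedSpace E M] [IsManifold 𝓘(ℝ, E) ∞ M]
  {F : Type*} [NormedAddCommGroup F] [NormedSpace ℝ F] [FiniteDimensional ℝ F] [CompleteSpace F]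
  {N : Type*} [TopologicalSpace N] [T2Space N] [ChartedSpace F N] [IsManifold 𝓘(ℝ, F) ∞ N]
  {covM : CovariantDerivative 𝓘(ℝ, E) E (TangentSpace 𝓘(ℝ, E) : M → Type _)}
  {covN : CovariantDerivative 𝓘(ℝ, F) F (TangentSpace 𝓘(ℝ, F) : N → Type _)}
  {U : Set E} {V : Set M} {σ₀ : E →L[ℝ] F} {x : E → M} {P : E → E →L[ℝ] E} {y : E → N}
  {Q : E → F →L[ℝ] F} {G : M → E} {f : M → N} {σ : M → E →L[ℝ] F} {u : E}

lemma contMDiffOn_of_comp_radial (hQ : IsRadialFrame covN U σ₀ y Q) (hV : IsOpen V)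
    (hG : ContMDiffOn 𝓘(ℝ, E) 𝓘(ℝ, E) ∞ G V) (hGU : MapsTo G V U)
    (hf : ∀ q ∈ V, f q = y (G q)) : ContMDiffOn 𝓘(ℝ, E) 𝓘(ℝ, F) ∞ f V := by
  intro q hq
  have h1 : ContMDiffAt 𝓘(ℝ, E) 𝓘(ℝ, F) ∞ (y ∘ G) q :=
    (hQ.contMDiffAt (hGU hq)).comp q (hG.contMDiffAt (hV.mem_nhds hq))
  refine (h1.congr_of_eventuallyEq ?_).contMDiffWithinAt
  filter_upwards [hV.mem_nhds hq] with q' hq' using hf q' hq'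

/-- The differential of `f`, for `f ∘ x = y`, carries the frame `P` to the frame `Q`. -/
lemma hasMFDerivAt_of_solder_eq (hP : IsRadialFrame covM U (.id ℝ E) x P)
    (hQ : IsRadialFrame covN U σ₀ y Q) (hV : IsOpen V)
    (hG : ContMDiffOn 𝓘(ℝ, E) 𝓘(ℝ, E) ∞ G V) (hxV : MapsTo x U V)
    (hxG : ∀ q ∈ V, x (G q) = q) (hGx : ∀ u ∈ U, G (x u) = u) (hf : ∀ q ∈ V, f q = y (G q))
    (hσ : ∀ u ∈ U, ∀ k, σ (x u) (P u k) = Q u (σ₀ k))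
    (hs : ∀ u ∈ U, ∀ w, solder (y u) y Q u w = σ₀ (solder (x u) x P u w)) (hu : u ∈ U) :
    HasMFDerivAt 𝓘(ℝ, E) 𝓘(ℝ, F) f (x u) (σ (x u)) ∧
      ∃ g : E →L[ℝ] E, HasMFDerivAt 𝓘(ℝ, E) 𝓘(ℝ, E) G (x u) g ∧
        ∀ v, P u (solder (x u) x P u (g v)) = v := by
  obtain ⟨X, hX, hXw⟩ := hP.exists_hasMFDerivAt hu
  obtain ⟨Y, hY, hYw⟩ := hQ.exists_hasMFDerivAt hu
  have hVn := hV.mem_nhds (hxV hu)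
  obtain ⟨g, hg⟩ : ∃ g : E →L[ℝ] E, HasMFDerivAt 𝓘(ℝ, E) 𝓘(ℝ, E) G (x u) g :=
    ⟨_, ((hG.contMDiffAt hVn).mdifferentiableAt (by simp)).hasMFDerivAt⟩
  have hX' : HasMFDerivAt 𝓘(ℝ, E) 𝓘(ℝ, E) x (G (x u)) X := by rw [hGx u hu]; exact hX
  have hY' : HasMFDerivAt 𝓘(ℝ, E) 𝓘(ℝ, F) y (G (x u)) Y := by rw [hGx u hu]; exact hY
  have h1 : HasMFDerivAt 𝓘(ℝ, E) 𝓘(ℝ, E) (x ∘ G) (x u) (X ∘L g) := hX'.comp (x u) hg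
  have h2 : HasMFDerivAt 𝓘(ℝ, E) 𝓘(ℝ, F) (y ∘ G) (x u) (Y ∘L g) := hY'.comp (x u) hg
  have h3 : HasMFDerivAt 𝓘(ℝ, E) 𝓘(ℝ, E) (x ∘ G) (x u) (ContinuousLinearMap.id ℝ E) :=
    (hasMFDerivAt_id (x u)).congr_of_eventuallyEq (by
      filter_upwards [hVn] with q hq using hxG q hq)
  have h4 : X ∘L g = .id ℝ E := hasMFDerivAt_unique h1 h3
  have h5 : ∀ v, P u (solder (x u) x P u (g v)) = v := fun v ↦
    (hXw (g v)).symm.trans (DFunLike.congr_fun h4 v)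
  refine ⟨?_, g, hg, h5⟩
  -- With `g = dG` inverse to `dx = P θ`, one has `dy g = Q σ₀ θ g = σ P θ g = σ`.
  have h6 : σ (x u) = Y ∘L g := by
    ext v
    rw [ContinuousLinearMap.comp_apply, hYw, hs u hu, ← hσ u hu, h5]
  rw [h6]
  refine h2.congr_of_eventuallyEq ?_
  filter_upwards [hVn] with q hq using hf q hq

/-- The map `f` with `f ∘ x = y` commutes with covariant derivatives, when the forms of the two
frames are related. -/
lemma apply_cov_eq_covAlong (hU : IsOpen U) (hP : IsRadialFrame covM U (.id ℝ E) x P)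
    (hQ : IsRadialFrame covN U σ₀ y Q) (hV : IsOpen V)
    (hG : ContMDiffOn 𝓘(ℝ, E) 𝓘(ℝ, E) ∞ G V) (hGU : MapsTo G V U) (hxV : MapsTo x U V)
    (hxG : ∀ q ∈ V, x (G q) = q) (hGx : ∀ u ∈ U, G (x u) = u) (hf : ∀ q ∈ V, f q = y (G q))
    (hσ : ∀ u ∈ U, ∀ k, σ (x u) (P u k) = Q u (σ₀ k))
    (hs : ∀ u ∈ U, ∀ w, solder (y u) y Q u w = σ₀ (solder (x u) x P u w))
    (hc : ∀ u ∈ U, ∀ w, connForm covN (y u) y Q u w ∘L σ₀ = σ₀ ∘L connForm covM (x u) x P u w)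
    {X : M → E} {Z : M → F} (hu : u ∈ U)
    (hX : MDifferentiableAt 𝓘(ℝ, E) (𝓘(ℝ, E).prod 𝓘(ℝ, E))
      (fun q ↦ (⟨q, X q⟩ : TangentBundle 𝓘(ℝ, E) M)) (x u))
    (hZ : ∀ q ∈ V, Z q = σ q (X q)) (v : E) :
    σ (x u) (covM (X : Π q : M, TangentSpace 𝓘(ℝ, E) q) (x u) v) =
      covN.covAlong (I₁ := 𝓘(ℝ, E)) (fun q ↦ (⟨f q, Z q⟩ : TangentBundle 𝓘(ℝ, F) N)) V (x u) v := by
  obtain ⟨hder, g, hg, hgv⟩ := hasMFDerivAt_of_solder_eq hP hQ hV hG hxV hxG hGx hf hσ hs hu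
  have hq := hxV hu
  have hVn := hV.mem_nhds hq
  obtain ⟨k', hk', hcov⟩ := hP.exists_hasFDerivAt_components hU hu hX
  set k : E → E := fun v ↦ Ring.inverse (P v) (X (x v)) with hk
  have hfx : f (x u) = y u := by rw [hf _ hq, hGx u hu]
  have hp : y u ∈ (chartAt F (f (x u))).source := by rw [hfx]; exact mem_chart_source F _
  have hσk : HasFDerivAt (fun v ↦ σ₀ (k v)) (σ₀ ∘L k') u := σ₀.hasFDerivAt.comp u hk'
  obtain ⟨b, hb, hbw⟩ := hQ.exists_hasFDerivAt_frame_apply hu hp hσk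
  have hcomp : ∀ q ∈ V, Z q = Q (G q) (σ₀ (k (G q))) := by
    intro q hq
    rw [hZ q hq, ← hσ _ (hGU hq), hk]
    simp only
    rw [apply_inverse_apply (hP.isUnit _ (hGU hq)), hxG q hq]
  have hb' : HasMFDerivAt 𝓘(ℝ, E) 𝓘(ℝ, F)
      (fun v ↦ coordMap (f (x u)) (y v) (Q v (σ₀ (k v)))) (G (x u)) b := by
    rw [hGx u hu]; exact hb.hasMFDerivAt
  have hbG : HasMFDerivAt 𝓘(ℝ, E) 𝓘(ℝ, F)
      ((fun v ↦ coordMap (f (x u)) (y v) (Q v (σ₀ (k v)))) ∘ G) (x u) (b ∘L g) :=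
    hb'.comp (x u) hg
  have hbf : HasMFDerivAt 𝓘(ℝ, E) 𝓘(ℝ, F)
      (fun q ↦ coordMap (f (x u)) (f q) (Z q)) (x u) (b ∘L g) :=
    hbG.congr_of_eventuallyEq (by
      filter_upwards [hVn] with q hq
      rw [hcomp q hq, hf q hq]
      rfl)
  have hal := covAlong_eq covN (fun q ↦ (⟨f q, Z q⟩ : TangentBundle 𝓘(ℝ, F) N)) V (x u)
    (hV.uniqueMDiffOn _ hq) hder.hasMFDerivWithinAt hbf.hasMFDerivWithinAt v
  refine Eq.trans ?_ hal.symm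
  have hk1 : Z (x u) = Q u (σ₀ (k u)) := by rw [hcomp _ hq, hGx u hu]
  have hsv : σ (x u) v = Q u (solder (y u) y Q u (g v)) := by
    rw [hs u hu, ← hσ u hu, hgv]
  have hcc : connForm covN (y u) y Q u (g v) (σ₀ (k u)) =
      σ₀ (connForm covM (x u) x P u (g v) (k u)) := DFunLike.congr_fun (hc u hu (g v)) (k u)
  have hrhs := hbw (g v)
  -- The points `f (x u)` and `y u` are equal but give syntactically different charts; chart
  -- independence of both forms moves between them.
  rw [hQ.solder_eq hu (mem_chart_source F (y u)) hp, ← hsv, ← hk1, ← hfx, coordMap_self,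
    hQ.connForm_eq hu (mem_chart_source F (y u)) hp, hcc] at hrhs
  have hlhs := hcov (g v)
  rw [hgv] at hlhs
  refine (congrArg (σ (x u)) hlhs).trans ((hσ u hu _).trans ?_)
  rw [map_add]
  exact hrhs.symm

/-- The map `f` with `f ∘ x = y` is affine, when the forms of the two frames are related. -/
lemma isAffineOn_of_forms_eq (hU : IsOpen U) (hP : IsRadialFrame covM U (.id ℝ E) x P)
    (hQ : IsRadialFrame covN U σ₀ y Q) (hV : IsOpen V)
    (hG : ContMDiffOn 𝓘(ℝ, E) 𝓘(ℝ, E) ∞ G V) (hGU : MapsTo G V U) (hxV : MapsTo x U V)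
    (hxG : ∀ q ∈ V, x (G q) = q) (hGx : ∀ u ∈ U, G (x u) = u) (hf : ∀ q ∈ V, f q = y (G q))
    (hσ : ∀ u ∈ U, ∀ k, σ (x u) (P u k) = Q u (σ₀ k))
    (hs : ∀ u ∈ U, ∀ w, solder (y u) y Q u w = σ₀ (solder (x u) x P u w))
    (hc : ∀ u ∈ U, ∀ w, connForm covN (y u) y Q u w ∘L σ₀ = σ₀ ∘L connForm covM (x u) x P u w) :
    IsAffineOn covM covN f V ∧ ∀ q ∈ V, HasMFDerivAt 𝓘(ℝ, E) 𝓘(ℝ, F) f q (σ q) := by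
  have hder : ∀ q ∈ V, HasMFDerivAt 𝓘(ℝ, E) 𝓘(ℝ, F) f q (σ q) := fun q hq ↦ by
    have := (hasMFDerivAt_of_solder_eq hP hQ hV hG hxV hxG hGx hf hσ hs (hGU hq)).1
    rwa [hxG q hq] at this
  refine ⟨⟨contMDiffOn_of_comp_radial hQ hV hG hGU hf, fun X hX q hq v ↦ ?_⟩, hder⟩
  obtain ⟨u, hu, rfl⟩ : ∃ u ∈ U, x u = q := ⟨G q, hGU hq, hxG q hq⟩
  exact (DFunLike.congr_fun (hder _ hq).mfderiv _).trans
    (apply_cov_eq_covAlong hU hP hQ hV hG hGU hxV hxG hGx hf hσ hs hc hu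
      ((hX.contMDiffAt (hV.mem_nhds hq)).mdifferentiableAt (by simp))
      (fun q hq ↦ DFunLike.congr_fun (hder q hq).mfderiv _) v)

end Affine

/-! ### Existence and uniqueness of the radial data. -/

section RadialData

variable {E : Type*} [NormedAddCommGroup E] [NormedSpace ℝ E] [FiniteDimensional ℝ E]
  [CompleteSpace E]
  {M : Type*} [TopologicalSpace M] [T2Space M] [ChartedSpace E M] [IsManifold 𝓘(ℝ, E) ∞ M]
  {F : Type*} [NormedAddCommGroup F] [NormedSpace ℝ F] [FiniteDimensional ℝ F] [CompleteSpace F]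
  {N : Type*} [TopologicalSpace N] [T2Space N] [ChartedSpace F N] [IsManifold 𝓘(ℝ, F) ∞ N]
  {covM : CovariantDerivative 𝓘(ℝ, E) E (TangentSpace 𝓘(ℝ, E) : M → Type _)}
  [ContMDiffCovariantDerivative covM ∞]
  {covN : CovariantDerivative 𝓘(ℝ, F) F (TangentSpace 𝓘(ℝ, F) : N → Type _)}
  [ContMDiffCovariantDerivative covN ∞]
  {U : Set E} {V : Set M} {x₀ : M} {y₀ : N} {σ₀ : E →L[ℝ] F}
  {α : E → ℝ → M} {A : E → ℝ → E →L[ℝ] E} {β : E → ℝ → N} {B : E → ℝ → F →L[ℝ] F} {G : M → E}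
  {γ : M → ℝ → M} {μ : M → ℝ → N}

/-- On `U` the exponential map is `u ↦ α u 1`, so its smooth inverse recovers the initial velocity
from the endpoint. -/
lemma IsRadialFamily.exists_inverse (hα : IsRadialFamily covM U (.id ℝ E) x₀ α A)
    (hexp : CarriesDiffeomorphically 𝓘(ℝ, E) (covM.expMap x₀) U V) :
    ∃ G : M → E, ContMDiffOn 𝓘(ℝ, E) 𝓘(ℝ, E) ∞ G V ∧ MapsTo G V U ∧
      MapsTo (fun u ↦ α u 1) U V ∧ (∀ q ∈ V, α (G q) 1 = q) ∧ ∀ u ∈ U, G (α u 1) = u := by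
  obtain ⟨-, hbij, G, hG, hGl, hGr⟩ := hexp
  have he : ∀ u ∈ U, covM.expMap x₀ u = α u 1 := fun u hu ↦ hα.expMap_eq hu
  have hGU : MapsTo G V U := by
    intro q hq
    obtain ⟨u, hu, rfl⟩ := hbij.surjOn hq
    rw [hGl hu]
    exact hu
  refine ⟨G, hG, hGU, fun u hu ↦ ?_, fun q hq ↦ ?_, fun u hu ↦ ?_⟩
  · change α u 1 ∈ V
    rw [← he u hu]
    exact hbij.mapsTo hu
  · exact (he _ (hGU hq)).symm.trans (hGr hq)
  · exact (congrArg G (he u hu)).symm.trans (hGl hu)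

lemma IsRadialFamily.isRadialData (hU : IsOpen U) (hstar : StarConvex ℝ 0 U)
    (hα : IsRadialFamily covM U (.id ℝ E) x₀ α A) (hβ : IsRadialFamily covN U σ₀ y₀ β B)
    (hGU : MapsTo G V U) (hαG : ∀ q ∈ V, α (G q) 1 = q) :
    IsRadialData covM covN (x₀ := x₀) (y₀ := y₀) σ₀ U V (fun q ↦ α (G q)) (fun q ↦ β (G q))
      (fun q ↦ (B (G q) 1 ∘L σ₀ ∘L Ring.inverse (A (G q) 1) : E →L[ℝ] F)) := by
  intro q hq
  have hu := hGU hq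
  refine ⟨⟨hα.isGeodesicOn _ hu, ⟨G q, hu, hα.velocity_eq _ hu⟩, hαG q hq⟩,
    ⟨hβ.isGeodesicOn _ hu, G q, hα.velocity_eq _ hu, hβ.velocity_eq _ hu⟩, fun v ↦ ?_⟩
  refine ⟨Ring.inverse (A (G q) 1) v, ?_, hβ.isParallelTransport hU hstar hu _⟩
  have h1 := hα.isParallelTransport hU hstar hu (Ring.inverse (A (G q) 1) v)
  have h2 : (⟨α (G q) 1, A (G q) 1 (Ring.inverse (A (G q) 1) v)⟩ : TangentBundle 𝓘(ℝ, E) M) =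
      ⟨q, v⟩ :=
    tangentBundle_mk_eq (hαG q hq) (apply_inverse_apply (hα.isUnit _ hu 1 (by simp)) v)
  rwa [h2] at h1

/-- Radial data are determined by the families of geodesics and parallel frames. -/
lemma IsRadialData.eq_of_isRadialFamily
    (hα : IsRadialFamily covM U (.id ℝ E) x₀ α A) (hβ : IsRadialFamily covN U σ₀ y₀ β B)
    (hGα : ∀ u ∈ U, G (α u 1) = u)
    {σ : ∀ q : M, TangentSpace 𝓘(ℝ, E) q →L[ℝ] TangentSpace 𝓘(ℝ, F) (μ q 1)}
    (h : IsRadialData covM covN (x₀ := x₀) (y₀ := y₀) σ₀ U V γ μ σ) {q : M} (hq : q ∈ V) :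
    μ q 1 = β (G q) 1 ∧ ∀ k : E, (σ q (A (G q) 1 k) : F) = B (G q) 1 (σ₀ k) := by
  obtain ⟨⟨hγ, ⟨u, hu, hγv⟩, hγ1⟩, ⟨hμ, u', hγv', hμv⟩, hσ⟩ := h q hq
  have hγe := hα.eqOn_of_isGeodesicOn hu hγ hγv
  -- The endpoint `q` determines the initial velocity, because the exponential map is injective on
  -- `U`.
  have hqu : G q = u := by
    rw [← hGα u hu, ← hγe (by simp), hγ1]
  have huu : u = u' := snd_eq_of_eq_mk (hγv.symm.trans hγv')
  subst huu
  have hμe := hβ.eqOn_of_isGeodesicOn hu hμ hμv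
  subst hqu
  refine ⟨hμe (by simp), fun k ↦ ?_⟩
  obtain ⟨w, hw, hw'⟩ := hσ (A (G q) 1 k)
  have h1 : A (G q) 1 k = A (G q) 1 w := (hα.isDevelopment _ hu).snd_eq_of_isParallelTransport
    (hα.frame_zero _ hu) (hα.isUnit _ hu) hγe hw
  have h2 := (hβ.isDevelopment _ hu).snd_eq_of_isParallelTransport
    (hβ.frame_zero _ hu) (hβ.isUnit _ hu) hμe hw'
  -- Invertibility of the frame on `M` identifies the transported-back vector `w` with `k`.
  have h3 := (inverse_apply_apply (hα.isUnit _ hu 1 (by simp)) k).symm.trans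
    ((congrArg (Ring.inverse (A (G q) 1) ·) h1).trans
      (inverse_apply_apply (hα.isUnit _ hu 1 (by simp)) w))
  exact h2.trans (congrArg (fun k : E ↦ B (G q) 1 (σ₀ k)) h3.symm)

end RadialData

end

end CovariantDerivative

/-! ### The main theorem. -/

open CovariantDerivative in
theorem theorem5p1
    {E : Type*} [NormedAddCommGroup E] [NormedSpace ℝ E] [FiniteDimensional ℝ E] [CompleteSpace E]
    {M : Type*} [TopologicalSpace M] [T2Space M] [ChartedSpace E M] [IsManifold 𝓘(ℝ, E) ∞ M]
    {F : Type*} [NormedAddCommGroup F] [NormedSpace ℝ F] [FiniteDimensional ℝ F] [CompleteSpace F]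
    {N : Type*} [TopologicalSpace N] [T2Space N] [ChartedSpace F N] [IsManifold 𝓘(ℝ, F) ∞ N]
    (covM : CovariantDerivative 𝓘(ℝ, E) E (TangentSpace 𝓘(ℝ, E) : M → Type _))
    [CovariantDerivative.ContMDiffCovariantDerivative covM ∞]
    (covN : CovariantDerivative 𝓘(ℝ, F) F (TangentSpace 𝓘(ℝ, F) : N → Type _))
    [CovariantDerivative.ContMDiffCovariantDerivative covN ∞]
    (x₀ : M) (y₀ : N) (σ₀ : TangentSpace 𝓘(ℝ, E) x₀ →L[ℝ] TangentSpace 𝓘(ℝ, F) y₀)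
    (U : Set (TangentSpace 𝓘(ℝ, E) x₀)) (V : Set M)
    (hUo : IsOpen U) (hU0 : 0 ∈ U) (hUstar : StarConvex ℝ 0 U) (hVo : IsOpen V)
    (hUdom : U ⊆ covM.expDomain x₀)
    (hexp : CovariantDerivative.CarriesDiffeomorphically 𝓘(ℝ, E) (covM.expMap x₀) U V)
    (hσU : ∀ u ∈ U, σ₀ u ∈ covN.expDomain y₀) :
    (∃ (γ : M → ℝ → M) (μ : M → ℝ → N)
        (σ : ∀ x : M, TangentSpace 𝓘(ℝ, E) x →L[ℝ] TangentSpace 𝓘(ℝ, F) (μ x 1)),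
      CovariantDerivative.IsRadialData covM covN σ₀ U V γ μ σ) ∧
    ∀ (γ : M → ℝ → M) (μ : M → ℝ → N)
      (σ : ∀ x : M, TangentSpace 𝓘(ℝ, E) x →L[ℝ] TangentSpace 𝓘(ℝ, F) (μ x 1)),
      CovariantDerivative.IsRadialData covM covN σ₀ U V γ μ σ →
      (∀ x ∈ V, ∀ u v : TangentSpace 𝓘(ℝ, E) x,
        σ x (covM.torsion x u v) = covN.torsion (μ x 1) (σ x u) (σ x v)) →
      (∀ x ∈ V, ∀ u v w : TangentSpace 𝓘(ℝ, E) x,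
        σ x (covM.curvature x u v w) = covN.curvature (μ x 1) (σ x u) (σ x v) (σ x w)) →
      CovariantDerivative.IsAffineOn covM covN (fun x ↦ μ x 1) V ∧
      (∀ x ∈ V, mfderiv 𝓘(ℝ, E) 𝓘(ℝ, F) (fun x ↦ μ x 1) x = σ x) ∧
      μ x₀ 1 = y₀ ∧
      ∀ v : TangentSpace 𝓘(ℝ, E) x₀,
        tangentMap 𝓘(ℝ, E) 𝓘(ℝ, F) (fun x ↦ μ x 1) ⟨x₀, v⟩ = ⟨y₀, σ₀ v⟩ := by
  obtain ⟨α, A, hα⟩ := exists_isRadialFamily (E := E) (cov := covM) (U := U) (L := .id ℝ E) (q₀ := x₀)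
    fun u hu ↦ hUdom hu
  obtain ⟨β, B, hβ⟩ := exists_isRadialFamily (E := E) (cov := covN) (U := U) (L := σ₀) (q₀ := y₀) hσU
  obtain ⟨G, hG, hGU, hαV, hαG, hGα⟩ := hα.exists_inverse hexp
  refine ⟨⟨_, _, _, hα.isRadialData hUo hUstar hβ hGU hαG⟩, fun γ μ σ h hT hR ↦ ?_⟩
  have hdata := fun q (hq : q ∈ V) ↦ h.eq_of_isRadialFamily hα hβ hGα hq
  have hP := hα.isRadialFrame hUo hUstar
  have hQ := hβ.isRadialFrame hUo hUstar
  have hf : ∀ q ∈ V, μ q 1 = β (G q) 1 := fun q hq ↦ (hdata q hq).1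
  have hσ : ∀ u ∈ U, ∀ k : E, (σ (α u 1) (A u 1 k) : F) = B u 1 (σ₀ k) := fun u hu k ↦ by
    have := (hdata _ (hαV hu)).2 k
    rwa [hGα u hu] at this
  have hfα : ∀ u ∈ U, μ (α u 1) 1 = β u 1 := fun u hu ↦ by rw [hf _ (hαV hu), hGα u hu]
  have hforms := fun u (hu : u ∈ U) w ↦
    IsRadialFrame.solder_eq_and_connForm_eq_of_related (E := E) hUo hUstar hP hQ (f := fun q ↦ μ q 1) (σ := fun q ↦ σ q) hfα hσ (fun u hu a b ↦ hT _ (hαV hu) a b)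
    (fun u hu a b c ↦ hR _ (hαV hu) a b c) hu w
  obtain ⟨haff, hder⟩ := isAffineOn_of_forms_eq (E := E) hUo hP hQ hVo hG hGU hαV hαG hGα
    (f := fun q ↦ μ q 1) (σ := fun q ↦ σ q) hf hσ (fun u hu w ↦ (hforms u hu w).1)
    (fun u hu w ↦ (hforms u hu w).2)
  -- The direction `u = 0` gives the values at `x₀`: both base maps take the values `x₀`, `y₀`
  -- there, and both frames are the identity.
  obtain ⟨hx₀, hA₀⟩ := hα.apply_zero hUo hUstar hU0
  obtain ⟨hy₀, hB₀⟩ := hβ.apply_zero hUo hUstar hU0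
  have hx₀V : x₀ ∈ V := hx₀ ▸ hαV hU0
  have hμ₀ : μ x₀ 1 = y₀ := by
    have := hfα (0 : E) hU0
    rwa [hx₀, hy₀] at this
  refine ⟨haff, fun q hq ↦ (hder q hq).mfderiv, hμ₀, fun v ↦ ?_⟩
  -- The equality `μ x₀ 1 = y₀` is not definitional, so the differentials at `x₀` are compared as
  -- points of the tangent bundle.
  refine tangentBundle_mk_eq hμ₀ ((DFunLike.congr_fun (hder x₀ hx₀V).mfderiv v).trans ?_)
  have h0 := hσ (0 : E) hU0 v
  rw [hA₀, hB₀] at h0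
  exact (congrArg (fun q ↦ (show E →L[ℝ] F from σ q) v) hx₀).symm.trans h0
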